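/- **Corollary 4.3.** Let $M$ and $M'$ be flat manifolds, that is, compact connected Riemannian manifolds (without boundary), of dimensions $n$ and $n'$ not assumed to be equal, that are locally isometric to the Euclidean spaces $\mathbb R^n$ and $\mathbb R^{n'}$ respectively. Suppose that $M$ and $M'$ are isospectral on functions: the Laplace operators acting on smooth real functions of $M$ and of $M'$ have the same eigenvalues with the same multiplicities, i.e. for every $\lambda\in\mathbb R$ $$\dim\{f\in C^\infty(M): -\Delta_M f=\lambda f\}=\dim\{f\in C^\infty(M'): -\Delta_{M'} f=\lambda f\}.$$ Then $M$ is orientable if and only if $M'$ is orientable. -/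

import Mathlib

namespace FlatManifold

open scoped ContDiff Laplacian Manifold

/-- An isometric (flat) chart of a metric space `M`: a homeomorphism from an open subset of `M` onto
an open subset of Euclidean `n`-space that preserves distances. -/
def IsFlatChart {n : ℕ} {M : Type*} [MetricSpace M]
    (φ : OpenPartialHomeomorph M (EuclideanSpace ℝ (Fin n))) : Prop :=
  ∀ x ∈ φ.source, ∀ y ∈ φ.source, dist (φ x) (φ y) = dist x y

/-- `M` is a compact flat Riemannian `n`-manifold, in metric form: `M` is compact and connected and
every point has an open neighbourhood isometric to an open subset of Euclidean `n`-space.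
A compact connected flat Riemannian manifold satisfies this with its Riemannian distance; conversely
the isometric charts of `M` make it a smooth manifold with a flat Riemannian metric. Only the germ of
the distance along the diagonal matters for the notions below. -/
structure IsCompactFlatManifold (n : ℕ) (M : Type*) [MetricSpace M] : Prop where
  compact : CompactSpace M
  connected : ConnectedSpace M
  flat : ∀ x : M, ∃ φ : OpenPartialHomeomorph M (EuclideanSpace ℝ (Fin n)),
    IsFlatChart φ ∧ x ∈ φ.source

/-- A real function on `M` is smooth if it is smooth when read in every isometric chart. -/
def IsSmooth (n : ℕ) {M : Type*} [MetricSpace M] (f : M → ℝ) : Prop :=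
  ∀ φ : OpenPartialHomeomorph M (EuclideanSpace ℝ (Fin n)), IsFlatChart φ →
    ContDiffOn ℝ ∞ (f ∘ φ.symm) φ.target

/-- The solutions `f ∈ C^∞(M)` of `-Δ f = lam f`, where `Δ` is the Laplace-Beltrami operator of the
flat metric: in an isometric chart it is the Euclidean Laplacian. For `M` compact flat and
connected this is the eigenspace, if `lam` is an eigenvalue, and zero otherwise. -/
def laplaceEigenspace (n : ℕ) (M : Type*) [MetricSpace M] (lam : ℝ) : Submodule ℝ (M → ℝ) where
  carrier := {f | IsSmooth n f ∧
    ∀ φ : OpenPartialHomeomorph M (EuclideanSpace ℝ (Fin n)), IsFlatChart φ →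
      ∀ y ∈ φ.target, -(Δ (f ∘ φ.symm)) y = lam * f (φ.symm y)}
  zero_mem' := by
    refine ⟨fun φ _ => contDiffOn_const, fun φ _ y _ => ?_⟩
    have h : ((0 : M → ℝ) ∘ φ.symm) = fun _ => (0 : ℝ) := rfl
    rw [h, InnerProductSpace.laplacian_const]
    simp
  add_mem' := by
    rintro f g ⟨hf, hf'⟩ ⟨hg, hg'⟩
    refine ⟨fun φ hφ => (hf φ hφ).add (hg φ hφ), fun φ hφ y hy => ?_⟩
    have h : ((f + g) ∘ φ.symm) = f ∘ φ.symm + g ∘ φ.symm := rfl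
    have h1 : ContDiffAt ℝ 2 (f ∘ φ.symm) y :=
      ((hf φ hφ).contDiffAt (φ.open_target.mem_nhds hy)).of_le (by norm_cast)
    have h2 : ContDiffAt ℝ 2 (g ∘ φ.symm) y :=
      ((hg φ hφ).contDiffAt (φ.open_target.mem_nhds hy)).of_le (by norm_cast)
    have e1 := hf' φ hφ y hy
    have e2 := hg' φ hφ y hy
    rw [h, h1.laplacian_add h2, Pi.add_apply]
    linarith
  smul_mem' := by
    rintro c f ⟨hf, hf'⟩
    refine ⟨fun φ hφ => (hf φ hφ).const_smul c, fun φ hφ y hy => ?_⟩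
    have h : ((c • f) ∘ φ.symm) = c • (f ∘ φ.symm) := rfl
    have h1 : ContDiffAt ℝ 2 (f ∘ φ.symm) y :=
      ((hf φ hφ).contDiffAt (φ.open_target.mem_nhds hy)).of_le (by norm_cast)
    have e1 := hf' φ hφ y hy
    rw [h, InnerProductSpace.laplacian_smul c h1, Pi.smul_apply, smul_eq_mul, smul_eq_mul]
    linear_combination c * e1

/-- Isospectrality on functions: every real number has the same multiplicity as an eigenvalue of the
Laplacian of `M` and of `M'` (multiplicity zero meaning that it is not an eigenvalue). -/
def Isospectral (n : ℕ) (M : Type*) [MetricSpace M] (n' : ℕ) (M' : Type*) [MetricSpace M'] : Prop :=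
  ∀ lam : ℝ, Nonempty (laplaceEigenspace n M lam ≃ₗ[ℝ] laplaceEigenspace n' M' lam)

/-- A chart of `M` belonging to the smooth structure given by the isometric charts. -/
def IsSmoothChart {n : ℕ} {M : Type*} [MetricSpace M]
    (φ : OpenPartialHomeomorph M (EuclideanSpace ℝ (Fin n))) : Prop :=
  ∀ ψ : OpenPartialHomeomorph M (EuclideanSpace ℝ (Fin n)), IsFlatChart ψ →
    ContDiffOn ℝ ∞ (φ ∘ ψ.symm) (ψ.symm ≫ₕ φ).source ∧
    ContDiffOn ℝ ∞ (ψ ∘ φ.symm) (φ.symm ≫ₕ ψ).source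

/-- `M` is orientable: it is covered by a family of smooth charts whose coordinate changes all have
positive Jacobian determinant. -/
def Orientable (n : ℕ) (M : Type*) [MetricSpace M] : Prop :=
  ∃ A : Set (OpenPartialHomeomorph M (EuclideanSpace ℝ (Fin n))),
    (∀ φ ∈ A, IsSmoothChart φ) ∧
    (∀ x : M, ∃ φ ∈ A, x ∈ φ.source) ∧
    ∀ φ ∈ A, ∀ ψ ∈ A, ∀ y ∈ (φ.symm ≫ₕ ψ).source,
      0 < (fderiv ℝ (ψ ∘ φ.symm) y).det

end FlatManifold

/-!
A compact flat manifold `M` is a quotient of Euclidean space `E` by a group `Γ` of isometries that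
acts freely and cocompactly, and `M` is orientable exactly if the linear part `B` of every `γ ∈ Γ`
has positive determinant (`IsCompactFlatManifold.exists_deckGroup`). Eigenfunctions on `M` are
`Γ`-invariant eigenfunctions on `E`. So the spectrum has to be shown to determine which signs of
determinants occur in `Γ`; this is done by means of the heat trace.

*Trace formula.* Summing the Euclidean heat kernel over `Γ` gives the heat kernel of the quotient.
Integrals over the quotient are integrals over `E` against a weight `w` whose translates by `Γ`
sum up to one, so that no fundamental domain is needed. On `L²(w dx)` the kernel defines a symmetric
semigroup of Hilbert–Schmidt operators whose eigenspaces are the invariant eigenspaces of the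
Laplacian, and comparing the two expressions for the Hilbert–Schmidt norm yields
`∑ exp (-λ t) dim V_λ = ∫ w(x) ∑_γ p_t(x - γ x) dx` (`tsum_exp_mul_finrank_eq_lintegral`). Neither
elliptic regularity nor the spectral theorem for unbounded operators enters: the heat flow smooths
its argument, and at short times it recovers the Laplacian.

*Geometric side.* For an isometry `γ` one has `‖x - γ x‖² = l + ‖(1 - B) u‖²`, where `l` is
the minimal squared displacement and `u` is the component of `x` perpendicular to the axis of `γ`.
The dilation that multiplies `u` by a constant is compatible with conjugation by `Γ`, and the
integrals do not depend on the weight. Therefore, with `s = 1/4t` and `k = dim ker (1 - B)`, the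
element `γ` contributes, together with all others having the same key `(l, k)`, a positive multiple
of `s ^ (k/2) * exp (-l s)` (`lintegral_quotientHeatKernel_diag`).

*Conclusion.* The coefficients are positive, so nothing cancels, and the numbers `l` are locally
finite. Letting `s → ∞` one recovers the set of all keys (`eq_zero_of_tsum_rpow_mul_exp_eq_zero`,
`exists_isometryKey_iff`). The key of the identity gives the dimension `n`, and the determinant of
`B` is `(-1) ^ (n - k)` (`det_linearIsometryEquiv`); hence the keys tell whether `Γ` contains an
element that reverses the orientation (`forall_det_pos_iff`).

The covering `E → M` is a developing map: isometric charts of a uniform size are continued from ball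
to larger ball, consistently because an isometry of `E` is determined by its germ at a point
(`exists_forall_isLocalIso`, `eventuallyEq_of_isLocalIso`).
-/

namespace FlatManifold

open MeasureTheory Filter Topology Module
open scoped ContDiff Laplacian Manifold SchwartzMap ENNReal NNReal Real InnerProductSpace


/-! ### Gaussians and the Euclidean heat kernel -/

lemma one_add_pow_mul_exp_neg_sq_le {a : ℝ} (ha : 0 < a) (m : ℕ) {r : ℝ} (hr : 0 ≤ r) :
    (1 + r) ^ m * Real.exp (-a * r ^ 2) ≤ m.factorial / a ^ m * Real.exp (2 * a) := by
  have h1 := Real.pow_div_factorial_le_exp (a * (1 + r)) (by positivity) m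
  rw [div_le_iff₀ (by positivity), mul_pow] at h1
  have h2 : (1 + r) ^ m ≤ m.factorial / a ^ m * Real.exp (a * (1 + r)) := by
    rw [div_mul_eq_mul_div, le_div_iff₀ (by positivity)]
    linarith
  calc (1 + r) ^ m * Real.exp (-a * r ^ 2)
      ≤ m.factorial / a ^ m * Real.exp (a * (1 + r)) * Real.exp (-a * r ^ 2) := by gcongr
    _ = m.factorial / a ^ m * Real.exp (a * (1 + r) + -a * r ^ 2) := by
        rw [Real.exp_add]; ring
    _ ≤ _ := by
        gcongr
        nlinarith [sq_nonneg (r - 1)]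

section Gaussian

variable {E : Type*} [NormedAddCommGroup E] [InnerProductSpace ℝ E]

/-- The Gaussian `x ↦ exp (-a ‖x‖²)`, `a > 0`, as a Schwartz function. -/
noncomputable def gaussianSchwartz {a : ℝ} (ha : 0 < a) : 𝓢(E, ℝ) where
  toFun x := Real.exp (-a * ‖x‖ ^ 2)
  smooth' := Real.contDiff_exp.comp (contDiff_const.mul (contDiff_norm_sq ℝ))
  decay' := by
    intro k n
    have hq : Function.HasTemperateGrowth (fun x : E => -a * ‖x‖ ^ 2) :=
      (Function.HasTemperateGrowth.const (-a)).mul (Function.hasTemperateGrowth_norm_sq E)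
    obtain ⟨l, C, hC0, hC⟩ := hq.norm_iteratedFDeriv_le_uniform n
    refine ⟨n.factorial * (C + 1) ^ n * ((k + l * n).factorial / a ^ (k + l * n) *
      Real.exp (2 * a)), fun x => ?_⟩
    have hbd := norm_iteratedFDeriv_comp_le (𝕜 := ℝ) (g := Real.exp)
      (f := fun x : E => -a * ‖x‖ ^ 2) (n := n) (N := n)
      Real.contDiff_exp (contDiff_const.mul (contDiff_norm_sq ℝ)) le_rfl x
      (C := Real.exp (-a * ‖x‖ ^ 2)) (D := (C + 1) * (1 + ‖x‖) ^ l)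
      (by
        intro i _
        rw [norm_iteratedFDeriv_eq_norm_iteratedDeriv, iteratedDeriv_eq_iterate,
          Real.iter_deriv_exp]
        simp)
      (by
        intro i hi hin
        have h1 : (1 : ℝ) ≤ (C + 1) * (1 + ‖x‖) ^ l := by
          have : (1 : ℝ) ≤ (1 + ‖x‖) ^ l := one_le_pow₀ (by linarith [norm_nonneg x])
          nlinarith
        calc _ ≤ C * (1 + ‖x‖) ^ l := hC i hin x
          _ ≤ (C + 1) * (1 + ‖x‖) ^ l := by gcongr; linarith
          _ ≤ _ := le_self_pow₀ h1 (by lia))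
    have h3 := one_add_pow_mul_exp_neg_sq_le ha (k + l * n) (norm_nonneg x)
    calc ‖x‖ ^ k * ‖iteratedFDeriv ℝ n (fun x : E => Real.exp (-a * ‖x‖ ^ 2)) x‖
        ≤ (1 + ‖x‖) ^ k * (n.factorial * Real.exp (-a * ‖x‖ ^ 2) *
          ((C + 1) * (1 + ‖x‖) ^ l) ^ n) := by
          gcongr
          · linarith
          · exact hbd
      _ = n.factorial * (C + 1) ^ n * ((1 + ‖x‖) ^ (k + l * n) * Real.exp (-a * ‖x‖ ^ 2)) := by
          rw [pow_add, pow_mul, mul_pow]; ring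
      _ ≤ _ := by gcongr

@[simp] lemma gaussianSchwartz_apply {a : ℝ} (ha : 0 < a) (x : E) :
    gaussianSchwartz ha x = Real.exp (-a * ‖x‖ ^ 2) := rfl

end Gaussian

section Convolution

set_option linter.unusedSectionVars false

variable {E : Type} [NormedAddCommGroup E] [InnerProductSpace ℝ E] [FiniteDimensional ℝ E]
  [MeasurableSpace E] [BorelSpace E]

lemma integrable_bounded_smul_schwartz {F : Type*} [NormedAddCommGroup F] [NormedSpace ℝ F]
    (φ : 𝓢(E, F)) {h : E → ℝ} (hm : Measurable h) {C : ℝ} (hC : ∀ y, |h y| ≤ C) (x : E) :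
    Integrable (fun y => h y • φ (x - y)) := by
  refine Integrable.bdd_smul ((φ.integrable (μ := volume)).comp_sub_left x)
    C hm.aestronglyMeasurable (Eventually.of_forall fun y => hC y)

/-- The convolution of a bounded function with a Schwartz function is smooth; each derivative
falls on the Schwartz function. -/
lemma contDiff_integral_bounded_smul_schwartz {h : E → ℝ} (hm : Measurable h) {C : ℝ}
    (hC : ∀ y, |h y| ≤ C) (n : ℕ) {F : Type} [NormedAddCommGroup F] [NormedSpace ℝ F]
    (φ : 𝓢(E, F)) : ContDiff ℝ n (fun x => ∫ y, h y • φ (x - y)) := by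
  have key : ∀ {F : Type} [NormedAddCommGroup F] [NormedSpace ℝ F] (φ : 𝓢(E, F)) (x₀ : E),
      HasFDerivAt (fun x => ∫ y, h y • φ (x - y))
        (∫ y, h y • SchwartzMap.fderivCLM ℝ E F φ (x₀ - y)) x₀ := by
    intro F _ _ φ x₀
    set m := finrank ℝ E + 1 with hmdef
    set K : ℝ := 2 ^ m * (Finset.Iic (m, 0)).sup (fun m => SchwartzMap.seminorm ℝ m.1 m.2)
      (SchwartzMap.fderivCLM ℝ E F φ) with hK
    have hdecay : ∀ z, ‖SchwartzMap.fderivCLM ℝ E F φ z‖ ≤ K * (1 + ‖z‖) ^ (-(m : ℝ)) := by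
      intro z
      have := SchwartzMap.one_add_le_sup_seminorm_apply (𝕜 := ℝ) (m := (m, 0)) le_rfl le_rfl
        (SchwartzMap.fderivCLM ℝ E F φ) z
      rw [norm_iteratedFDeriv_zero] at this
      rw [Real.rpow_neg (by positivity), Real.rpow_natCast, ← div_eq_mul_inv,
        le_div_iff₀ (by positivity), mul_comm]
      exact this
    have hC0 : 0 ≤ C := (abs_nonneg _).trans (hC 0)
    have hK0 : 0 ≤ K := by positivity
    have hint : Integrable (fun z : E => (1 + ‖z‖) ^ (-(m : ℝ))) :=
      integrable_one_add_norm (by rw [hmdef]; push_cast; linarith)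
    refine hasFDerivAt_integral_of_dominated_of_fderiv_le (s := Metric.ball x₀ 1)
      (F' := fun x y => h y • SchwartzMap.fderivCLM ℝ E F φ (x - y))
      (bound := fun y => C * (K * (2 ^ m * (1 + ‖x₀ - y‖) ^ (-(m : ℝ)))))
      (Metric.ball_mem_nhds _ one_pos)
      (Eventually.of_forall fun x =>
        (integrable_bounded_smul_schwartz φ hm hC x).aestronglyMeasurable)
      (integrable_bounded_smul_schwartz φ hm hC x₀)
      (integrable_bounded_smul_schwartz _ hm hC x₀).aestronglyMeasurable ?_ ?_ ?_
    · refine Eventually.of_forall fun y x hx => ?_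
      rw [norm_smul]
      refine mul_le_mul (hC y) ?_ (norm_nonneg _) hC0
      refine (hdecay _).trans (mul_le_mul_of_nonneg_left ?_ hK0)
      rw [Real.rpow_neg (by positivity), Real.rpow_neg (by positivity), Real.rpow_natCast,
        Real.rpow_natCast, ← div_eq_mul_inv, le_div_iff₀ (by positivity), inv_mul_le_iff₀
        (by positivity), ← mul_pow]
      gcongr
      have h1 : ‖x₀ - y‖ ≤ ‖x - y‖ + ‖x₀ - x‖ := by
        have := norm_add_le (x - y) (x₀ - x)
        simpa using this
      have h2 : ‖x₀ - x‖ < 1 := by rw [← dist_eq_norm, dist_comm]; exact hx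
      nlinarith [norm_nonneg (x - y)]
    · exact ((((hint.comp_sub_left x₀)).const_mul _).const_mul _).const_mul _
    · refine Eventually.of_forall fun y x _ => ?_
      have h1 : HasFDerivAt (fun x => φ (x - y)) (SchwartzMap.fderivCLM ℝ E F φ (x - y)) x := by
        rw [SchwartzMap.fderivCLM_apply]
        exact (hasFDerivAt_comp_sub y).2 (φ.differentiableAt.hasFDerivAt (x := x - y))
      exact h1.const_smul (h y)
  -- the derivative is a convolution of the same kind, with values in another space
  induction n generalizing F with
  | zero =>
    rw [Nat.cast_zero, contDiff_zero]
    exact continuous_iff_continuousAt.2 fun x => (key φ x).continuousAt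
  | succ n ih =>
    rw [Nat.cast_add, Nat.cast_one, contDiff_succ_iff_hasFDerivAt]
    exact ⟨_, ih (SchwartzMap.fderivCLM ℝ E F φ), key φ⟩

/-- The heat kernel of Euclidean space, `(4πt)^(-n/2) exp (-‖z‖²/4t)`. -/
noncomputable def heatKernel (t : ℝ) (z : E) : ℝ :=
  (4 * π * t) ^ (-(finrank ℝ E : ℝ) / 2) * Real.exp (-(1 / (4 * t)) * ‖z‖ ^ 2)

variable {s t : ℝ}

lemma heatKernel_pos (ht : 0 < t) (z : E) : 0 < heatKernel t z := by
  unfold heatKernel; positivity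

lemma heatKernel_neg (t : ℝ) (z : E) : heatKernel t (-z) = heatKernel t z := by
  simp [heatKernel]

lemma heatKernel_sub_comm (t : ℝ) (x y : E) : heatKernel t (x - y) = heatKernel t (y - x) := by
  rw [← heatKernel_neg, neg_sub]

lemma heatKernel_eq_of_norm_eq (t : ℝ) {x y : E} (h : ‖x‖ = ‖y‖) :
    heatKernel t x = heatKernel t y := by
  simp [heatKernel, h]

lemma continuous_heatKernel (t : ℝ) : Continuous (heatKernel t : E → ℝ) := by
  unfold heatKernel; fun_prop

lemma heatKernel_eq_schwartz (ht : 0 < t) (z : E) :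
    heatKernel t z = (4 * π * t) ^ (-(finrank ℝ E : ℝ) / 2) *
      gaussianSchwartz (E := E) (show 0 < 1 / (4 * t) by positivity) z := rfl

lemma integral_heatKernel (ht : 0 < t) : ∫ z : E, heatKernel t z = 1 := by
  have hb : 0 < 1 / (4 * t) := by positivity
  unfold heatKernel
  rw [integral_const_mul, GaussianFourier.integral_rexp_neg_mul_sq_norm hb,
    show π / (1 / (4 * t)) = 4 * π * t by field_simp, ← Real.rpow_add (by positivity)]
  rw [neg_div, neg_add_cancel, Real.rpow_zero]

lemma integrable_heatKernel (ht : 0 < t) : Integrable (heatKernel t : E → ℝ) := by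
  have := integral_heatKernel (E := E) ht
  by_contra h
  rw [integral_undef h] at this
  exact zero_ne_one this

lemma lintegral_heatKernel (ht : 0 < t) :
    ∫⁻ z : E, ENNReal.ofReal (heatKernel t z) = 1 := by
  rw [← ofReal_integral_eq_lintegral_ofReal (integrable_heatKernel ht)
    (Eventually.of_forall fun z => (heatKernel_pos ht z).le), integral_heatKernel ht,
    ENNReal.ofReal_one]

/-- Semigroup property of the heat kernel. The exponents combine by completing the square around
`c = (t x + s z)/(s+t)`. -/
lemma lintegral_heatKernel_mul (hs : 0 < s) (ht : 0 < t) (x z : E) :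
    ∫⁻ y : E, ENNReal.ofReal (heatKernel s (x - y)) * ENNReal.ofReal (heatKernel t (y - z)) =
      ENNReal.ofReal (heatKernel (s + t) (x - z)) := by
  set r := s * t / (s + t) with hr
  have hr0 : 0 < r := by positivity
  set c : E := (t / (s + t)) • x + (s / (s + t)) • z with hc
  have key : ∀ y : E, heatKernel s (x - y) * heatKernel t (y - z) =
      heatKernel (s + t) (x - z) * heatKernel r (y - c) := by
    intro y
    have e1 : ‖x - z‖ ^ 2 = ‖x - y‖ ^ 2 + 2 * ⟪x - y, y - z⟫_ℝ + ‖y - z‖ ^ 2 := by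
      rw [← norm_add_sq_real]; simp
    have e2 : y - c = (s / (s + t)) • (y - z) - (t / (s + t)) • (x - y) := by
      have : y = (s / (s + t)) • y + (t / (s + t)) • y := by
        rw [← add_smul, ← add_div, div_self (by positivity), one_smul]
      rw [hc]
      nth_rewrite 1 [this]
      simp only [smul_sub]
      abel
    have e3 : ‖y - c‖ ^ 2 = (s / (s + t)) ^ 2 * ‖y - z‖ ^ 2 -
        2 * (s / (s + t)) * (t / (s + t)) * ⟪x - y, y - z⟫_ℝ
        + (t / (s + t)) ^ 2 * ‖x - y‖ ^ 2 := by
      rw [e2, norm_sub_sq_real, norm_smul, norm_smul, inner_smul_left, inner_smul_right,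
        real_inner_comm, mul_pow, mul_pow, Real.norm_eq_abs, Real.norm_eq_abs, sq_abs, sq_abs]
      simp
      ring
    have e4 : -(1 / (4 * s)) * ‖x - y‖ ^ 2 + -(1 / (4 * t)) * ‖y - z‖ ^ 2 =
        -(1 / (4 * (s + t))) * ‖x - z‖ ^ 2 + -(1 / (4 * r)) * ‖y - c‖ ^ 2 := by
      rw [e3, e1, hr]
      field_simp
      ring
    unfold heatKernel
    rw [mul_mul_mul_comm, mul_mul_mul_comm ((4 * π * (s + t)) ^ _), ← Real.exp_add, ← Real.exp_add, e4]
    congr 1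
    rw [← Real.mul_rpow (by positivity) (by positivity),
      ← Real.mul_rpow (by positivity) (by positivity)]
    congr 1
    rw [hr]
    field_simp
  have h1 : ∀ y : E, ENNReal.ofReal (heatKernel s (x - y)) *
      ENNReal.ofReal (heatKernel t (y - z)) =
      ENNReal.ofReal (heatKernel (s + t) (x - z)) * ENNReal.ofReal (heatKernel r (y - c)) := by
    intro y
    rw [← ENNReal.ofReal_mul (heatKernel_pos hs _).le, key,
      ENNReal.ofReal_mul (heatKernel_pos (by positivity) _).le]
  simp_rw [h1]
  rw [lintegral_const_mul' _ _ ENNReal.ofReal_ne_top,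
    lintegral_sub_right_eq_self (fun y : E => ENNReal.ofReal (heatKernel r y)) c,
    lintegral_heatKernel hr0, mul_one]

/-- The heat flow `P_t f = p_t * f` on functions on Euclidean space. -/
noncomputable def heatFlow (t : ℝ) (f : E → ℝ) (x : E) : ℝ := ∫ y, heatKernel t (x - y) * f y

lemma contDiff_heatFlow (ht : 0 < t) {f : E → ℝ} (hm : Measurable f) {C : ℝ}
    (hC : ∀ y, |f y| ≤ C) : ContDiff ℝ ∞ (heatFlow t f) := by
  rw [contDiff_infty]
  intro n
  have hb : 0 < 1 / (4 * t) := by positivity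
  have e : heatFlow t f = fun x => (4 * π * t) ^ (-(finrank ℝ E : ℝ) / 2) *
      ∫ y, f y • gaussianSchwartz (E := E) hb (x - y) := by
    funext x
    rw [heatFlow, ← integral_const_mul]
    congr 1
    funext y
    rw [heatKernel_eq_schwartz ht, smul_eq_mul]
    ring
  rw [e]
  exact contDiff_const.mul (contDiff_integral_bounded_smul_schwartz hm hC n _)

end Convolution


/-! ### The heat flow of eigenfunctions of the Laplacian -/

section HeatFlow

set_option linter.unusedSectionVars false

variable {E : Type} [NormedAddCommGroup E] [InnerProductSpace ℝ E] [FiniteDimensional ℝ E]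
  [MeasurableSpace E] [BorelSpace E]

lemma integrable_heatKernel_mul_bounded {t : ℝ} (ht : 0 < t) {g : E → ℝ} (hg : Continuous g)
    {C : ℝ} (hC : ∀ z, |g z| ≤ C) : Integrable (fun z => heatKernel t z * g z) :=
  (integrable_heatKernel ht).mul_bdd hg.aestronglyMeasurable (Eventually.of_forall hC)

lemma integrable_norm_mul_heatKernel {t : ℝ} (ht : 0 < t) :
    Integrable (fun z : E => ‖z‖ * heatKernel t z) := by
  have h := ((gaussianSchwartz (E := E) (show 0 < 1 / (4 * t) by positivity)).integrable_pow_mul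
    volume 1).const_mul ((4 * π * t) ^ (-(finrank ℝ E : ℝ) / 2))
  refine h.congr (Eventually.of_forall fun z => ?_)
  simp only [pow_one, heatKernel, gaussianSchwartz_apply, Real.norm_eq_abs, Real.abs_exp]
  ring

lemma hasFDerivAt_heatKernel (t : ℝ) (z : E) :
    HasFDerivAt (heatKernel t) ((-(1 / (2 * t)) * heatKernel t z) • innerSL ℝ z) z := by
  unfold heatKernel
  have h := (((hasStrictFDerivAt_norm_sq z).hasFDerivAt.const_mul (-(1 / (4 * t)))).exp).const_mul
    ((4 * π * t) ^ (-(finrank ℝ E : ℝ) / 2))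
  convert! h using 1
  ext v
  simp
  ring

lemma fderiv_heatKernel_apply (t : ℝ) (z v : E) :
    fderiv ℝ (heatKernel t) z v = -(1 / (2 * t)) * heatKernel t z * ⟪z, v⟫_ℝ := by
  rw [(hasFDerivAt_heatKernel t z).fderiv]
  simp

/-- In the variable `z = (y - x)/τ` the heat flow at time `τ²` is an average against a fixed
Gaussian. This form makes sense for all real `τ`. -/
lemma heatFlow_sq {τ : ℝ} (hτ : 0 < τ) (f : E → ℝ) (x : E) :
    heatFlow (τ ^ 2) f x = ∫ z, heatKernel 1 z * f (x + τ • z) := by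
  have h1 : ∀ z : E, heatKernel 1 z = τ ^ (finrank ℝ E) * heatKernel (τ ^ 2) (τ • z) := by
    intro z
    unfold heatKernel
    rw [norm_smul, Real.norm_eq_abs, abs_of_pos hτ, mul_one,
      Real.mul_rpow (x := 4 * π) (y := τ ^ 2) (by positivity) (by positivity),
      mul_pow, neg_div, ← Real.rpow_natCast_mul hτ.le, Nat.cast_ofNat,
      show (2 : ℝ) * -((finrank ℝ E : ℝ) / 2) = -(finrank ℝ E : ℝ) by ring,
      Real.rpow_neg hτ.le, Real.rpow_natCast]
    have : -(1 / (4 * τ ^ 2)) * (τ ^ 2 * ‖z‖ ^ 2) = -(1 / 4) * ‖z‖ ^ 2 := by field_simp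
    rw [this]
    field_simp
  simp_rw [h1, mul_assoc]
  rw [integral_const_mul,
    Measure.integral_comp_smul volume (fun w : E => heatKernel (τ ^ 2) w * f (x + w)) τ,
    smul_eq_mul, abs_of_pos (by positivity), mul_inv_cancel_left₀ (by positivity), heatFlow,
    ← integral_add_left_eq_self (fun y => heatKernel (τ ^ 2) (x - y) * f y) x]
  congr 1
  funext w
  rw [sub_add_cancel_left, heatKernel_neg]

variable {f : E → ℝ}

/-- The derivative with respect to the square root `τ` of the time; integration by parts turns it
into `2 τ` times the heat flow of the Laplacian. -/
lemma hasDerivAt_integral_heatKernel_mul (hf : ContDiff ℝ 2 f) {C₀ C₁ : ℝ}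
    (h0 : ∀ x, |f x| ≤ C₀) (h1 : ∀ x, ‖fderiv ℝ f x‖ ≤ C₁) (x : E) (τ : ℝ) :
    HasDerivAt (fun τ : ℝ => ∫ z, heatKernel 1 z * f (x + τ • z))
      (∫ z, heatKernel 1 z * fderiv ℝ f (x + τ • z) z) τ := by
  have hc : ∀ τ : ℝ, Continuous fun z : E => f (x + τ • z) := fun τ =>
    hf.continuous.comp (by fun_prop)
  have hc' : Continuous (fderiv ℝ f) := hf.continuous_fderiv (by norm_num)
  refine (hasDerivAt_integral_of_dominated_loc_of_deriv_le (s := Set.univ)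
    (bound := fun z => C₁ * (‖z‖ * heatKernel 1 z)) univ_mem
    (F := fun (τ : ℝ) z => heatKernel 1 z * f (x + τ • z))
    (F' := fun (τ : ℝ) z => heatKernel 1 z * fderiv ℝ f (x + τ • z) z)
    (Eventually.of_forall fun τ => (integrable_heatKernel_mul_bounded one_pos (hc τ)
      (fun z => h0 _)).aestronglyMeasurable)
    (integrable_heatKernel_mul_bounded one_pos (hc τ) (fun z => h0 _)) ?_ ?_ ?_ ?_).2
  · refine Continuous.aestronglyMeasurable ((continuous_heatKernel 1).mul ?_)
    exact (hc'.comp (by fun_prop)).clm_apply continuous_id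
  · refine Eventually.of_forall fun z r _ => ?_
    rw [norm_mul, Real.norm_eq_abs, abs_of_pos (heatKernel_pos one_pos z)]
    have : ‖fderiv ℝ f (x + r • z) z‖ ≤ C₁ * ‖z‖ :=
      (ContinuousLinearMap.le_opNorm _ _).trans (by gcongr; exact h1 _)
    nlinarith [heatKernel_pos one_pos z]
  · exact (integrable_norm_mul_heatKernel one_pos).const_mul C₁
  · refine Eventually.of_forall fun z r _ => ?_
    have hl : HasDerivAt (fun τ : ℝ => x + τ • z) z r := by
      simpa using ((hasDerivAt_id r).smul_const z).const_add x
    exact (((hf.differentiable (by norm_num)).differentiableAt.hasFDerivAt).comp_hasDerivAt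
      r hl).const_mul _

lemma laplacian_eq_sum_fderiv (f : E → ℝ) (x : E) :
    (Δ f) x = ∑ i, fderiv ℝ (fderiv ℝ f) x (stdOrthonormalBasis ℝ E i)
      (stdOrthonormalBasis ℝ E i) := by
  rw [InnerProductSpace.laplacian_eq_iteratedFDeriv_stdOrthonormalBasis]
  simp [iteratedFDeriv_two_apply]

lemma continuous_laplacian (hf : ContDiff ℝ 2 f) : Continuous (Δ f) := by
  have hf' : ContDiff ℝ 1 (fderiv ℝ f) := hf.fderiv_right (by norm_num)
  have hc2 : Continuous (fderiv ℝ (fderiv ℝ f)) := hf'.continuous_fderiv (by norm_num)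
  rw [funext (laplacian_eq_sum_fderiv f)]
  fun_prop

lemma exists_abs_laplacian_le {C₂ : ℝ} (h2 : ∀ x, ‖fderiv ℝ (fderiv ℝ f) x‖ ≤ C₂) :
    ∃ C, ∀ x, |(Δ f) x| ≤ C := by
  refine ⟨∑ _i : Fin (finrank ℝ E), C₂, fun x => ?_⟩
  rw [laplacian_eq_sum_fderiv]
  refine (Finset.abs_sum_le_sum_abs _ _).trans (Finset.sum_le_sum fun i _ => ?_)
  have := ContinuousLinearMap.le_opNorm₂ (fderiv ℝ (fderiv ℝ f) x)
    (stdOrthonormalBasis ℝ E i) (stdOrthonormalBasis ℝ E i)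
  rw [(stdOrthonormalBasis ℝ E).norm_eq_one, mul_one, mul_one] at this
  exact this.trans (h2 _)

/-- Gaussian integration by parts, applied to the gradient of `f`. -/
lemma integral_heatKernel_mul_fderiv (hf : ContDiff ℝ 2 f) {C₁ C₂ : ℝ}
    (h1 : ∀ x, ‖fderiv ℝ f x‖ ≤ C₁) (h2 : ∀ x, ‖fderiv ℝ (fderiv ℝ f) x‖ ≤ C₂) (x : E) (τ : ℝ) :
    ∫ z, heatKernel 1 z * fderiv ℝ f (x + τ • z) z =
      2 * τ * ∫ z, heatKernel 1 z * (Δ f) (x + τ • z) := by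
  set b := stdOrthonormalBasis ℝ E
  have hl : ∀ z : E, HasFDerivAt (fun z : E => x + τ • z) (τ • ContinuousLinearMap.id ℝ E) z :=
    fun z => ((hasFDerivAt_id z).const_smul τ).const_add x
  have hf' : ContDiff ℝ 1 (fderiv ℝ f) := hf.fderiv_right (by norm_num)
  have hc1 : Continuous (fderiv ℝ f) := hf'.continuous
  have hc2 : Continuous (fderiv ℝ (fderiv ℝ f)) := hf'.continuous_fderiv (by norm_num)
  have hg : ∀ i (z : E), HasFDerivAt (fun z : E => fderiv ℝ f (x + τ • z) (b i))
      (((fderiv ℝ (fderiv ℝ f) (x + τ • z)).comp (τ • ContinuousLinearMap.id ℝ E)).flip (b i))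
      z := by
    intro i z
    have h := ((hf'.differentiable (by norm_num)).differentiableAt.hasFDerivAt
      (x := x + τ • z)).comp z (hl z)
    exact (h.clm_apply (hasFDerivAt_const (b i) z)).congr_fderiv (by ext v; simp)
  have hgv : ∀ i (z : E), fderiv ℝ (fun z : E => fderiv ℝ f (x + τ • z) (b i)) z (b i) =
      τ * fderiv ℝ (fderiv ℝ f) (x + τ • z) (b i) (b i) := by
    intro i z
    rw [(hg i z).fderiv]
    simp
  have hb1 : ∀ i (z : E), |fderiv ℝ f (x + τ • z) (b i)| ≤ C₁ := fun i z => by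
    have := ContinuousLinearMap.le_opNorm (fderiv ℝ f (x + τ • z)) (b i)
    rw [b.norm_eq_one, mul_one] at this
    exact this.trans (h1 _)
  have hb2 : ∀ i (z : E), |fderiv ℝ (fderiv ℝ f) (x + τ • z) (b i) (b i)| ≤ C₂ := fun i z => by
    have := ContinuousLinearMap.le_opNorm₂ (fderiv ℝ (fderiv ℝ f) (x + τ • z)) (b i) (b i)
    rw [b.norm_eq_one, mul_one, mul_one] at this
    exact this.trans (h2 _)
  have hcl : Continuous fun z : E => x + τ • z := by fun_prop
  have hci1 : ∀ i, Continuous fun z : E => fderiv ℝ f (x + τ • z) (b i) := fun i =>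
    (hc1.comp hcl).clm_apply continuous_const
  have hci2 : ∀ i, Continuous fun z : E => fderiv ℝ (fderiv ℝ f) (x + τ • z) (b i) (b i) :=
    fun i => ((hc2.comp hcl).clm_apply continuous_const).clm_apply continuous_const
  have hC1 : 0 ≤ C₁ := (norm_nonneg _).trans (h1 0)
  have hint : ∀ i, Integrable fun z : E =>
      heatKernel 1 z * (⟪z, b i⟫_ℝ * fderiv ℝ f (x + τ • z) (b i)) := by
    intro i
    refine ((integrable_norm_mul_heatKernel one_pos).const_mul C₁).mono'
      (((continuous_heatKernel 1).mul ((by fun_prop : Continuous fun z : E =>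
        ⟪z, b i⟫_ℝ).mul (hci1 i))).aestronglyMeasurable) (Eventually.of_forall fun z => ?_)
    rw [norm_mul, norm_mul, Real.norm_eq_abs, abs_of_pos (heatKernel_pos one_pos z)]
    have e1 : ‖⟪z, b i⟫_ℝ‖ ≤ ‖z‖ := by
      simpa using norm_inner_le_norm (𝕜 := ℝ) z (b i)
    have e2 : ‖⟪z, b i⟫_ℝ‖ * ‖fderiv ℝ f (x + τ • z) (b i)‖ ≤ ‖z‖ * C₁ :=
      mul_le_mul e1 (hb1 i z) (norm_nonneg _) (norm_nonneg _)
    nlinarith [heatKernel_pos one_pos z]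
  have hparts : ∀ i, ∫ z : E, heatKernel 1 z * (⟪z, b i⟫_ℝ * fderiv ℝ f (x + τ • z) (b i)) =
      2 * τ * ∫ z : E, heatKernel 1 z * fderiv ℝ (fderiv ℝ f) (x + τ • z) (b i) (b i) := by
    intro i
    have h := integral_mul_fderiv_eq_neg_fderiv_mul_of_integrable (μ := (volume : Measure E))
      (f := fun z : E => fderiv ℝ f (x + τ • z) (b i)) (g := heatKernel 1) (v := b i)
      (by
        simp_rw [hgv]
        simp_rw [mul_assoc]
        refine Integrable.const_mul ?_ τ
        simp_rw [mul_comm _ (heatKernel 1 _)]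
        exact integrable_heatKernel_mul_bounded one_pos (hci2 i) (hb2 i))
      (by
        simp_rw [fderiv_heatKernel_apply]
        refine ((hint i).const_mul (-(1 / (2 * 1)))).congr (Eventually.of_forall fun z => ?_)
        ring)
      (by
        simp_rw [mul_comm _ (heatKernel 1 _)]
        exact integrable_heatKernel_mul_bounded one_pos (hci1 i) (hb1 i))
      (fun z _ => (hg i z).differentiableAt)
      (fun z _ => (hasFDerivAt_heatKernel 1 z).differentiableAt)
    simp_rw [hgv, fderiv_heatKernel_apply] at h
    rw [← integral_const_mul]
    have e1 : ∫ z : E, heatKernel 1 z * (⟪z, b i⟫_ℝ * fderiv ℝ f (x + τ • z) (b i)) =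
        (-2) * ∫ z : E, fderiv ℝ f (x + τ • z) (b i) *
          (-(1 / (2 * 1)) * heatKernel 1 z * ⟪z, b i⟫_ℝ) := by
      rw [← integral_const_mul]
      congr 1; funext z; ring
    rw [e1, h, mul_neg, neg_mul, neg_neg, ← integral_const_mul]
    congr 1; funext z; ring
  have hsum : ∀ z : E, heatKernel 1 z * fderiv ℝ f (x + τ • z) z =
      ∑ i, heatKernel 1 z * (⟪z, b i⟫_ℝ * fderiv ℝ f (x + τ • z) (b i)) := by
    intro z
    rw [← Finset.mul_sum]
    congr 1
    have h : (fderiv ℝ f (x + τ • z)) (∑ i, ⟪b i, z⟫_ℝ • b i) =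
        ∑ i, ⟪z, b i⟫_ℝ * fderiv ℝ f (x + τ • z) (b i) := by
      rw [map_sum]
      refine Finset.sum_congr rfl fun i _ => ?_
      rw [map_smul, smul_eq_mul, real_inner_comm]
    rwa [b.sum_repr'] at h
  have hlap : ∀ z : E, heatKernel 1 z * (Δ f) (x + τ • z) =
      ∑ i, heatKernel 1 z * fderiv ℝ (fderiv ℝ f) (x + τ • z) (b i) (b i) := by
    intro z
    rw [← Finset.mul_sum, laplacian_eq_sum_fderiv]
  simp_rw [hsum, hlap]
  rw [integral_finsetSum _ (fun i _ => hint i), integral_finsetSum _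
    (fun i _ => integrable_heatKernel_mul_bounded one_pos (hci2 i) (hb2 i)), Finset.mul_sum]
  exact Finset.sum_congr rfl fun i _ => hparts i

/-- The heat flow multiplies a (bounded, with bounded derivatives) solution of `-Δ f = λ f`
by `exp (-λ t)`. -/
lemma heatFlow_eq_exp_mul (hf : ContDiff ℝ 2 f) {C₀ C₁ C₂ : ℝ} (h0 : ∀ x, |f x| ≤ C₀)
    (h1 : ∀ x, ‖fderiv ℝ f x‖ ≤ C₁) (h2 : ∀ x, ‖fderiv ℝ (fderiv ℝ f) x‖ ≤ C₂) {lam : ℝ}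
    (hlam : ∀ x, -(Δ f) x = lam * f x) {t : ℝ} (ht : 0 < t) (x : E) :
    heatFlow t f x = Real.exp (-lam * t) * f x := by
  set u : ℝ → ℝ := fun τ => ∫ z, heatKernel 1 z * f (x + τ • z) with hu
  have hu' : ∀ τ, HasDerivAt u (-(2 * τ * lam) * u τ) τ := by
    intro τ
    have h := hasDerivAt_integral_heatKernel_mul hf h0 h1 x τ
    rw [integral_heatKernel_mul_fderiv hf h1 h2] at h
    convert! h using 1
    have : ∀ z, heatKernel 1 z * (Δ f) (x + τ • z) = (-lam) * (heatKernel 1 z * f (x + τ • z)) := by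
      intro z
      have := hlam (x + τ • z)
      linear_combination (-heatKernel 1 z) * this
    simp_rw [this]
    rw [integral_const_mul]
    ring
  have hv : ∀ τ, HasDerivAt (fun τ => Real.exp (lam * τ ^ 2) * u τ) 0 τ := by
    intro τ
    have h := (((hasDerivAt_pow 2 τ).const_mul lam).exp).mul (hu' τ)
    convert! h using 1
    push_cast
    ring
  have hconst := is_const_of_deriv_eq_zero (fun τ => (hv τ).differentiableAt)
    (fun τ => (hv τ).deriv) (√t) 0
  have hu0 : u 0 = f x := by
    simp only [hu, zero_smul, add_zero]
    rw [integral_mul_const, integral_heatKernel one_pos, one_mul]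
  have hut : heatFlow t f x = u (√t) := by
    rw [← Real.sq_sqrt ht.le, heatFlow_sq (Real.sqrt_pos.2 ht), Real.sq_sqrt ht.le]
  simp only [hu0, Real.sq_sqrt ht.le] at hconst
  rw [zero_pow two_ne_zero, mul_zero, Real.exp_zero, one_mul] at hconst
  rw [hut, ← hconst, ← mul_assoc, ← Real.exp_add, neg_mul, neg_add_cancel, Real.exp_zero, one_mul]

/-- Conversely, a bounded function with bounded derivatives that is multiplied by `exp (-λ t)` by
the heat flow for a sequence of times tending to zero solves `-Δ f = λ f`. -/
lemma neg_laplacian_eq_of_heatFlow_eq (hf : ContDiff ℝ 2 f) {C₀ C₁ C₂ : ℝ}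
    (h0 : ∀ x, |f x| ≤ C₀) (h1 : ∀ x, ‖fderiv ℝ f x‖ ≤ C₁)
    (h2 : ∀ x, ‖fderiv ℝ (fderiv ℝ f) x‖ ≤ C₂) {lam : ℝ}
    {s : ℕ → ℝ} (hs : ∀ k, 0 < s k) (hs0 : Tendsto s atTop (𝓝 0))
    (hflow : ∀ k x, heatFlow (s k) f x = Real.exp (-lam * s k) * f x) (x : E) :
    -(Δ f) x = lam * f x := by
  have hcΔ : Continuous (Δ f) := continuous_laplacian hf
  obtain ⟨C₃, h3⟩ := exists_abs_laplacian_le h2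
  set u : ℝ → ℝ := fun τ => ∫ z, heatKernel 1 z * f (x + τ • z) with hu
  set w : ℝ → ℝ := fun τ => ∫ z, heatKernel 1 z * (Δ f) (x + τ • z) with hw
  have hu' : ∀ τ, HasDerivAt u (2 * τ * w τ) τ := by
    intro τ
    have h := hasDerivAt_integral_heatKernel_mul hf h0 h1 x τ
    rwa [integral_heatKernel_mul_fderiv hf h1 h2] at h
  have hu0 : u 0 = f x := by
    simp only [hu, zero_smul, add_zero]
    rw [integral_mul_const, integral_heatKernel one_pos, one_mul]
  have hw0 : w 0 = (Δ f) x := by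
    simp only [hw, zero_smul, add_zero]
    rw [integral_mul_const, integral_heatKernel one_pos, one_mul]
  have hwc : Continuous w := by
    refine continuous_of_dominated (bound := fun z => C₃ * heatKernel 1 z)
      (fun τ => ((continuous_heatKernel 1).mul
        (hcΔ.comp (by fun_prop))).aestronglyMeasurable) (fun τ => Eventually.of_forall fun z => ?_)
      ((integrable_heatKernel one_pos).const_mul _)
      (Eventually.of_forall fun z => continuous_const.mul (hcΔ.comp (by fun_prop)))
    rw [norm_mul, Real.norm_eq_abs, Real.norm_eq_abs, abs_of_pos (heatKernel_pos one_pos z),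
      mul_comm]
    exact mul_le_mul_of_nonneg_right (h3 _) (heatKernel_pos one_pos z).le
  -- Cauchy's mean value theorem for `u` and `τ ↦ τ²` on `[0, √(s k)]`
  have hmv : ∀ k, ∃ c ∈ Set.Ioo 0 (√(s k)), w c = (Real.exp (-lam * s k) - 1) / s k * f x := by
    intro k
    have hsq := Real.sqrt_pos.2 (hs k)
    obtain ⟨c, hc, h⟩ := exists_ratio_hasDerivAt_eq_ratio_slope u (fun τ => 2 * τ * w τ) hsq
      (fun τ _ => (hu' τ).continuousAt.continuousWithinAt) (fun τ _ => hu' τ)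
      (fun τ => τ ^ 2) (fun τ => 2 * τ) (by fun_prop)
      (fun τ _ => by simpa using hasDerivAt_pow 2 τ)
    refine ⟨c, hc, ?_⟩
    have hus : u (√(s k)) = Real.exp (-lam * s k) * f x := by
      rw [← hflow, ← Real.sq_sqrt (hs k).le, heatFlow_sq hsq, Real.sq_sqrt (hs k).le]
    simp only [hus, hu0, Real.sq_sqrt (hs k).le] at h
    have hc0 : c ≠ 0 := hc.1.ne'
    have hsk := (hs k).ne'
    field_simp
    have : 2 * c * (s k * w c - (Real.exp (-lam * s k) - 1) * f x) = 0 := by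
      linear_combination h
    have h' := (mul_eq_zero.1 this).resolve_left (by simpa using hc0)
    have e : -(lam * s k) = -lam * s k := by ring
    simp only [e]
    linear_combination h'
  choose c hc hwc' using hmv
  have hc0 : Tendsto c atTop (𝓝 0) := by
    have : Tendsto (fun k => √(s k)) atTop (𝓝 0) := by
      simpa [Function.comp_def] using (Real.continuous_sqrt.tendsto 0).comp hs0
    exact squeeze_zero (fun k => (hc k).1.le) (fun k => (hc k).2.le) this
  have lim1 : Tendsto (fun k => w (c k)) atTop (𝓝 ((Δ f) x)) := by
    rw [← hw0]
    exact (hwc.tendsto 0).comp hc0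
  have lim2 : Tendsto (fun k => w (c k)) atTop (𝓝 (-lam * f x)) := by
    simp_rw [hwc']
    refine Tendsto.mul_const _ ?_
    have hd : HasDerivAt (fun r => Real.exp (-lam * r)) (-lam) 0 := by
      simpa using ((hasDerivAt_id (0 : ℝ)).const_mul (-lam)).exp
    have := hasDerivAt_iff_tendsto_slope_zero.1 hd
    have h' := this.comp (tendsto_nhdsWithin_iff.2 ⟨hs0, Eventually.of_forall fun k => (hs k).ne'⟩)
    refine h'.congr fun k => ?_
    simp [div_eq_inv_mul]
  have := tendsto_nhds_unique lim1 lim2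
  linarith

end HeatFlow


/-! ### Free cocompact groups of isometries and their heat kernels -/

/-- A group of isometries of Euclidean space acting freely, with displacements bounded away from
zero, and cocompactly. These are the deck groups of compact flat manifolds. -/
structure IsFreeCocompact {E : Type*} [NormedAddCommGroup E] [InnerProductSpace ℝ E]
    (Γ : Subgroup (E ≃ᵃⁱ[ℝ] E)) : Prop where
  exists_sep : ∃ ρ > 0, ∀ γ ∈ Γ, γ ≠ 1 → ∀ x, ρ ≤ dist x (γ x)
  exists_radius : ∃ R, ∀ x, ∃ γ ∈ Γ, ‖γ x‖ < R

/-- A measurable partition of unity for `Γ`: the translates of `w` sum up to one. For a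
`Γ`-invariant function `f`, the integral of `w f` is the integral of `f` over the quotient by `Γ`;
the indicator function of a fundamental domain is an example. -/
structure IsWeight {E : Type*} [NormedAddCommGroup E] [InnerProductSpace ℝ E] [MeasurableSpace E]
    (Γ : Subgroup (E ≃ᵃⁱ[ℝ] E)) (w : E → ℝ≥0∞) : Prop where
  measurable : Measurable w
  tsum_eq_one : ∀ x, ∑' γ : Γ, w ((γ : E ≃ᵃⁱ[ℝ] E) x) = 1

section Group

set_option linter.unusedSectionVars false

variable {E : Type} [NormedAddCommGroup E] [InnerProductSpace ℝ E] [FiniteDimensional ℝ E]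
  [MeasurableSpace E] [BorelSpace E] {Γ : Subgroup (E ≃ᵃⁱ[ℝ] E)}

lemma affineIsometryEquiv_measurePreserving (g : E ≃ᵃⁱ[ℝ] E) :
    MeasurePreserving g (volume : Measure E) volume := by
  have h : (g : E → E) = (fun x => x + g 0) ∘ g.linearIsometryEquiv := by
    funext x
    have := g.map_vadd 0 x
    simpa using this
  rw [h]
  exact (measurePreserving_add_right volume (g 0)).comp g.linearIsometryEquiv.measurePreserving

lemma lintegral_comp_affineIsometryEquiv (g : E ≃ᵃⁱ[ℝ] E) (f : E → ℝ≥0∞) :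
    ∫⁻ x, f (g x) = ∫⁻ x, f x :=
  (affineIsometryEquiv_measurePreserving g).lintegral_comp_emb
    g.toHomeomorph.measurableEmbedding f

lemma IsFreeCocompact.exists_sep_orbit (hΓ : IsFreeCocompact Γ) :
    ∃ ρ > 0, ∀ γ δ : Γ, γ ≠ δ → ∀ x, ρ ≤ dist ((γ : E ≃ᵃⁱ[ℝ] E) x) ((δ : E ≃ᵃⁱ[ℝ] E) x) := by
  obtain ⟨ρ, hρ, h⟩ := hΓ.exists_sep
  refine ⟨ρ, hρ, fun γ δ hne x => ?_⟩
  have h1 := h (γ⁻¹ * δ) (mul_mem (inv_mem γ.2) δ.2)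
    (fun e => hne (Subtype.ext (inv_mul_eq_one.1 e))) x
  rw [← (γ : E ≃ᵃⁱ[ℝ] E).dist_map] at h1
  have h2 : (γ : E ≃ᵃⁱ[ℝ] E) ((((γ⁻¹ : Γ) : E ≃ᵃⁱ[ℝ] E) * (δ : E ≃ᵃⁱ[ℝ] E)) x) =
      (δ : E ≃ᵃⁱ[ℝ] E) x :=
    (γ : E ≃ᵃⁱ[ℝ] E).apply_symm_apply _
  rwa [h2] at h1

lemma pairwise_disjoint_ball_orbit {ρ : ℝ}
    (h : ∀ γ δ : Γ, γ ≠ δ → ∀ x, ρ ≤ dist ((γ : E ≃ᵃⁱ[ℝ] E) x) ((δ : E ≃ᵃⁱ[ℝ] E) x)) (x : E) :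
    Pairwise (Function.onFun Disjoint
      fun γ : Γ => Metric.ball ((γ : E ≃ᵃⁱ[ℝ] E) x) (ρ / 2)) := by
  intro γ δ hne
  exact Metric.ball_disjoint_ball (by linarith [h γ δ hne x])

lemma IsFreeCocompact.countable (hΓ : IsFreeCocompact Γ) : Countable Γ := by
  obtain ⟨ρ, hρ, h⟩ := hΓ.exists_sep_orbit
  have h1 : (Set.univ : Set Γ).PairwiseDisjoint
      fun γ : Γ => Metric.ball ((γ : E ≃ᵃⁱ[ℝ] E) (0 : E)) (ρ / 2) :=
    fun γ _ δ _ hne => pairwise_disjoint_ball_orbit h 0 hne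
  exact Set.countable_univ_iff.1 (h1.countable_of_isOpen (fun _ _ => Metric.isOpen_ball)
    fun _ _ => ⟨_, Metric.mem_ball_self (half_pos hρ)⟩)

/-- Comparison of an orbit sum with an integral: the balls about the points of an orbit are
disjoint. -/
lemma tsum_orbit_mul_le [Countable Γ] {ρ : ℝ}
    (h : ∀ γ δ : Γ, γ ≠ δ → ∀ x, ρ ≤ dist ((γ : E ≃ᵃⁱ[ℝ] E) x) ((δ : E ≃ᵃⁱ[ℝ] E) x))
    {F G : E → ℝ≥0∞} (hFG : ∀ y z, dist z y < ρ / 2 → F y ≤ G z) (x : E) :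
    (∑' γ : Γ, F ((γ : E ≃ᵃⁱ[ℝ] E) x)) * volume (Metric.ball (0 : E) (ρ / 2)) ≤ ∫⁻ z, G z := by
  calc (∑' γ : Γ, F ((γ : E ≃ᵃⁱ[ℝ] E) x)) * volume (Metric.ball (0 : E) (ρ / 2))
      = ∑' γ : Γ, ∫⁻ _z in Metric.ball ((γ : E ≃ᵃⁱ[ℝ] E) x) (ρ / 2), F ((γ : E ≃ᵃⁱ[ℝ] E) x) := by
        rw [← ENNReal.tsum_mul_right]
        congr 1
        funext γ
        rw [setLIntegral_const, Measure.addHaar_ball_center volume ((γ : E ≃ᵃⁱ[ℝ] E) x)]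
    _ ≤ ∑' γ : Γ, ∫⁻ z in Metric.ball ((γ : E ≃ᵃⁱ[ℝ] E) x) (ρ / 2), G z := by
        refine ENNReal.tsum_le_tsum fun γ => ?_
        exact setLIntegral_mono' measurableSet_ball fun z hz => hFG _ _ hz
    _ = ∫⁻ z in ⋃ γ : Γ, Metric.ball ((γ : E ≃ᵃⁱ[ℝ] E) x) (ρ / 2), G z :=
        (lintegral_iUnion (fun _ => measurableSet_ball)
          (pairwise_disjoint_ball_orbit h x) _).symm
    _ ≤ ∫⁻ z, G z := setLIntegral_le_lintegral _ _

lemma IsFreeCocompact.exists_tsum_orbit_le (hΓ : IsFreeCocompact Γ) :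
    ∃ ρ > 0, ∃ V : ℝ≥0∞, V ≠ ⊤ ∧ ∀ F G : E → ℝ≥0∞, (∀ y z, dist z y < ρ → F y ≤ G z) →
      ∀ x, ∑' γ : Γ, F ((γ : E ≃ᵃⁱ[ℝ] E) x) ≤ V * ∫⁻ z, G z := by
  have := hΓ.countable
  obtain ⟨ρ, hρ, h⟩ := hΓ.exists_sep_orbit
  have hv0 : volume (Metric.ball (0 : E) (ρ / 2)) ≠ 0 :=
    (Metric.measure_ball_pos volume _ (half_pos hρ)).ne'
  refine ⟨ρ / 2, half_pos hρ, (volume (Metric.ball (0 : E) (ρ / 2)))⁻¹, ENNReal.inv_ne_top.2 hv0,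
    fun F G hFG x => ?_⟩
  rw [mul_comm, ← div_eq_mul_inv, ENNReal.le_div_iff_mul_le (Or.inl hv0)
    (Or.inl measure_ball_lt_top.ne)]
  exact tsum_orbit_mul_le h hFG x

lemma IsFreeCocompact.tsum_indicator_ball_ne_top (hΓ : IsFreeCocompact Γ) (R : ℝ) (x : E) :
    ∑' γ : Γ, (Metric.ball (0 : E) R).indicator (1 : E → ℝ≥0∞) ((γ : E ≃ᵃⁱ[ℝ] E) x) ≠ ⊤ := by
  obtain ⟨ρ, hρ, V, hV, h⟩ := hΓ.exists_tsum_orbit_le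
  refine ((h _ ((Metric.ball (0 : E) (R + ρ)).indicator 1) (fun y z hyz => ?_) x).trans_lt ?_).ne
  · by_cases hy : y ∈ Metric.ball (0 : E) R
    · have : z ∈ Metric.ball (0 : E) (R + ρ) := by
        rw [mem_ball_zero_iff] at hy ⊢
        have := norm_le_norm_add_norm_sub' z y
        rw [dist_eq_norm] at hyz
        linarith
      simp [hy, this]
    · simp [hy]
  · rw [lintegral_indicator_one measurableSet_ball]
    exact ENNReal.mul_lt_top hV.lt_top measure_ball_lt_top

lemma IsFreeCocompact.finite_orbit_ball (hΓ : IsFreeCocompact Γ) (R : ℝ) (x : E) :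
    {γ : Γ | ‖(γ : E ≃ᵃⁱ[ℝ] E) x‖ < R}.Finite := by
  refine (ENNReal.finite_const_le_of_tsum_ne_top (hΓ.tsum_indicator_ball_ne_top R x)
    one_ne_zero).subset fun γ hγ => ?_
  have : (γ : E ≃ᵃⁱ[ℝ] E) x ∈ Metric.ball (0 : E) R := by simpa using hγ
  simp [Set.indicator_of_mem this]

lemma measurable_coe_affineIsometryEquiv (g : E ≃ᵃⁱ[ℝ] E) : Measurable g :=
  g.continuous.measurable

/-- The normalized indicator function of a ball that meets every orbit is an integrable weight. -/
lemma IsFreeCocompact.exists_isWeight (hΓ : IsFreeCocompact Γ) :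
    ∃ w : E → ℝ≥0∞, IsWeight Γ w ∧ ∫⁻ x, w x ≠ ⊤ := by
  have := hΓ.countable
  obtain ⟨R, hR⟩ := hΓ.exists_radius
  set I : E → ℝ≥0∞ := (Metric.ball (0 : E) R).indicator 1 with hI
  set S : E → ℝ≥0∞ := fun x => ∑' γ : Γ, I ((γ : E ≃ᵃⁱ[ℝ] E) x) with hS
  have hIm : Measurable I := measurable_one.indicator measurableSet_ball
  have hSm : Measurable S :=
    Measurable.tsum fun γ => hIm.comp (measurable_coe_affineIsometryEquiv _)
  have hStop : ∀ x, S x ≠ ⊤ := hΓ.tsum_indicator_ball_ne_top R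
  have hS1 : ∀ x, 1 ≤ S x := by
    intro x
    obtain ⟨γ, hγ, h⟩ := hR x
    refine le_trans ?_ (ENNReal.le_tsum (⟨γ, hγ⟩ : Γ))
    have : γ x ∈ Metric.ball (0 : E) R := by simpa using h
    simp [hI, this]
  have hSinv : ∀ (γ : Γ) x, S ((γ : E ≃ᵃⁱ[ℝ] E) x) = S x := by
    intro γ x
    exact (Equiv.mulRight γ).tsum_eq (fun δ : Γ => I ((δ : E ≃ᵃⁱ[ℝ] E) x))
  refine ⟨fun x => I x / S x, ⟨hIm.div hSm, fun x => ?_⟩, ?_⟩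
  · simp_rw [hSinv, div_eq_mul_inv]
    rw [ENNReal.tsum_mul_right, ENNReal.mul_inv_cancel (zero_lt_one.trans_le (hS1 x)).ne'
      (hStop x)]
  · refine ((lintegral_mono fun x => (ENNReal.div_le_of_le_mul ?_ : I x / S x ≤ I x)).trans_lt
      (b := ∫⁻ x, I x) ?_).ne
    · exact le_mul_of_one_le_right zero_le (hS1 x)
    · rw [hI, lintegral_indicator_one measurableSet_ball]
      exact measure_ball_lt_top

/-- Unfolding: the integral over the quotient of an orbit sum is the integral over `E`. -/
lemma IsWeight.lintegral_mul_tsum [Countable Γ] {w : E → ℝ≥0∞} (hw : IsWeight Γ w)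
    {h : E → ℝ≥0∞} (hh : Measurable h) :
    ∫⁻ y, w y * ∑' γ : Γ, h ((γ : E ≃ᵃⁱ[ℝ] E) y) = ∫⁻ y, h y := by
  calc ∫⁻ y, w y * ∑' γ : Γ, h ((γ : E ≃ᵃⁱ[ℝ] E) y)
      = ∑' γ : Γ, ∫⁻ y, w y * h ((γ : E ≃ᵃⁱ[ℝ] E) y) := by
        simp_rw [← ENNReal.tsum_mul_left]
        exact lintegral_tsum fun γ => (hw.measurable.mul
          (hh.comp (measurable_coe_affineIsometryEquiv _))).aemeasurable
    _ = ∑' γ : Γ, ∫⁻ y, w (((γ⁻¹ : Γ) : E ≃ᵃⁱ[ℝ] E) y) * h y := by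
        congr 1
        funext γ
        rw [← lintegral_comp_affineIsometryEquiv (γ : E ≃ᵃⁱ[ℝ] E)
          (fun y => w (((γ⁻¹ : Γ) : E ≃ᵃⁱ[ℝ] E) y) * h y)]
        congr 1
        funext y
        have : ((γ⁻¹ : Γ) : E ≃ᵃⁱ[ℝ] E) ((γ : E ≃ᵃⁱ[ℝ] E) y) = y :=
          (γ : E ≃ᵃⁱ[ℝ] E).symm_apply_apply y
        rw [this]
    _ = ∑' γ : Γ, ∫⁻ y, w ((γ : E ≃ᵃⁱ[ℝ] E) y) * h y :=
        (Equiv.inv Γ).tsum_eq (fun γ : Γ => ∫⁻ y, w ((γ : E ≃ᵃⁱ[ℝ] E) y) * h y)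
    _ = ∫⁻ y, (∑' γ : Γ, w ((γ : E ≃ᵃⁱ[ℝ] E) y)) * h y := by
        simp_rw [← ENNReal.tsum_mul_right]
        exact (lintegral_tsum fun γ => ((hw.measurable.comp
          (measurable_coe_affineIsometryEquiv _)).mul hh).aemeasurable).symm
    _ = ∫⁻ y, h y := by simp_rw [hw.tsum_eq_one, one_mul]

/-- An invariant measurable set that is null for the weighted measure is a null set. -/
lemma IsWeight.ae_of_ae_withDensity [Countable Γ] {w : E → ℝ≥0∞} (hw : IsWeight Γ w)
    {p : E → Prop} (hp : MeasurableSet {x | p x})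
    (hinv : ∀ (γ : Γ) x, p ((γ : E ≃ᵃⁱ[ℝ] E) x) ↔ p x)
    (h : ∀ᵐ x ∂(volume.withDensity w), p x) : ∀ᵐ x : E, p x := by
  set f : E → ℝ≥0∞ := {x | p x}ᶜ.indicator 1 with hf
  have hfm : Measurable f := measurable_one.indicator hp.compl
  have hfinv : ∀ (γ : Γ) x, f ((γ : E ≃ᵃⁱ[ℝ] E) x) = f x := by
    intro γ x
    by_cases hx : p x
    · simp [hf, hx, (hinv γ x).2 hx]
    · have hx' : ¬ p ((γ : E ≃ᵃⁱ[ℝ] E) x) := fun h' => hx ((hinv γ x).1 h')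
      simp [hf, hx, hx']
  have h1 : ∫⁻ x, f x ∂(volume.withDensity w) = 0 := by
    rw [hf, lintegral_indicator_one hp.compl]
    exact h
  rw [lintegral_withDensity_eq_lintegral_mul _ hw.measurable hfm,
    lintegral_eq_zero_iff (hw.measurable.mul hfm)] at h1
  have h2 : ∫⁻ y, f y = 0 := by
    rw [← hw.lintegral_mul_tsum hfm]
    simp_rw [hfinv]
    rw [← lintegral_zero (μ := (volume : Measure E))]
    refine lintegral_congr_ae ?_
    filter_upwards [h1] with x hx
    rcases mul_eq_zero.1 hx with h0 | h0
    · simp [h0]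
    · simp [h0]
  rw [hf, lintegral_indicator_one hp.compl] at h2
  exact h2

/-- The heat kernel of the quotient by `Γ`, as an extended nonnegative function. -/
noncomputable def quotientHeatKernel (Γ : Subgroup (E ≃ᵃⁱ[ℝ] E)) (t : ℝ) (x y : E) : ℝ≥0∞ :=
  ∑' γ : Γ, ENNReal.ofReal (heatKernel t (x - (γ : E ≃ᵃⁱ[ℝ] E) y))

lemma measurable_quotientHeatKernel [Countable Γ] (t : ℝ) :
    Measurable fun p : E × E => quotientHeatKernel Γ t p.1 p.2 := by
  refine Measurable.tsum fun γ => ENNReal.measurable_ofReal.comp ?_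
  refine ((continuous_heatKernel t).comp ?_).measurable
  exact continuous_fst.sub ((γ : E ≃ᵃⁱ[ℝ] E).continuous.comp continuous_snd)

lemma measurable_quotientHeatKernel_right [Countable Γ] (t : ℝ) (x : E) :
    Measurable (quotientHeatKernel Γ t x) :=
  Measurable.comp (g := fun p : E × E => quotientHeatKernel Γ t p.1 p.2) (f := fun y => (x, y))
    (measurable_quotientHeatKernel t) measurable_prodMk_left

lemma measurable_quotientHeatKernel_left [Countable Γ] (t : ℝ) (y : E) :
    Measurable fun x => quotientHeatKernel Γ t x y :=
  Measurable.comp (g := fun p : E × E => quotientHeatKernel Γ t p.1 p.2) (f := fun x => (x, y))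
    (measurable_quotientHeatKernel t) measurable_prodMk_right

lemma heatKernel_sub_map (g : E ≃ᵃⁱ[ℝ] E) (t : ℝ) (x y : E) :
    heatKernel t (g x - g y) = heatKernel t (x - y) := by
  refine heatKernel_eq_of_norm_eq t ?_
  rw [← dist_eq_norm, ← dist_eq_norm, g.dist_map]

lemma quotientHeatKernel_map_right (γ : Γ) (t : ℝ) (x y : E) :
    quotientHeatKernel Γ t x ((γ : E ≃ᵃⁱ[ℝ] E) y) = quotientHeatKernel Γ t x y :=
  (Equiv.mulRight γ).tsum_eq
    (fun δ : Γ => ENNReal.ofReal (heatKernel t (x - (δ : E ≃ᵃⁱ[ℝ] E) y)))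

lemma quotientHeatKernel_comm (t : ℝ) (x y : E) :
    quotientHeatKernel Γ t x y = quotientHeatKernel Γ t y x := by
  unfold quotientHeatKernel
  rw [← (Equiv.inv Γ).tsum_eq]
  congr 1
  funext γ
  rw [← heatKernel_sub_map (γ : E ≃ᵃⁱ[ℝ] E), heatKernel_sub_comm]
  congr 3
  exact (γ : E ≃ᵃⁱ[ℝ] E).apply_symm_apply y

lemma quotientHeatKernel_map_left (γ : Γ) (t : ℝ) (x y : E) :
    quotientHeatKernel Γ t ((γ : E ≃ᵃⁱ[ℝ] E) x) y = quotientHeatKernel Γ t x y := by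
  rw [quotientHeatKernel_comm, quotientHeatKernel_map_right, quotientHeatKernel_comm]

/-- The quotient heat kernel is bounded: on balls of fixed radius the heat kernel at time `t` is at
most a constant times its minimum at time `2t`, so the orbit sum is controlled by an integral. -/
lemma IsFreeCocompact.exists_quotientHeatKernel_le (hΓ : IsFreeCocompact Γ) {t : ℝ} (ht : 0 < t) :
    ∃ C : ℝ, 0 ≤ C ∧ ∀ x y, quotientHeatKernel Γ t x y ≤ ENNReal.ofReal C := by
  obtain ⟨ρ, hρ, V, hV, h⟩ := hΓ.exists_tsum_orbit_le
  set A : ℝ := Real.exp (1 / (4 * t) * ρ ^ 2) * ((4 * π * t) ^ (-(finrank ℝ E : ℝ) / 2) /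
    (4 * π * (2 * t)) ^ (-(finrank ℝ E : ℝ) / 2)) with hA
  have hA0 : 0 ≤ A := by positivity
  refine ⟨(V * ENNReal.ofReal A).toReal, ENNReal.toReal_nonneg, fun x y => ?_⟩
  rw [ENNReal.ofReal_toReal (ENNReal.mul_ne_top hV ENNReal.ofReal_ne_top)]
  refine (h (fun z => ENNReal.ofReal (heatKernel t (x - z)))
    (fun z => ENNReal.ofReal A * ENNReal.ofReal (heatKernel (2 * t) (x - z)))
    (fun y z hyz => ?_) y).trans (le_of_eq ?_)
  · rw [← ENNReal.ofReal_mul hA0]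
    refine ENNReal.ofReal_le_ofReal ?_
    have e : A * heatKernel (2 * t) (x - z) = (4 * π * t) ^ (-(finrank ℝ E : ℝ) / 2) *
        Real.exp (1 / (4 * t) * ρ ^ 2 + -(1 / (4 * (2 * t))) * ‖x - z‖ ^ 2) := by
      rw [Real.exp_add, hA, heatKernel]
      field_simp
    rw [e, heatKernel]
    gcongr
    have h1 : ‖x - z‖ ≤ ‖x - y‖ + ρ := by
      have := norm_sub_le_norm_sub_add_norm_sub x y z
      rw [dist_comm, dist_eq_norm] at hyz
      linarith
    have h2 : ‖x - z‖ ^ 2 ≤ 2 * ‖x - y‖ ^ 2 + 2 * ρ ^ 2 := by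
      nlinarith [norm_nonneg (x - z), sq_nonneg (‖x - y‖ - ρ), norm_nonneg (x - y)]
    have h3 : 0 < 1 / (4 * (2 * t)) := by positivity
    have h4 : 1 / (4 * t) = 2 * (1 / (4 * (2 * t))) := by field_simp
    rw [h4]
    nlinarith
  · congr 1
    rw [lintegral_const_mul' _ _ ENNReal.ofReal_ne_top]
    have : ∫⁻ z : E, ENNReal.ofReal (heatKernel (2 * t) (x - z)) = 1 := by
      rw [lintegral_sub_left_eq_self (fun z : E => ENNReal.ofReal (heatKernel (2 * t) z)) x,
        lintegral_heatKernel (by positivity)]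
    rw [this, mul_one]

/-- Integrating an invariant function against the quotient heat kernel, over the quotient,
amounts to integrating it against the Euclidean heat kernel. -/
lemma IsWeight.lintegral_quotientHeatKernel_mul [Countable Γ] {w : E → ℝ≥0∞} (hw : IsWeight Γ w)
    {t : ℝ} {f : E → ℝ≥0∞} (hf : Measurable f)
    (hinv : ∀ (γ : Γ) x, f ((γ : E ≃ᵃⁱ[ℝ] E) x) = f x) (x : E) :
    ∫⁻ y, quotientHeatKernel Γ t x y * f y ∂(volume.withDensity w) =
      ∫⁻ y, ENNReal.ofReal (heatKernel t (x - y)) * f y := by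
  have hm : Measurable fun y => quotientHeatKernel Γ t x y :=
    measurable_quotientHeatKernel_right t x
  have hc : Continuous fun y => heatKernel t (x - y) :=
    (continuous_heatKernel t).comp (continuous_const.sub continuous_id)
  have hk : Measurable fun y => ENNReal.ofReal (heatKernel t (x - y)) :=
    hc.measurable.ennreal_ofReal
  have hmf : Measurable fun y => quotientHeatKernel Γ t x y * f y := hm.mul hf
  rw [lintegral_withDensity_eq_lintegral_mul _ hw.measurable hmf,
    ← hw.lintegral_mul_tsum (h := fun y => ENNReal.ofReal (heatKernel t (x - y)) * f y)
      (hk.mul hf)]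
  congr 1
  funext y
  simp only [Pi.mul_apply, hinv]
  rw [ENNReal.tsum_mul_right]
  rfl

/-- Semigroup property of the quotient heat kernel. -/
lemma IsWeight.lintegral_quotientHeatKernel_mul_quotientHeatKernel [Countable Γ] {w : E → ℝ≥0∞}
    (hw : IsWeight Γ w) {s t : ℝ} (hs : 0 < s) (ht : 0 < t) (x z : E) :
    ∫⁻ y, quotientHeatKernel Γ s x y * quotientHeatKernel Γ t y z ∂(volume.withDensity w) =
      quotientHeatKernel Γ (s + t) x z := by
  rw [hw.lintegral_quotientHeatKernel_mul (f := fun y => quotientHeatKernel Γ t y z)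
    (measurable_quotientHeatKernel_left t z)
    (fun γ y => quotientHeatKernel_map_left γ t y z)]
  unfold quotientHeatKernel
  simp_rw [← ENNReal.tsum_mul_left]
  have hc : Continuous fun y => heatKernel s (x - y) :=
    (continuous_heatKernel s).comp (continuous_const.sub continuous_id)
  have hc' : ∀ v : E, Continuous fun y => heatKernel t (y - v) := fun v =>
    (continuous_heatKernel t).comp (continuous_id.sub continuous_const)
  have hm : ∀ γ : Γ, AEMeasurable (fun y => ENNReal.ofReal (heatKernel s (x - y)) *
      ENNReal.ofReal (heatKernel t (y - (γ : E ≃ᵃⁱ[ℝ] E) z))) volume := fun γ =>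
    (hc.measurable.ennreal_ofReal.mul (hc' _).measurable.ennreal_ofReal).aemeasurable
  rw [lintegral_tsum hm]
  congr 1
  funext γ
  exact lintegral_heatKernel_mul hs ht _ _

/-- On bounded invariant functions the heat operator of the quotient is the Euclidean heat flow. -/
lemma IsWeight.integral_quotientHeatKernel_mul [Countable Γ] {w : E → ℝ≥0∞}
    (hw : IsWeight Γ w) (hΓ : IsFreeCocompact Γ) (hfin : ∫⁻ x, w x ≠ ⊤) {t : ℝ} (ht : 0 < t)
    {f : E → ℝ} (hf : Measurable f)
    (hinv : ∀ (γ : Γ) x, f ((γ : E ≃ᵃⁱ[ℝ] E) x) = f x) {C : ℝ} (hC : ∀ x, |f x| ≤ C) (x : E) :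
    ∫ y, (quotientHeatKernel Γ t x y).toReal * f y ∂(volume.withDensity w) = heatFlow t f x := by
  have : IsFiniteMeasure (volume.withDensity w) := isFiniteMeasure_withDensity hfin
  obtain ⟨K, hK0, hK⟩ := hΓ.exists_quotientHeatKernel_le ht
  have hKtop : ∀ y, quotientHeatKernel Γ t x y ≠ ⊤ := fun y =>
    ((hK x y).trans_lt ENNReal.ofReal_lt_top).ne
  have hm : Measurable fun y => (quotientHeatKernel Γ t x y).toReal :=
    (measurable_quotientHeatKernel_right t x).ennreal_toReal
  have hKr : ∀ y, ‖(quotientHeatKernel Γ t x y).toReal‖ ≤ K := fun y => by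
    rw [Real.norm_eq_abs, abs_of_nonneg ENNReal.toReal_nonneg]
    exact ENNReal.toReal_le_of_le_ofReal hK0 (hK x y)
  have hhk : Integrable fun y => heatKernel t (x - y) := (integrable_heatKernel ht).comp_sub_left x
  -- for nonnegative functions this is the statement for Lebesgue integrals
  have key : ∀ g : E → ℝ, Measurable g → (∀ (γ : Γ) x, g ((γ : E ≃ᵃⁱ[ℝ] E) x) = g x) →
      (∀ y, 0 ≤ g y) →
      ∫ y, (quotientHeatKernel Γ t x y).toReal * g y ∂(volume.withDensity w) =
        ∫ y, heatKernel t (x - y) * g y := by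
    intro g hg hginv hg0
    rw [integral_eq_lintegral_of_nonneg_ae
      (Eventually.of_forall fun y => mul_nonneg ENNReal.toReal_nonneg (hg0 y))
      (hm.mul hg).aestronglyMeasurable,
      integral_eq_lintegral_of_nonneg_ae
      (Eventually.of_forall fun y => mul_nonneg (heatKernel_pos ht _).le (hg0 y))
      (hhk.aestronglyMeasurable.mul hg.aestronglyMeasurable)]
    congr 1
    have e1 : ∀ y, ENNReal.ofReal ((quotientHeatKernel Γ t x y).toReal * g y) =
        quotientHeatKernel Γ t x y * ENNReal.ofReal (g y) := fun y => by
      rw [ENNReal.ofReal_mul ENNReal.toReal_nonneg, ENNReal.ofReal_toReal (hKtop y)]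
    have e2 : ∀ y, ENNReal.ofReal (heatKernel t (x - y) * g y) =
        ENNReal.ofReal (heatKernel t (x - y)) * ENNReal.ofReal (g y) := fun y => by
      rw [ENNReal.ofReal_mul (heatKernel_pos ht _).le]
    simp_rw [e1, e2]
    exact hw.lintegral_quotientHeatKernel_mul (ENNReal.measurable_ofReal.comp hg)
      (fun γ y => by simp [hginv]) x
  -- the general case: `f + C` and `C` are nonnegative and invariant
  have h1 := key (fun y => f y + C) (hf.add_const C) (fun γ y => by simp [hinv])
    (fun y => by linarith [neg_abs_le (f y), hC y])
  have h2 := key (fun _ => C) measurable_const (fun _ _ => rfl)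
    (fun y => (abs_nonneg _).trans (hC y))
  have i1 : Integrable (fun y => (quotientHeatKernel Γ t x y).toReal * f y)
      (volume.withDensity w) :=
    Integrable.of_bound (hm.mul hf).aestronglyMeasurable (K * C) (Eventually.of_forall fun y => by
      rw [norm_mul]
      exact mul_le_mul (hKr y) (hC y) (norm_nonneg _) hK0)
  have i2 : Integrable (fun y => (quotientHeatKernel Γ t x y).toReal * C)
      (volume.withDensity w) :=
    (Integrable.of_bound hm.aestronglyMeasurable K (Eventually.of_forall hKr)).mul_const C
  have i3 : Integrable (fun y => heatKernel t (x - y) * f y) :=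
    hhk.mul_bdd hf.aestronglyMeasurable (Eventually.of_forall hC)
  simp_rw [mul_add] at h1
  rw [integral_add i1 i2, integral_add i3 (hhk.mul_const C)] at h1
  rw [heatFlow]
  linarith

end Group


/-! ### Hilbert–Schmidt operators -/

section HilbertSchmidt

variable {H : Type} [NormedAddCommGroup H] [InnerProductSpace ℝ H] [CompleteSpace H]

/-- A Hilbert–Schmidt operator is compact: it is the norm limit of the finite rank operators
`x ↦ ∑ i ∈ s, ⟪b i, x⟫ T (b i)`. -/
lemma isCompactOperator_of_summable_norm_sq (T : H →L[ℝ] H) {ι : Type} (b : HilbertBasis ι ℝ H)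
    (hs : Summable fun i => ‖T (b i)‖ ^ 2) : IsCompactOperator T := by
  classical
  set TS : Finset ι → (H →L[ℝ] H) := fun s =>
    ∑ i ∈ s, (innerSL ℝ (b i)).smulRight (T (b i)) with hTS
  have hTSapply : ∀ s x, TS s x = ∑ i ∈ s, ⟪b i, x⟫_ℝ • T (b i) := by
    intro s x
    simp [hTS]
  have hcomp : ∀ s, IsCompactOperator (TS s) := by
    intro s
    have h1 : ∀ i, IsCompactOperator ((innerSL ℝ (b i)).smulRight (T (b i))) := by
      intro i
      have h2 : IsCompactOperator (innerSL ℝ (b i)) :=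
        isCompactOperator_of_locallyCompactSpace_dom (innerSL ℝ (b i))
      have := h2.clm_comp (ContinuousLinearMap.toSpanSingleton ℝ (T (b i)))
      convert! this using 1
    have : TS s ∈ compactOperator (RingHom.id ℝ) H H :=
      Submodule.sum_mem _ fun i _ => h1 i
    exact this
  refine isCompactOperator_of_tendsto (F := TS) (l := atTop) ?_
    (Eventually.of_forall hcomp)
  rw [Metric.tendsto_atTop]
  intro ε hε
  -- the tail of the series bounds the error
  obtain ⟨s₀, hs₀⟩ := summable_iff_vanishing_norm.1 hs ((ε / 2) ^ 2) (by positivity)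
  refine ⟨s₀, fun s hss => ?_⟩
  rw [dist_comm, dist_eq_norm]
  refine lt_of_le_of_lt ?_ (half_lt_self hε)
  refine ContinuousLinearMap.opNorm_le_bound _ (by positivity) fun x => ?_
  have hsum : HasSum (fun i => ⟪b i, x⟫_ℝ • T (b i)) (T x) := by
    have := (b.hasSum_repr x).mapL T
    simpa [b.repr_apply_apply] using this
  have hlim : Tendsto (fun u : Finset ι => ‖(∑ i ∈ u, ⟪b i, x⟫_ℝ • T (b i)) - TS s x‖) atTop
      (𝓝 ‖T x - TS s x‖) := (Tendsto.sub_const hsum _).norm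
  refine le_of_tendsto hlim ?_
  filter_upwards [eventually_ge_atTop s] with u hu
  have hsplit : (∑ i ∈ u, ⟪b i, x⟫_ℝ • T (b i)) - TS s x =
      ∑ i ∈ u \ s, ⟪b i, x⟫_ℝ • T (b i) := by
    rw [hTSapply, ← Finset.sum_sdiff hu, add_sub_cancel_right]
  rw [hsplit]
  have hCS : (∑ i ∈ u \ s, |⟪b i, x⟫_ℝ| * ‖T (b i)‖) ^ 2 ≤ ‖x‖ ^ 2 * (ε / 2) ^ 2 := by
    refine (Finset.sum_mul_sq_le_sq_mul_sq _ _ _).trans ?_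
    refine mul_le_mul ?_ ?_ (Finset.sum_nonneg fun _ _ => sq_nonneg _) (sq_nonneg _)
    · simpa using b.orthonormal.sum_inner_products_le (s := u \ s) x
    · have h := hs₀ (u \ s) (Finset.disjoint_of_subset_right hss Finset.sdiff_disjoint)
      rw [Real.norm_eq_abs] at h
      exact (le_abs_self _).trans h.le
  have h0 : ‖∑ i ∈ u \ s, ⟪b i, x⟫_ℝ • T (b i)‖ ≤ ∑ i ∈ u \ s, |⟪b i, x⟫_ℝ| * ‖T (b i)‖ := by
    refine (norm_sum_le _ _).trans (le_of_eq (Finset.sum_congr rfl fun i _ => ?_))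
    rw [norm_smul, Real.norm_eq_abs]
  refine h0.trans (abs_le_of_sq_le_sq' ?_ (by positivity)).2
  calc _ ≤ ‖x‖ ^ 2 * (ε / 2) ^ 2 := hCS
    _ = _ := by ring

/-- The eigenvalue formula for the Hilbert–Schmidt norm of a symmetric operator. The summand at
`μ = 0` vanishes whatever the dimension of the kernel. -/
lemma tsum_sq_mul_finrank_eigenspace {T : H →L[ℝ] H} (hT : T.IsSymmetric) {S : ℝ≥0∞}
    (hS : S ≠ ⊤)
    (h : ∀ {ι : Type} (b : HilbertBasis ι ℝ H), ∑' i, ENNReal.ofReal (‖T (b i)‖ ^ 2) = S) :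
    ∑' μ : ℝ, ENNReal.ofReal (μ ^ 2) *
      (finrank ℝ (End.eigenspace (T : H →ₗ[ℝ] H) μ) : ℝ≥0∞) = S := by
  have hcomp : IsCompactOperator T := by
    obtain ⟨w, b, _⟩ := exists_hilbertBasis ℝ H
    refine isCompactOperator_of_summable_norm_sq T b ?_
    have h1 := h b
    have h2 : Summable fun i => (ENNReal.ofReal (‖T (b i)‖ ^ 2)).toReal :=
      ENNReal.summable_toReal (by rw [h1]; exact hS)
    simpa [ENNReal.toReal_ofReal, sq_nonneg] using h2
  -- bases of the eigenspaces form a Hilbert basis, in which `T` is diagonal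
  set V : ℝ → Submodule ℝ H := fun μ => End.eigenspace (T : H →ₗ[ℝ] H) μ with hV
  have hVc : ∀ μ, CompleteSpace (V μ) := fun μ => by
    have : IsClosed (V μ : Set H) := by
      have e : (V μ : Set H) = {x | T x = μ • x} := by
        ext x
        simp [hV]
      rw [e]
      exact isClosed_eq T.continuous (continuous_const_smul μ)
    exact this.completeSpace_coe
  choose w e he using fun μ => exists_hilbertBasis ℝ (V μ)
  set v : (Σ μ, w μ) → H := fun p => (V p.1).subtypeₗᵢ (e p.1 p.2) with hv
  have hon : Orthonormal ℝ v :=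
    hT.orthogonalFamily_eigenspaces.orthonormal_sigma_orthonormal fun μ => (e μ).orthonormal
  have hspan : (Submodule.span ℝ (Set.range v))ᗮ = ⊥ := by
    rw [eq_bot_iff, ← ContinuousLinearMap.orthogonalComplement_iSup_eigenspaces_eq_bot hcomp hT]
    intro x hx
    rw [Submodule.mem_orthogonal] at hx
    rw [← Submodule.iInf_orthogonal, Submodule.mem_iInf]
    intro μ
    rw [Submodule.mem_orthogonal]
    intro y hy
    have h1 : Dense ((Submodule.span ℝ (Set.range (e μ))) : Set (V μ)) :=
      Submodule.dense_iff_topologicalClosure_eq_top.2 (e μ).dense_span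
    have h2 : ∀ z : V μ, ⟪(z : H), x⟫_ℝ = 0 := by
      have hcl : IsClosed {z : V μ | ⟪(z : H), x⟫_ℝ = 0} :=
        isClosed_eq (by fun_prop) continuous_const
      have hsub : ((Submodule.span ℝ (Set.range (e μ))) : Set (V μ)) ⊆
          {z : V μ | ⟪(z : H), x⟫_ℝ = 0} := by
        intro z hz
        refine hx _ ?_
        have : (Submodule.span ℝ (Set.range (e μ))).map (V μ).subtype ≤
            Submodule.span ℝ (Set.range v) := by
          rw [Submodule.map_span_le]
          rintro _ ⟨i, rfl⟩
          exact Submodule.subset_span ⟨⟨μ, i⟩, rfl⟩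
        exact this ⟨z, hz, rfl⟩
      intro z
      exact closure_minimal hsub hcl (h1 z)
    exact h2 ⟨y, hy⟩
  set b : HilbertBasis (Σ μ, w μ) ℝ H := HilbertBasis.mkOfOrthogonalEqBot hon hspan with hb
  have hbv : ∀ p, b p = v p := fun p => by rw [hb, HilbertBasis.coe_mkOfOrthogonalEqBot]
  have hTv : ∀ p : Σ μ, w μ, ‖T (b p)‖ ^ 2 = p.1 ^ 2 := by
    intro p
    have h1 : T (v p) = p.1 • v p := End.mem_eigenspace_iff.1 (e p.1 p.2).2
    rw [hbv, h1, norm_smul, hon.1 p, mul_one, Real.norm_eq_abs, sq_abs]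
  have hsum := h b
  simp_rw [hTv] at hsum
  rw [ENNReal.tsum_sigma'] at hsum
  dsimp only at hsum
  rw [← hsum]
  congr 1
  funext μ
  rw [ENNReal.tsum_const]
  by_cases hμ : μ = 0
  · simp [hμ]
  have hfin : FiniteDimensional ℝ (V μ) :=
    ContinuousLinearMap.finite_dimensional_eigenspace hcomp μ hμ
  have hwfin : Finite (w μ) := (e μ).orthonormal.linearIndependent.finite
  have := Fintype.ofFinite (w μ)
  rw [mul_comm, ENat.card_eq_coe_fintype_card]
  have hdim : finrank ℝ (V μ) = Fintype.card (w μ) :=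
    finrank_eq_card_basis (e μ).toOrthonormalBasis.toBasis
  rw [hdim, ENat.toENNReal_coe]

end HilbertSchmidt


/-! ### Integral operators with bounded kernels -/

lemma countable_of_orthonormal {H ι : Type} [NormedAddCommGroup H] [InnerProductSpace ℝ H]
    [TopologicalSpace.SeparableSpace H] {v : ι → H} (hv : Orthonormal ℝ v) : Countable ι := by
  have h1 : (Set.univ : Set ι).PairwiseDisjoint fun i => Metric.ball (v i) (1 / 2) := by
    intro i _ j _ hij
    refine Metric.ball_disjoint_ball ?_
    have h2 : ‖v i - v j‖ ^ 2 = 2 := by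
      rw [norm_sub_sq_real, hv.1 i, hv.1 j, hv.2 hij]
      norm_num
    rw [dist_eq_norm]
    nlinarith [norm_nonneg (v i - v j)]
  exact Set.countable_univ_iff.1 (h1.countable_of_isOpen (fun _ _ => Metric.isOpen_ball)
    fun _ _ => ⟨_, Metric.mem_ball_self (by norm_num)⟩)

lemma ofReal_norm_sq_eq_lintegral {X : Type} [MeasurableSpace X] {ν : Measure X}
    (f : Lp ℝ 2 ν) : ENNReal.ofReal (‖f‖ ^ 2) = ∫⁻ x, ENNReal.ofReal (f x ^ 2) ∂ν := by
  have h1 : ‖f‖ ^ 2 = ∫ x, f x ^ 2 ∂ν := by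
    rw [← real_inner_self_eq_norm_sq, L2.inner_def]
    congr 1
    funext x
    simp [sq]
  rw [h1, ofReal_integral_eq_lintegral_ofReal]
  · exact (memLp_two_iff_integrable_sq (Lp.memLp f).1).1 (Lp.memLp f)
  · exact Eventually.of_forall fun x => sq_nonneg _

/-- A bounded measurable integral kernel. -/
structure IsBoundedKernel {X : Type} [MeasurableSpace X] (k : X → X → ℝ) : Prop where
  measurable : Measurable fun p : X × X => k p.1 p.2
  bounded : ∃ C, ∀ x y, |k x y| ≤ C

namespace IsBoundedKernel

variable {X : Type} [MeasurableSpace X] {ν : Measure X} [IsFiniteMeasure ν] {k k' k'' : X → X → ℝ}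

lemma memLp (hk : IsBoundedKernel k) (x : X) : MemLp (k x) 2 ν := by
  obtain ⟨C, hC⟩ := hk.bounded
  exact MemLp.of_bound (hk.measurable.comp measurable_prodMk_left).aestronglyMeasurable C
    (Eventually.of_forall (hC x))

/-- The function `k x` as a vector of `L²`. -/
noncomputable def vec (hk : IsBoundedKernel k) (ν : Measure X) [IsFiniteMeasure ν] (x : X) :
    Lp ℝ 2 ν := (hk.memLp x).toLp (k x)

lemma inner_vec (hk : IsBoundedKernel k) (x : X) (f : Lp ℝ 2 ν) :
    ⟪hk.vec ν x, f⟫_ℝ = ∫ y, k x y * f y ∂ν := by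
  rw [L2.inner_def]
  refine integral_congr_ae ?_
  filter_upwards [(hk.memLp (ν := ν) x).coeFn_toLp] with y hy
  rw [vec, hy]
  simp [mul_comm]

lemma exists_norm_vec_le (hk : IsBoundedKernel k) (ν : Measure X) [IsFiniteMeasure ν] :
    ∃ C, 0 ≤ C ∧ ∀ x, ‖hk.vec ν x‖ ≤ C := by
  obtain ⟨C, hC⟩ := hk.bounded
  by_cases hX : Nonempty X
  · obtain ⟨x₀⟩ := hX
    have hC0 : 0 ≤ C := (abs_nonneg _).trans (hC x₀ x₀)
    refine ⟨(ν.real Set.univ) ^ ((2 : ℝ≥0∞).toReal)⁻¹ * C, by positivity, fun x => ?_⟩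
    refine Lp.norm_le_of_ae_bound hC0 ?_
    filter_upwards [(hk.memLp (ν := ν) x).coeFn_toLp] with y hy
    rw [vec, hy]
    exact hC x y
  · exact ⟨0, le_rfl, fun x => (hX ⟨x⟩).elim⟩

lemma stronglyMeasurable_integral (hk : IsBoundedKernel k) (f : Lp ℝ 2 ν) :
    StronglyMeasurable fun x => ⟪hk.vec ν x, f⟫_ℝ := by
  simp_rw [inner_vec]
  refine StronglyMeasurable.integral_prod_right (f := fun x y => k x y * f y) ?_
  exact (hk.measurable.mul ((Lp.stronglyMeasurable f).measurable.comp
    measurable_snd)).stronglyMeasurable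

lemma memLp_inner_vec (hk : IsBoundedKernel k) (f : Lp ℝ 2 ν) :
    MemLp (fun x => ⟪hk.vec ν x, f⟫_ℝ) 2 ν := by
  obtain ⟨C, hC0, hC⟩ := hk.exists_norm_vec_le ν
  refine MemLp.of_bound (hk.stronglyMeasurable_integral f).aestronglyMeasurable (C * ‖f‖)
    (Eventually.of_forall fun x => ?_)
  exact (norm_inner_le_norm _ _).trans (by gcongr; exact hC x)

/-- The integral operator on `L²` with a given bounded kernel. -/
noncomputable def toCLM (hk : IsBoundedKernel k) (ν : Measure X) [IsFiniteMeasure ν] :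
    Lp ℝ 2 ν →L[ℝ] Lp ℝ 2 ν :=
  LinearMap.mkContinuousOfExistsBound
    { toFun := fun f => (hk.memLp_inner_vec f).toLp _
      map_add' := fun f g => by
        rw [← MemLp.toLp_add]
        exact MemLp.toLp_congr _ _ (Eventually.of_forall fun x => inner_add_right _ _ _)
      map_smul' := fun c f => by
        rw [RingHom.id_apply, ← MemLp.toLp_const_smul]
        exact MemLp.toLp_congr _ _ (Eventually.of_forall fun x => inner_smul_right _ _ _) }
    (by
      obtain ⟨C, hC0, hC⟩ := hk.exists_norm_vec_le ν
      refine ⟨(ν.real Set.univ) ^ ((2 : ℝ≥0∞).toReal)⁻¹ * C, fun f => ?_⟩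
      rw [mul_assoc]
      refine Lp.norm_le_of_ae_bound (by positivity) ?_
      filter_upwards [(hk.memLp_inner_vec f).coeFn_toLp] with y hy
      refine (le_of_eq (congrArg norm hy)).trans ?_
      exact (norm_inner_le_norm _ _).trans (by gcongr; exact hC y))

lemma coeFn_toCLM (hk : IsBoundedKernel k) (f : Lp ℝ 2 ν) :
    hk.toCLM ν f =ᵐ[ν] fun x => ∫ y, k x y * f y ∂ν := by
  simp_rw [← inner_vec hk]
  exact (hk.memLp_inner_vec f).coeFn_toLp

lemma integrable_coeFn (f : Lp ℝ 2 ν) : Integrable f ν :=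
  (Lp.memLp f).integrable (by norm_num)

lemma isSymmetric_toCLM (hk : IsBoundedKernel k) (hsymm : ∀ x y, k x y = k y x) :
    (hk.toCLM ν).IsSymmetric := by
  intro f g
  obtain ⟨C, hC⟩ := hk.bounded
  have e1 : ⟪hk.toCLM ν f, g⟫_ℝ = ∫ x, ∫ y, k x y * (g x * f y) ∂ν ∂ν := by
    rw [L2.inner_def]
    refine integral_congr_ae ?_
    filter_upwards [hk.coeFn_toCLM f] with x hx
    rw [hx]
    simp only [RCLike.inner_apply, conj_trivial]
    rw [← integral_const_mul]
    congr 1; funext y; ring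
  have e2 : ⟪f, hk.toCLM ν g⟫_ℝ = ∫ y, ∫ x, k x y * (g x * f y) ∂ν ∂ν := by
    rw [L2.inner_def]
    refine integral_congr_ae ?_
    filter_upwards [hk.coeFn_toCLM g] with y hy
    rw [hy]
    simp only [RCLike.inner_apply, conj_trivial]
    rw [← integral_mul_const]
    congr 1; funext x; rw [hsymm]; ring
  refine e1.trans (Eq.trans ?_ e2.symm)
  refine integral_integral_swap ?_
  exact ((integrable_coeFn g).mul_prod (integrable_coeFn f)).bdd_mul (c := C)
    hk.measurable.aestronglyMeasurable (Eventually.of_forall fun p => hC p.1 p.2)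

lemma toCLM_apply_toCLM (hk : IsBoundedKernel k) (hk' : IsBoundedKernel k')
    (hk'' : IsBoundedKernel k'') (h : ∀ x z, ∫ y, k x y * k' y z ∂ν = k'' x z) (f : Lp ℝ 2 ν) :
    hk.toCLM ν (hk'.toCLM ν f) = hk''.toCLM ν f := by
  obtain ⟨C, hC⟩ := hk.bounded
  obtain ⟨C', hC'⟩ := hk'.bounded
  refine Lp.ext ?_
  filter_upwards [hk.coeFn_toCLM (hk'.toCLM ν f), hk''.coeFn_toCLM f] with x h1 h2
  rw [h1, h2]
  have e1 : ∫ y, k x y * hk'.toCLM ν f y ∂ν = ∫ y, ∫ z, k x y * k' y z * (1 * f z) ∂ν ∂ν := by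
    refine integral_congr_ae ?_
    filter_upwards [hk'.coeFn_toCLM f] with y hy
    rw [hy, ← integral_const_mul]
    congr 1; funext z; ring
  rw [e1, integral_integral_swap]
  · congr 1
    funext z
    rw [integral_mul_const, h, one_mul]
  · refine ((integrable_const (1 : ℝ)).mul_prod (integrable_coeFn f)).bdd_mul (c := C * C')
      (Measurable.aestronglyMeasurable ?_) (Eventually.of_forall fun p => ?_)
    · exact (hk.measurable.comp (measurable_const.prodMk measurable_fst)).mul hk'.measurable
    · rw [norm_mul]
      exact mul_le_mul (hC x p.1) (hC' p.1 p.2) (norm_nonneg _) ((abs_nonneg _).trans (hC x p.1))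

/-- The Hilbert–Schmidt norm of an integral operator is the `L²` norm of its kernel. -/
lemma tsum_norm_sq_toCLM [MeasurableSpace.CountablyGenerated X] (hk : IsBoundedKernel k)
    {ι : Type} (b : HilbertBasis ι ℝ (Lp ℝ 2 ν)) :
    ∑' i, ENNReal.ofReal (‖hk.toCLM ν (b i)‖ ^ 2) =
      ∫⁻ x, ∫⁻ y, ENNReal.ofReal (k x y ^ 2) ∂ν ∂ν := by
  have : Fact ((2 : ℝ≥0∞) ≠ ⊤) := ⟨by norm_num⟩
  have : Countable ι := countable_of_orthonormal b.orthonormal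
  have h1 : ∀ i, ENNReal.ofReal (‖hk.toCLM ν (b i)‖ ^ 2) =
      ∫⁻ x, ENNReal.ofReal (⟪hk.vec ν x, b i⟫_ℝ ^ 2) ∂ν := by
    intro i
    rw [ofReal_norm_sq_eq_lintegral]
    refine lintegral_congr_ae ?_
    filter_upwards [hk.coeFn_toCLM (b i)] with x hx
    rw [hx, inner_vec]
  simp_rw [h1]
  rw [← lintegral_tsum fun i => ((hk.stronglyMeasurable_integral (b i)).measurable.pow_const
    2).ennreal_ofReal.aemeasurable]
  congr 1
  funext x
  have h2 : HasSum (fun i => ⟪hk.vec ν x, b i⟫_ℝ ^ 2) (‖hk.vec ν x‖ ^ 2) := by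
    have := b.hasSum_inner_mul_inner (hk.vec ν x) (hk.vec ν x)
    rw [real_inner_self_eq_norm_sq] at this
    refine this.congr_fun fun i => ?_
    rw [sq, real_inner_comm (b i)]
  rw [← ENNReal.ofReal_tsum_of_nonneg (fun i => sq_nonneg _) h2.summable, h2.tsum_eq,
    ofReal_norm_sq_eq_lintegral]
  refine lintegral_congr_ae ?_
  filter_upwards [(hk.memLp (ν := ν) x).coeFn_toLp] with y hy
  rw [vec, hy]

end IsBoundedKernel


/-! ### The spectral side of the trace formula -/

section Spectral

set_option linter.unusedSectionVars false

variable {E : Type} [NormedAddCommGroup E] [InnerProductSpace ℝ E] [FiniteDimensional ℝ E]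
  [MeasurableSpace E] [BorelSpace E] {Γ : Subgroup (E ≃ᵃⁱ[ℝ] E)}

/-- The `Γ`-invariant smooth solutions of `-Δ f = lam f`. -/
def invariantEigenspace (Γ : Subgroup (E ≃ᵃⁱ[ℝ] E)) (lam : ℝ) : Submodule ℝ (E → ℝ) where
  carrier := {f | ContDiff ℝ ∞ f ∧ (∀ (γ : Γ) x, f ((γ : E ≃ᵃⁱ[ℝ] E) x) = f x) ∧
    ∀ x, -(Δ f) x = lam * f x}
  zero_mem' := by
    refine ⟨contDiff_const, fun _ _ => rfl, fun x => ?_⟩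
    have h : (0 : E → ℝ) = fun _ => (0 : ℝ) := rfl
    rw [h, InnerProductSpace.laplacian_const]
    simp
  add_mem' := by
    rintro f g ⟨hf, hfi, hf'⟩ ⟨hg, hgi, hg'⟩
    refine ⟨hf.add hg, fun γ x => by simp [hfi, hgi], fun x => ?_⟩
    have h1 : ContDiffAt ℝ 2 f x := hf.contDiffAt.of_le (by norm_cast)
    have h2 : ContDiffAt ℝ 2 g x := hg.contDiffAt.of_le (by norm_cast)
    rw [h1.laplacian_add h2, Pi.add_apply]
    linear_combination hf' x + hg' x
  smul_mem' := by
    rintro c f ⟨hf, hfi, hf'⟩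
    refine ⟨hf.const_smul c, fun γ x => by simp [hfi], fun x => ?_⟩
    have h1 : ContDiffAt ℝ 2 f x := hf.contDiffAt.of_le (by norm_cast)
    rw [InnerProductSpace.laplacian_smul c h1, Pi.smul_apply, smul_eq_mul, smul_eq_mul]
    linear_combination c * hf' x

lemma norm_iteratedFDeriv_comp_affineIsometryEquiv (g : E ≃ᵃⁱ[ℝ] E) (f : E → ℝ) (n : ℕ) (x : E) :
    ‖iteratedFDeriv ℝ n (f ∘ g) x‖ = ‖iteratedFDeriv ℝ n f (g x)‖ := by
  have h : (f ∘ g : E → ℝ) = (fun y => f (y + g 0)) ∘ g.linearIsometryEquiv := by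
    funext x
    have := g.map_vadd 0 x
    simp only [vadd_eq_add, add_zero] at this
    simp [this]
  rw [h, LinearIsometryEquiv.norm_iteratedFDeriv_comp_right, iteratedFDeriv_comp_add_right]
  have := g.map_vadd 0 x
  simp only [vadd_eq_add, add_zero] at this
  rw [this]

/-- All derivatives of an invariant smooth function are bounded. -/
lemma IsFreeCocompact.exists_norm_iteratedFDeriv_le (hΓ : IsFreeCocompact Γ) {f : E → ℝ}
    (hf : ContDiff ℝ ∞ f) (hinv : ∀ (γ : Γ) x, f ((γ : E ≃ᵃⁱ[ℝ] E) x) = f x) (n : ℕ) :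
    ∃ C, ∀ x, ‖iteratedFDeriv ℝ n f x‖ ≤ C := by
  obtain ⟨R, hR⟩ := hΓ.exists_radius
  have hc : Continuous (iteratedFDeriv ℝ n f) :=
    hf.continuous_iteratedFDeriv (by exact_mod_cast le_top)
  obtain ⟨C, hC⟩ := (isCompact_closedBall (0 : E) R).exists_bound_of_continuousOn hc.continuousOn
  refine ⟨C, fun x => ?_⟩
  obtain ⟨γ, hγ, h⟩ := hR x
  have h1 := norm_iteratedFDeriv_comp_affineIsometryEquiv γ f n x
  have h2 : f ∘ γ = f := funext fun x => hinv ⟨γ, hγ⟩ x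
  rw [h2] at h1
  rw [h1]
  exact hC _ (by simpa using h.le)

lemma IsFreeCocompact.exists_bounds (hΓ : IsFreeCocompact Γ) {f : E → ℝ}
    (hf : ContDiff ℝ ∞ f) (hinv : ∀ (γ : Γ) x, f ((γ : E ≃ᵃⁱ[ℝ] E) x) = f x) :
    ∃ C₀ C₁ C₂, (∀ x, |f x| ≤ C₀) ∧ (∀ x, ‖fderiv ℝ f x‖ ≤ C₁) ∧
      ∀ x, ‖fderiv ℝ (fderiv ℝ f) x‖ ≤ C₂ := by
  obtain ⟨C₀, h0⟩ := hΓ.exists_norm_iteratedFDeriv_le hf hinv 0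
  obtain ⟨C₁, h1⟩ := hΓ.exists_norm_iteratedFDeriv_le hf hinv 1
  obtain ⟨C₂, h2⟩ := hΓ.exists_norm_iteratedFDeriv_le hf hinv 2
  refine ⟨C₀, C₁, C₂, fun x => ?_, fun x => ?_, fun x => ?_⟩
  · simpa using h0 x
  · rw [← norm_iteratedFDeriv_one]
    exact h1 x
  · rw [← norm_iteratedFDeriv_one, norm_iteratedFDeriv_fderiv]
    exact h2 x

lemma isBoundedKernel_quotientHeatKernel (hΓ : IsFreeCocompact Γ) {t : ℝ} (ht : 0 < t) :
    IsBoundedKernel fun x y => (quotientHeatKernel Γ t x y).toReal where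
  measurable := by
    have := hΓ.countable
    exact (measurable_quotientHeatKernel t).ennreal_toReal
  bounded := by
    obtain ⟨C, hC0, hC⟩ := hΓ.exists_quotientHeatKernel_le ht
    refine ⟨C, fun x y => ?_⟩
    rw [abs_of_nonneg ENNReal.toReal_nonneg]
    exact ENNReal.toReal_le_of_le_ofReal hC0 (hC x y)

variable {w : E → ℝ≥0∞}

/-- The heat operator of the quotient by `Γ` on `L²(w dx)`, given by integration against the
quotient heat kernel. Its image consists of `Γ`-invariant functions. -/
noncomputable def heatOp (hΓ : IsFreeCocompact Γ) (w : E → ℝ≥0∞)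
    [IsFiniteMeasure (volume.withDensity w)] {t : ℝ} (ht : 0 < t) :
    Lp ℝ 2 (volume.withDensity w) →L[ℝ] Lp ℝ 2 (volume.withDensity w) :=
  (isBoundedKernel_quotientHeatKernel hΓ ht).toCLM (volume.withDensity w)

variable [IsFiniteMeasure (volume.withDensity w)]

lemma isSymmetric_heatOp (hΓ : IsFreeCocompact Γ) {t : ℝ} (ht : 0 < t) :
    (heatOp hΓ w ht).IsSymmetric :=
  IsBoundedKernel.isSymmetric_toCLM _ fun x y => by rw [quotientHeatKernel_comm]

lemma coeFn_heatOp (hΓ : IsFreeCocompact Γ) {t : ℝ} (ht : 0 < t)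
    (f : Lp ℝ 2 (volume.withDensity w)) :
    heatOp hΓ w ht f =ᵐ[volume.withDensity w]
      fun x => ∫ y, (quotientHeatKernel Γ t x y).toReal * f y ∂(volume.withDensity w) :=
  IsBoundedKernel.coeFn_toCLM _ f

lemma IsFreeCocompact.quotientHeatKernel_ne_top (hΓ : IsFreeCocompact Γ) {t : ℝ} (ht : 0 < t)
    (x y : E) : quotientHeatKernel Γ t x y ≠ ⊤ := by
  obtain ⟨C, -, hC⟩ := hΓ.exists_quotientHeatKernel_le ht
  exact ((hC x y).trans_lt ENNReal.ofReal_lt_top).ne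

lemma heatOp_heatOp (hΓ : IsFreeCocompact Γ) (hw : IsWeight Γ w) {s t r : ℝ} (hs : 0 < s)
    (ht : 0 < t) (hr : 0 < r) (hst : s + t = r) (f : Lp ℝ 2 (volume.withDensity w)) :
    heatOp hΓ w hs (heatOp hΓ w ht f) = heatOp hΓ w hr f := by
  have := hΓ.countable
  subst hst
  refine IsBoundedKernel.toCLM_apply_toCLM _ _ _ (fun x z => ?_) f
  rw [← hw.lintegral_quotientHeatKernel_mul_quotientHeatKernel hs ht]
  simp_rw [← ENNReal.toReal_mul]
  refine integral_toReal ?_ (Eventually.of_forall fun y => ?_)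
  · exact ((measurable_quotientHeatKernel_right s x).mul
      (measurable_quotientHeatKernel_left t z)).aemeasurable
  · exact ENNReal.mul_lt_top (hΓ.quotientHeatKernel_ne_top hs x y).lt_top
      (hΓ.quotientHeatKernel_ne_top ht y z).lt_top

lemma inner_heatOp_self (hΓ : IsFreeCocompact Γ) (hw : IsWeight Γ w) {t : ℝ} (ht : 0 < t)
    (f : Lp ℝ 2 (volume.withDensity w)) :
    ⟪heatOp hΓ w ht f, f⟫_ℝ = ‖heatOp hΓ w (half_pos ht) f‖ ^ 2 := by
  rw [← heatOp_heatOp hΓ hw (half_pos ht) (half_pos ht) ht (add_halves t),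
    ← real_inner_self_eq_norm_sq]
  exact isSymmetric_heatOp hΓ (half_pos ht) _ _

/-- The heat operators are positive and form a semigroup, so an eigenvector for time `t` is an
eigenvector for time `t/2`, with the nonnegative square root of the eigenvalue. -/
lemma heatOp_half_eq (hΓ : IsFreeCocompact Γ) (hw : IsWeight Γ w) {t : ℝ} (ht : 0 < t)
    {f : Lp ℝ 2 (volume.withDensity w)} {c : ℝ} (hc : 0 < c)
    (hf : heatOp hΓ w ht f = (c ^ 2) • f) : heatOp hΓ w (half_pos ht) f = c • f := by
  set g := heatOp hΓ w (half_pos ht) f - c • f with hg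
  have h1 : heatOp hΓ w (half_pos ht) g = (-c) • g := by
    rw [hg, map_sub, map_smul, heatOp_heatOp hΓ hw (half_pos ht) (half_pos ht) ht (add_halves t),
      hf]
    module
  have h2 := inner_heatOp_self hΓ hw (half_pos ht) g
  rw [h1, inner_smul_left, real_inner_self_eq_norm_sq] at h2
  simp only [conj_trivial] at h2
  have h3 : ‖g‖ ^ 2 = 0 := by
    nlinarith [sq_nonneg ‖g‖, sq_nonneg ‖heatOp hΓ w (half_pos (half_pos ht)) g‖]
  have h4 : g = 0 := by simpa using h3
  exact sub_eq_zero.1 h4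

lemma heatOp_div_two_pow_eq (hΓ : IsFreeCocompact Γ) (hw : IsWeight Γ w) {t : ℝ} (ht : 0 < t)
    {f : Lp ℝ 2 (volume.withDensity w)} {lam : ℝ}
    (hf : heatOp hΓ w ht f = Real.exp (-lam * t) • f) (k : ℕ) (hk : 0 < t / 2 ^ k) :
    heatOp hΓ w hk f = Real.exp (-lam * (t / 2 ^ k)) • f := by
  induction k with
  | zero => simpa using hf
  | succ k ih =>
    have hk' : 0 < t / 2 ^ k := by positivity
    have h := heatOp_half_eq hΓ hw hk' (f := f) (Real.exp_pos (-lam * (t / 2 ^ k / 2))) (by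
      rw [ih hk', ← Real.exp_nat_mul]
      congr 2
      push_cast
      ring)
    have e : t / 2 ^ (k + 1) = t / 2 ^ k / 2 := by rw [pow_succ, div_div]
    simp only [e]
    exact h

lemma eigenvalue_heatOp_nonneg (hΓ : IsFreeCocompact Γ) (hw : IsWeight Γ w) {t : ℝ} (ht : 0 < t)
    {f : Lp ℝ 2 (volume.withDensity w)} {μ : ℝ} (hf : heatOp hΓ w ht f = μ • f) (hf0 : f ≠ 0) :
    0 ≤ μ := by
  have h2 := inner_heatOp_self hΓ hw ht f
  rw [hf, inner_smul_left, real_inner_self_eq_norm_sq] at h2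
  simp only [conj_trivial] at h2
  have h3 : 0 < ‖f‖ ^ 2 := by positivity
  by_contra! h
  nlinarith [sq_nonneg ‖heatOp hΓ w (half_pos ht) f‖]

lemma heatFlow_invariant (hΓ : IsFreeCocompact Γ) (hw : IsWeight Γ w) (hfin : ∫⁻ x, w x ≠ ⊤)
    {t : ℝ} (ht : 0 < t) {F : E → ℝ} (hF : Measurable F)
    (hinv : ∀ (γ : Γ) x, F ((γ : E ≃ᵃⁱ[ℝ] E) x) = F x) {C : ℝ} (hC : ∀ x, |F x| ≤ C)
    (γ : Γ) (x : E) : heatFlow t F ((γ : E ≃ᵃⁱ[ℝ] E) x) = heatFlow t F x := by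
  have := hΓ.countable
  rw [← hw.integral_quotientHeatKernel_mul hΓ hfin ht hF hinv hC,
    ← hw.integral_quotientHeatKernel_mul hΓ hfin ht hF hinv hC]
  simp_rw [quotientHeatKernel_map_left]

/-- Invariant continuous functions that agree almost everywhere for the weighted measure are
equal. -/
lemma eq_of_ae_eq_of_invariant (hΓ : IsFreeCocompact Γ) (hw : IsWeight Γ w) {F G : E → ℝ}
    (hF : Continuous F) (hG : Continuous G)
    (hFi : ∀ (γ : Γ) x, F ((γ : E ≃ᵃⁱ[ℝ] E) x) = F x)
    (hGi : ∀ (γ : Γ) x, G ((γ : E ≃ᵃⁱ[ℝ] E) x) = G x)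
    (h : F =ᵐ[volume.withDensity w] G) : F = G := by
  have := hΓ.countable
  have h1 : ∀ᵐ x : E, F x = G x := hw.ae_of_ae_withDensity (p := fun x => F x = G x)
    (isClosed_eq hF hG).measurableSet (fun γ x => by rw [hFi, hGi]) h
  exact hF.ae_eq_iff_eq volume hG |>.1 h1

/-- An eigenvector of the heat operator has a representative that is an invariant smooth
eigenfunction of the Laplacian. The representative is given by the integral that defines the heat
operator; it is an eigenfunction of the heat flow at all times `t / 2 ^ k`, which tend to zero. -/
lemma exists_invariantEigenspace_rep (hΓ : IsFreeCocompact Γ) (hw : IsWeight Γ w)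
    (hfin : ∫⁻ x, w x ≠ ⊤) {t : ℝ} (ht : 0 < t) {f : Lp ℝ 2 (volume.withDensity w)} {lam : ℝ}
    (hf : heatOp hΓ w ht f = Real.exp (-lam * t) • f) :
    ∃ F ∈ invariantEigenspace Γ lam, F =ᵐ[volume.withDensity w] f := by
  have := hΓ.countable
  set μ := Real.exp (-lam * t) with hμ
  have hμ0 : μ ≠ 0 := (Real.exp_pos _).ne'
  have hk := isBoundedKernel_quotientHeatKernel hΓ ht
  set F : E → ℝ := fun x => μ⁻¹ *
    ∫ y, (quotientHeatKernel Γ t x y).toReal * f y ∂(volume.withDensity w) with hF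
  have hFf : F =ᵐ[volume.withDensity w] f := by
    filter_upwards [coeFn_heatOp hΓ ht f, Lp.coeFn_smul μ f] with x h1 h2
    simp only [hF]
    rw [← h1, hf, h2, Pi.smul_apply, smul_eq_mul, inv_mul_cancel_left₀ hμ0]
  have hFi : ∀ (γ : Γ) x, F ((γ : E ≃ᵃⁱ[ℝ] E) x) = F x := by
    intro γ x
    simp only [hF, quotientHeatKernel_map_left]
  have hFe : F = fun x => μ⁻¹ * ⟪hk.vec (volume.withDensity w) x, f⟫_ℝ := by
    funext x
    rw [hk.inner_vec]
  have hFm : Measurable F := by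
    rw [hFe]
    exact (hk.stronglyMeasurable_integral f).measurable.const_mul _
  obtain ⟨C, hC0, hC⟩ := hk.exists_norm_vec_le (volume.withDensity w)
  have hFb : ∀ x, |F x| ≤ |μ⁻¹| * (C * ‖f‖) := by
    intro x
    rw [hFe, abs_mul]
    gcongr
    exact (abs_real_inner_le_norm _ _).trans (by gcongr; exact hC x)
  have hflow : ∀ s (hs : 0 < s) x, heatFlow s F x =
      ∫ y, (quotientHeatKernel Γ s x y).toReal * f y ∂(volume.withDensity w) := by
    intro s hs x
    rw [← hw.integral_quotientHeatKernel_mul hΓ hfin hs hFm hFi hFb]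
    refine integral_congr_ae ?_
    filter_upwards [hFf] with y hy
    rw [hy]
  have hFs : ContDiff ℝ ∞ F := by
    have : F = fun x => μ⁻¹ * heatFlow t F x := by
      funext x
      rw [hflow t ht]
    rw [this]
    exact contDiff_const.mul (contDiff_heatFlow ht hFm hFb)
  refine ⟨F, ⟨hFs, hFi, ?_⟩, hFf⟩
  have hpos : ∀ k : ℕ, 0 < t / 2 ^ k := fun k => by positivity
  have hlim : Tendsto (fun k : ℕ => t / 2 ^ k) atTop (𝓝 0) := by
    have h := (tendsto_pow_atTop_nhds_zero_of_lt_one (r := (1 / 2 : ℝ)) (by norm_num)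
      (by norm_num)).const_mul t
    rw [mul_zero] at h
    refine h.congr fun k => ?_
    rw [one_div, inv_pow, div_eq_mul_inv]
  obtain ⟨C₀, C₁, C₂, h0, h1, h2⟩ := hΓ.exists_bounds hFs hFi
  refine neg_laplacian_eq_of_heatFlow_eq (hFs.of_le (by norm_cast)) h0 h1 h2 hpos hlim
    fun k x => ?_
  refine congrFun (eq_of_ae_eq_of_invariant hΓ hw
    (G := fun x => Real.exp (-lam * (t / 2 ^ k)) * F x)
    (contDiff_heatFlow (hpos k) hFm hFb).continuous (continuous_const.mul hFs.continuous)
    (heatFlow_invariant hΓ hw hfin (hpos k) hFm hFi hFb) (fun γ x => by rw [hFi]) ?_) x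
  filter_upwards [coeFn_heatOp hΓ (hpos k) f, Lp.coeFn_smul (Real.exp (-lam * (t / 2 ^ k))) f, hFf]
    with x e1 e2 e3
  rw [hflow _ (hpos k), ← e1, heatOp_div_two_pow_eq hΓ hw ht hf, e2, Pi.smul_apply, smul_eq_mul, e3]

/-- An invariant smooth function is bounded, hence in `L²` of the finite weighted measure. -/
lemma memLp_of_mem_invariantEigenspace (hΓ : IsFreeCocompact Γ) {lam : ℝ} {F : E → ℝ}
    (hF : F ∈ invariantEigenspace Γ lam) : MemLp F 2 (volume.withDensity w) := by
  obtain ⟨C₀, -, -, h0, -, -⟩ := hΓ.exists_bounds hF.1 hF.2.1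
  exact MemLp.of_bound hF.1.continuous.aestronglyMeasurable C₀ (Eventually.of_forall h0)

lemma heatOp_toLp (hΓ : IsFreeCocompact Γ) (hw : IsWeight Γ w) (hfin : ∫⁻ x, w x ≠ ⊤) {t : ℝ}
    (ht : 0 < t) {lam : ℝ} {F : E → ℝ} (hF : F ∈ invariantEigenspace Γ lam) :
    heatOp hΓ w ht ((memLp_of_mem_invariantEigenspace hΓ hF).toLp F) =
      Real.exp (-lam * t) • (memLp_of_mem_invariantEigenspace hΓ hF).toLp F := by
  have := hΓ.countable
  obtain ⟨C₀, C₁, C₂, h0, h1, h2⟩ := hΓ.exists_bounds hF.1 hF.2.1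
  have hFL := (memLp_of_mem_invariantEigenspace (w := w) hΓ hF).coeFn_toLp
  refine Lp.ext ?_
  filter_upwards [coeFn_heatOp hΓ ht ((memLp_of_mem_invariantEigenspace hΓ hF).toLp F),
    Lp.coeFn_smul (Real.exp (-lam * t)) ((memLp_of_mem_invariantEigenspace (w := w) hΓ hF).toLp F),
    hFL] with x e1 e2 e3
  rw [e1, e2, Pi.smul_apply, smul_eq_mul, e3,
    ← heatFlow_eq_exp_mul (hF.1.of_le (by norm_cast)) h0 h1 h2 hF.2.2 ht,
    ← hw.integral_quotientHeatKernel_mul hΓ hfin ht hF.1.continuous.measurable hF.2.1 h0]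
  refine integral_congr_ae ?_
  filter_upwards [hFL] with y hy
  rw [hy]

/-- The eigenspace of the Laplacian for `λ` is the eigenspace of the heat operator for
`exp (-λ t)`. -/
lemma finrank_eigenspace_heatOp (hΓ : IsFreeCocompact Γ) (hw : IsWeight Γ w)
    (hfin : ∫⁻ x, w x ≠ ⊤) {t : ℝ} (ht : 0 < t) (lam : ℝ) :
    finrank ℝ (End.eigenspace (heatOp hΓ w ht : Lp ℝ 2 (volume.withDensity w) →ₗ[ℝ]
      Lp ℝ 2 (volume.withDensity w)) (Real.exp (-lam * t))) =
      finrank ℝ (invariantEigenspace Γ lam) := by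
  set L : invariantEigenspace Γ lam →ₗ[ℝ] End.eigenspace (heatOp hΓ w ht :
      Lp ℝ 2 (volume.withDensity w) →ₗ[ℝ] Lp ℝ 2 (volume.withDensity w)) (Real.exp (-lam * t)) :=
    { toFun := fun F => ⟨(memLp_of_mem_invariantEigenspace hΓ F.2).toLp F.1,
        End.mem_eigenspace_iff.2 (heatOp_toLp hΓ hw hfin ht F.2)⟩
      map_add' := fun F G => Subtype.ext (MemLp.toLp_add
        (memLp_of_mem_invariantEigenspace hΓ F.2) (memLp_of_mem_invariantEigenspace hΓ G.2))
      map_smul' := fun c F => Subtype.ext (MemLp.toLp_const_smul c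
        (memLp_of_mem_invariantEigenspace hΓ F.2)) } with hL
  refine (LinearEquiv.ofBijective L ⟨fun F G h => ?_, fun f => ?_⟩).finrank_eq.symm
  · have h1 := congrArg Subtype.val h
    refine Subtype.ext (eq_of_ae_eq_of_invariant hΓ hw F.2.1.continuous G.2.1.continuous
      F.2.2.1 G.2.2.1 ?_)
    exact (MemLp.toLp_eq_toLp_iff (memLp_of_mem_invariantEigenspace hΓ F.2)
      (memLp_of_mem_invariantEigenspace hΓ G.2)).1 h1
  · obtain ⟨F, hF, hFf⟩ := exists_invariantEigenspace_rep hΓ hw hfin ht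
      (End.mem_eigenspace_iff.1 f.2)
    refine ⟨⟨F, hF⟩, Subtype.ext (Lp.ext ?_)⟩
    exact (memLp_of_mem_invariantEigenspace hΓ hF).coeFn_toLp.trans hFf

/-- The trace formula: the heat trace, computed from the spectrum, is the integral of the heat
kernel of the quotient over the diagonal. -/
theorem tsum_exp_mul_finrank_eq_lintegral (hΓ : IsFreeCocompact Γ) (hw : IsWeight Γ w)
    (hfin : ∫⁻ x, w x ≠ ⊤) {t : ℝ} (ht : 0 < t) :
    ∑' lam : ℝ, ENNReal.ofReal (Real.exp (-lam * t)) *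
        (finrank ℝ (invariantEigenspace Γ lam) : ℝ≥0∞) =
      ∫⁻ x, w x * quotientHeatKernel Γ t x x := by
  have := hΓ.countable
  have ht2 := half_pos ht
  have hm : Measurable fun x => quotientHeatKernel Γ t x x :=
    Measurable.comp (g := fun p : E × E => quotientHeatKernel Γ t p.1 p.2) (f := fun x => (x, x))
      (measurable_quotientHeatKernel t) (measurable_id.prodMk measurable_id)
  have hν : ∫⁻ x, w x * quotientHeatKernel Γ t x x =
      ∫⁻ x, quotientHeatKernel Γ t x x ∂(volume.withDensity w) :=
    (lintegral_withDensity_eq_lintegral_mul _ hw.measurable hm).symm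
  rw [hν]
  have hS : ∫⁻ x, quotientHeatKernel Γ t x x ∂(volume.withDensity w) ≠ ⊤ := by
    obtain ⟨C, -, hC⟩ := hΓ.exists_quotientHeatKernel_le ht
    refine ((lintegral_mono fun x => hC x x).trans_lt ?_).ne
    rw [lintegral_const]
    exact ENNReal.mul_lt_top ENNReal.ofReal_lt_top (measure_lt_top _ _)
  have key := tsum_sq_mul_finrank_eigenspace (isSymmetric_heatOp (w := w) hΓ ht2) hS (by
    intro ι b
    rw [heatOp, IsBoundedKernel.tsum_norm_sq_toCLM]
    congr 1
    funext x
    have h1 := hw.lintegral_quotientHeatKernel_mul_quotientHeatKernel ht2 ht2 x x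
    rw [add_halves] at h1
    rw [← h1]
    congr 1
    funext y
    rw [ENNReal.ofReal_pow ENNReal.toReal_nonneg,
      ENNReal.ofReal_toReal (hΓ.quotientHeatKernel_ne_top ht2 x y), sq,
      quotientHeatKernel_comm (t / 2) y x])
  rw [← key]
  -- the Hilbert–Schmidt norm at time `t/2` is the trace at time `t`;
  -- only the numbers `exp (-λ t/2)` can be nonzero eigenvalues
  have hinj : Function.Injective fun lam : ℝ => Real.exp (-lam * (t / 2)) := by
    intro a b h
    have := Real.exp_injective h
    have h' : (a - b) * (t / 2) = 0 := by linear_combination -this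
    rcases mul_eq_zero.1 h' with h0 | h0
    · linarith
    · exact (ht2.ne' h0).elim
  refine Eq.trans ?_ (hinj.tsum_eq (f := fun μ : ℝ => ENNReal.ofReal (μ ^ 2) *
    (finrank ℝ (End.eigenspace (heatOp hΓ w ht2 : Lp ℝ 2 (volume.withDensity w) →ₗ[ℝ]
      Lp ℝ 2 (volume.withDensity w)) μ) : ℝ≥0∞)) ?_)
  · congr 1
    funext lam
    rw [finrank_eigenspace_heatOp hΓ hw hfin ht2, ← Real.exp_nat_mul]
    congr 3
    push_cast
    ring
  · intro μ hμ
    rw [Function.mem_support] at hμ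
    have hμ0 : μ ≠ 0 := by
      rintro rfl
      simp at hμ
    have hne : finrank ℝ (End.eigenspace (heatOp hΓ w ht2 : Lp ℝ 2 (volume.withDensity w) →ₗ[ℝ]
      Lp ℝ 2 (volume.withDensity w)) μ) ≠ 0 := by
      intro h0
      exact hμ (by rw [h0]; simp)
    have hbot : End.eigenspace (heatOp hΓ w ht2 : Lp ℝ 2 (volume.withDensity w) →ₗ[ℝ]
      Lp ℝ 2 (volume.withDensity w)) μ ≠ ⊥ := by
      intro h0
      rw [h0] at hne
      simp at hne
    obtain ⟨f, hf, hf0⟩ := Submodule.exists_mem_ne_zero_of_ne_bot hbot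
    have hnn := eigenvalue_heatOp_nonneg hΓ hw ht2 (End.mem_eigenspace_iff.1 hf) hf0
    have hpos : 0 < μ := lt_of_le_of_ne hnn hμ0.symm
    refine ⟨-Real.log μ / (t / 2), ?_⟩
    dsimp only
    rw [neg_div, neg_neg, div_mul_cancel₀ _ ht2.ne', Real.exp_log hpos]

end Spectral


/-! ### Displacement of an isometry -/

section Displacement

set_option linter.unusedSectionVars false

variable {E : Type} [NormedAddCommGroup E] [InnerProductSpace ℝ E] [FiniteDimensional ℝ E]

/-- The space of vectors fixed by a linear isometry. -/
noncomputable def fixedSpace (B : E ≃ₗᵢ[ℝ] E) : Submodule ℝ E :=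
  LinearMap.ker (LinearMap.id - (B.toLinearEquiv : E →ₗ[ℝ] E))

lemma mem_fixedSpace {B : E ≃ₗᵢ[ℝ] E} {v : E} : v ∈ fixedSpace B ↔ B v = v := by
  rw [fixedSpace, LinearMap.mem_ker, LinearMap.sub_apply, sub_eq_zero]
  exact eq_comm

lemma sub_map_mem_fixedSpace_orthogonal (B : E ≃ₗᵢ[ℝ] E) (v : E) :
    v - B v ∈ (fixedSpace B)ᗮ := by
  rw [Submodule.mem_orthogonal]
  intro k hk
  rw [inner_sub_right, sub_eq_zero]
  nth_rewrite 2 [← mem_fixedSpace.1 hk]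
  exact (B.inner_map_map k v).symm

lemma eq_zero_of_mem_orthogonal_of_sub_map_mem {B : E ≃ₗᵢ[ℝ] E} {v : E}
    (hv : v ∈ (fixedSpace B)ᗮ) (h : v - B v ∈ fixedSpace B) : v = 0 := by
  have h1 : v - B v = 0 := by
    have := (fixedSpace B).inner_right_of_mem_orthogonal h (sub_map_mem_fixedSpace_orthogonal B v)
    exact inner_self_eq_zero.1 this
  have h2 : v ∈ fixedSpace B := mem_fixedSpace.2 (sub_eq_zero.1 h1).symm
  exact inner_self_eq_zero.1 ((fixedSpace B).inner_right_of_mem_orthogonal h2 hv)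

/-- A linear isometry has determinant `(-1)^j`, where `j` is the codimension of its fixed space:
by the Cartan–Dieudonné theorem it is a product of `j` reflections. -/
lemma det_linearIsometryEquiv (B : E ≃ₗᵢ[ℝ] E) :
    LinearMap.det (B.toLinearEquiv : E →ₗ[ℝ] E) = (-1) ^ finrank ℝ (fixedSpace B)ᗮ := by
  -- dropping trivial factors, a product of `m` reflections has a fixed space of codimension at
  -- most `m`, so a list as short as this codimension has no trivial factors
  have key : ∀ l : List E, ∃ m ≤ l.length,
      LinearMap.det (((l.map fun v => (ℝ ∙ v)ᗮ.reflection).prod).toLinearEquiv : E →ₗ[ℝ] E) =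
        (-1) ^ m ∧
      finrank ℝ (fixedSpace (l.map fun v => (ℝ ∙ v)ᗮ.reflection).prod)ᗮ ≤ m := by
    intro l
    induction l with
    | nil =>
      refine ⟨0, le_rfl, ?_, ?_⟩
      · exact LinearMap.det_id
      · have : fixedSpace (1 : E ≃ₗᵢ[ℝ] E) = ⊤ := by
          ext v; simp [mem_fixedSpace]
        simp [this]
    | cons v l ih =>
      obtain ⟨m, hm, hdet, hfin⟩ := ih
      set φ := (l.map fun v => (ℝ ∙ v)ᗮ.reflection).prod with hφ
      rw [List.map_cons, List.prod_cons, ← hφ]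
      by_cases hv : v = 0
      · have h1 : ((ℝ ∙ v)ᗮ.reflection : E ≃ₗᵢ[ℝ] E) = 1 := by
          ext x
          simp [hv, Submodule.reflection_mem_subspace_eq_self]
        rw [h1, one_mul]
        exact ⟨m, by simp; lia, hdet, hfin⟩
      · refine ⟨m + 1, by simpa using hm, ?_, ?_⟩
        · have h1 : (((ℝ ∙ v)ᗮ.reflection * φ).toLinearEquiv : E →ₗ[ℝ] E) =
              (((ℝ ∙ v)ᗮ.reflection).toLinearEquiv : E →ₗ[ℝ] E) ∘ₗ
                (φ.toLinearEquiv : E →ₗ[ℝ] E) := rfl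
          rw [h1, LinearMap.det_comp, hdet]
          have h2 := (ℝ ∙ v)ᗮ.det_reflection
          rw [Submodule.orthogonal_orthogonal, finrank_span_singleton hv, pow_one] at h2
          have h3 : LinearMap.det (((ℝ ∙ v)ᗮ.reflection).toLinearEquiv : E →ₗ[ℝ] E) = -1 := h2
          rw [h3, pow_succ]
          ring
        · have hle : fixedSpace φ ⊓ (ℝ ∙ v)ᗮ ≤ fixedSpace ((ℝ ∙ v)ᗮ.reflection * φ) := by
            rintro x ⟨hx1, hx2⟩
            rw [mem_fixedSpace, LinearIsometryEquiv.coe_mul, Function.comp_apply,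
              mem_fixedSpace.1 hx1]
            exact Submodule.reflection_mem_subspace_eq_self hx2
          have h1 := Submodule.finrank_mono (Submodule.orthogonal_le hle)
          have h2 : (fixedSpace φ ⊓ (ℝ ∙ v)ᗮ)ᗮ = (fixedSpace φ)ᗮ ⊔ (ℝ ∙ v) := by
            rw [← Submodule.orthogonal_orthogonal ((fixedSpace φ)ᗮ ⊔ (ℝ ∙ v)),
              ← Submodule.inf_orthogonal, Submodule.orthogonal_orthogonal]
          rw [h2] at h1
          have h3 := Submodule.finrank_add_le_finrank_add_finrank (fixedSpace φ)ᗮ (ℝ ∙ v)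
          rw [finrank_span_singleton hv] at h3
          lia
  obtain ⟨l, hl, hB⟩ := B.reflections_generate_dim_aux (n := finrank ℝ (fixedSpace B)ᗮ) (by
    exact le_rfl)
  obtain ⟨m, hm, hdet, hfin⟩ := key l
  rw [← hB] at hdet hfin
  rw [hdet]
  congr 1
  lia

variable (γ : E ≃ᵃⁱ[ℝ] E)

lemma map_add_eq (g : E ≃ᵃⁱ[ℝ] E) (x v : E) : g (x + v) = g x + g.linearIsometryEquiv v := by
  have := g.map_vadd x v
  simpa [add_comm] using this

/-- The space of vectors fixed by the linear part of an isometry. -/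
noncomputable abbrev fixedDirections : Submodule ℝ E := fixedSpace γ.linearIsometryEquiv

/-- On the orthogonal complement of the fixed space of the linear part `B`, the map `1 - B` is
invertible. -/
lemma exists_axisOffset (x : E) : ∃ u ∈ (fixedDirections γ)ᗮ,
    (u - γ.linearIsometryEquiv u) - (x - γ x) ∈ fixedDirections γ := by
  set K := fixedDirections γ
  set A : Kᗮ →ₗ[ℝ] Kᗮ := LinearMap.codRestrict Kᗮ
    ((LinearMap.id - (γ.linearIsometryEquiv.toLinearEquiv : E →ₗ[ℝ] E)) ∘ₗ Kᗮ.subtype)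
    (fun v => sub_map_mem_fixedSpace_orthogonal _ _) with hA
  have hinj : Function.Injective A := by
    rw [← LinearMap.ker_eq_bot, LinearMap.ker_eq_bot']
    intro v hv
    have h1 : (v : E) - γ.linearIsometryEquiv v = 0 := congrArg Subtype.val hv
    refine Subtype.ext (eq_zero_of_mem_orthogonal_of_sub_map_mem v.2 ?_)
    rw [h1]
    exact zero_mem _
  obtain ⟨u, hu⟩ := LinearMap.surjective_of_injective hinj (Kᗮ.orthogonalProjectionOnto (x - γ x))
  refine ⟨u, u.2, ?_⟩
  have h1 : (u : E) - γ.linearIsometryEquiv u = Kᗮ.starProjection (x - γ x) :=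
    congrArg Subtype.val hu
  rw [h1, ← neg_mem_iff, neg_sub]
  have h2 := K.starProjection_add_starProjection_orthogonal (x - γ x)
  have h3 : x - γ x - Kᗮ.starProjection (x - γ x) = K.starProjection (x - γ x) := by
    rw [sub_eq_iff_eq_add]; exact h2.symm
  rw [h3]
  exact K.starProjection_apply_mem _

/-- The component of `x` perpendicular to the axis of the isometry `γ`, that is, to the affine
subspace on which the displacement of `γ` is minimal. It is the vector `u` perpendicular to the
fixed directions for which `(1 - B) u` and `x - γ x` differ by a fixed direction, where `B` is the
linear part. -/
noncomputable def axisOffset (x : E) : E := (exists_axisOffset γ x).choose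

lemma axisOffset_mem (x : E) : axisOffset γ x ∈ (fixedDirections γ)ᗮ :=
  (exists_axisOffset γ x).choose_spec.1

lemma axisOffset_spec (x : E) : (axisOffset γ x - γ.linearIsometryEquiv (axisOffset γ x)) -
    (x - γ x) ∈ fixedDirections γ :=
  (exists_axisOffset γ x).choose_spec.2

variable {γ} in
lemma eq_axisOffset {x u : E} (hu : u ∈ (fixedDirections γ)ᗮ)
    (h : (u - γ.linearIsometryEquiv u) - (x - γ x) ∈ fixedDirections γ) : u = axisOffset γ x := by
  rw [← sub_eq_zero]
  refine eq_zero_of_mem_orthogonal_of_sub_map_mem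
    (sub_mem hu (axisOffset_mem γ x)) ?_
  have := sub_mem h (axisOffset_spec γ x)
  convert! this using 1
  rw [map_sub]
  abel

lemma axisOffset_add (x v : E) :
    axisOffset γ (x + v) = axisOffset γ x + (fixedDirections γ)ᗮ.starProjection v := by
  refine (eq_axisOffset (add_mem (axisOffset_mem γ x)
    (Submodule.starProjection_apply_mem _ v)) ?_).symm
  set p := (fixedDirections γ).starProjection v with hp
  have h0 : (fixedDirections γ)ᗮ.starProjection v = v - p := by
    rw [eq_sub_iff_add_eq, add_comm]
    exact Submodule.starProjection_add_starProjection_orthogonal v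
  have h1 : γ.linearIsometryEquiv p = p :=
    mem_fixedSpace.1 (Submodule.starProjection_apply_mem _ v)
  have := axisOffset_spec γ x
  convert! this using 1
  rw [h0, map_add_eq, map_add, map_sub, h1]
  abel

lemma axisOffset_add_smul (x : E) (c : ℝ) :
    axisOffset γ (x + c • axisOffset γ x) = (1 + c) • axisOffset γ x := by
  rw [axisOffset_add, map_smul, Submodule.starProjection_eq_self_iff.2 (axisOffset_mem γ x),
    add_smul, one_smul]

/-- The square of the minimal displacement of an isometry `γ`, which is the length of the component
of the displacement vector in the direction fixed by `γ`. This component is the same at all points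
and is computed at the origin. -/
noncomputable def minDispSq : ℝ := ‖(fixedDirections γ).starProjection (γ 0)‖ ^ 2

/-- The excess of the squared displacement of `γ` at `x` over its minimum. -/
noncomputable def dispExcess (x : E) : ℝ :=
  ‖axisOffset γ x - γ.linearIsometryEquiv (axisOffset γ x)‖ ^ 2

/-- The displacement vector is the sum of its constant component in the fixed direction and
of a perpendicular component that depends linearly on the distance vector from the axis. -/
lemma norm_sub_map_sq (x : E) : ‖x - γ x‖ ^ 2 = minDispSq γ + dispExcess γ x := by
  set K := fixedDirections γ
  set a := axisOffset γ x - γ.linearIsometryEquiv (axisOffset γ x) with ha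
  have haK : a ∈ Kᗮ := sub_map_mem_fixedSpace_orthogonal _ _
  have hk := axisOffset_spec γ x
  rw [← ha] at hk
  have h1 : x - γ x = -(a - (x - γ x)) + a := by abel
  have h2 : K.starProjection (γ 0) = a - (x - γ x) := by
    have e1 : γ 0 = (x - γ.linearIsometryEquiv x) + -a + (a - (x - γ x)) := by
      have := map_add_eq γ 0 x
      rw [zero_add] at this
      rw [this]
      abel
    have e2 : K.starProjection (x - γ.linearIsometryEquiv x) = 0 :=
      (K.starProjection_apply_eq_zero_iff).2 (sub_map_mem_fixedSpace_orthogonal _ _)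
    rw [e1, map_add, map_add, map_neg, e2,
      (K.starProjection_apply_eq_zero_iff).2 haK, Submodule.starProjection_eq_self_iff.2 hk]
    simp
  rw [minDispSq, h2, dispExcess, ← ha]
  have h3 : ⟪-(a - (x - γ x)), a⟫_ℝ = 0 :=
    K.inner_right_of_mem_orthogonal (neg_mem hk) haK
  have h4 := norm_add_sq_real (-(a - (x - γ x))) a
  rw [h3, ← h1, norm_neg] at h4
  linarith

/-- Dilation with factor `c` away from the axis of `γ`. For `c = 0` it is the orthogonal projection
to the axis. -/
noncomputable def axisDilation (c : ℝ) (x : E) : E := x + (c - 1) • axisOffset γ x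

lemma axisOffset_axisDilation (c : ℝ) (x : E) :
    axisOffset γ (axisDilation γ c x) = c • axisOffset γ x := by
  rw [axisDilation, axisOffset_add_smul]
  congr 1
  ring

lemma dispExcess_axisDilation (c : ℝ) (x : E) :
    dispExcess γ (axisDilation γ c x) = c ^ 2 * dispExcess γ x := by
  rw [dispExcess, axisOffset_axisDilation, map_smul, ← smul_sub, norm_smul, mul_pow,
    Real.norm_eq_abs, sq_abs, dispExcess]

lemma axisDilation_axisDilation (c d : ℝ) (x : E) :
    axisDilation γ c (axisDilation γ d x) = axisDilation γ (c * d) x := by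
  rw [axisDilation, axisOffset_axisDilation]
  simp only [axisDilation]
  module

lemma axisDilation_one (x : E) : axisDilation γ 1 x = x := by
  simp [axisDilation]

lemma axisDilation_eq (c : ℝ) (x : E) : axisDilation γ c x =
    (LinearMap.id + (c - 1) • ((fixedDirections γ)ᗮ.starProjection : E →ₗ[ℝ] E) :
      E →ₗ[ℝ] E) x + axisDilation γ c 0 := by
  have h := axisOffset_add γ 0 x
  rw [zero_add] at h
  simp only [axisDilation, h, LinearMap.add_apply, LinearMap.id_apply, LinearMap.smul_apply,
    ContinuousLinearMap.coe_coe, smul_add, zero_add]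
  abel

lemma det_id_add_smul_starProjection (K : Submodule ℝ E) (c : ℝ) :
    LinearMap.det (LinearMap.id + (c - 1) • (Kᗮ.starProjection : E →ₗ[ℝ] E)) =
      c ^ finrank ℝ Kᗮ := by
  let e := K.prodEquivOfIsCompl _ K.isCompl_orthogonal
  have h1 : ∀ v : K, Kᗮ.starProjection (v : E) = 0 := fun v =>
    (Kᗮ.starProjection_apply_eq_zero_iff).2 (by simp)
  have h2 : ∀ v : Kᗮ, Kᗮ.starProjection (v : E) = v := fun v =>
    Submodule.starProjection_mem_subspace_eq_self v
  have : (e.symm : E →ₗ[ℝ] K × Kᗮ) ∘ₗ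
      (LinearMap.id + (c - 1) • (Kᗮ.starProjection : E →ₗ[ℝ] E)) ∘ₗ
      (e.symm.symm : K × Kᗮ →ₗ[ℝ] E) =
      LinearMap.prodMap LinearMap.id (c • LinearMap.id) := by
    refine LinearMap.ext fun v => ?_
    refine (e.symm_apply_eq).2 ?_
    have h3 : ∀ v : K × Kᗮ, e v = (v.1 : E) + (v.2 : E) :=
      fun v => Submodule.coe_prodEquivOfIsCompl' _ _ _ v
    have h4 : ((LinearMap.id + (c - 1) • (Kᗮ.starProjection : E →ₗ[ℝ] E) : E →ₗ[ℝ] E)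
        ((v.1 : E) + (v.2 : E))) = (v.1 : E) + c • (v.2 : E) := by
      simp only [LinearMap.add_apply, LinearMap.id_apply, LinearMap.smul_apply,
        ContinuousLinearMap.coe_coe, map_add, h1, h2]
      module
    rw [h3]
    refine Eq.trans ?_ h4
    simp only [LinearMap.coe_comp, Function.comp_apply, LinearEquiv.symm_symm,
      LinearEquiv.coe_coe, h3]
  rw [← LinearMap.det_conj _ e.symm, this, LinearMap.det_prodMap]
  simp

lemma measurable_axisDilation [MeasurableSpace E] [BorelSpace E] (c : ℝ) :
    Measurable (axisDilation γ c) := by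
  rw [show axisDilation γ c = fun x => _ from funext (axisDilation_eq γ c)]
  exact ((LinearMap.continuous_of_finiteDimensional _).add continuous_const).measurable

lemma measurable_dispExcess [MeasurableSpace E] [BorelSpace E] :
    Measurable (dispExcess γ) := by
  have h : dispExcess γ = fun x => ‖x - γ x‖ ^ 2 - minDispSq γ := by
    funext x
    rw [norm_sub_map_sq]
    ring
  rw [h]
  exact (((continuous_id.sub γ.continuous).norm.pow 2).sub continuous_const).measurable

lemma lintegral_comp_axisDilation [MeasurableSpace E] [BorelSpace E] {c : ℝ} (hc : 0 < c)
    {f : E → ℝ≥0∞} (hf : Measurable f) :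
    ∫⁻ x, f (axisDilation γ c x) =
      ENNReal.ofReal ((c ^ finrank ℝ (fixedDirections γ)ᗮ)⁻¹) * ∫⁻ x, f x := by
  set L : E →ₗ[ℝ] E :=
    LinearMap.id + (c - 1) • ((fixedDirections γ)ᗮ.starProjection : E →ₗ[ℝ] E) with hL
  have hdet : LinearMap.det L = c ^ finrank ℝ (fixedDirections γ)ᗮ :=
    det_id_add_smul_starProjection _ c
  have hLm : Measurable L := L.continuous_of_finiteDimensional.measurable
  have hfm : Measurable fun y => f (y + axisDilation γ c 0) := hf.comp (measurable_add_const _)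
  have hx : ∀ x, f (axisDilation γ c x) = f (L x + axisDilation γ c 0) := fun x => by
    rw [axisDilation_eq γ c x]
  rw [lintegral_congr hx,
    ← lintegral_map (f := fun y => f (y + axisDilation γ c 0)) hfm hLm,
    Measure.map_linearMap_addHaar_eq_smul_addHaar volume (by rw [hdet]; positivity),
    lintegral_smul_measure, hdet, lintegral_add_right_eq_self f, abs_of_pos (by positivity),
    smul_eq_mul]

section Conj

variable (g : E ≃ᵃⁱ[ℝ] E)

lemma linearIsometryEquiv_mul (g h : E ≃ᵃⁱ[ℝ] E) (v : E) :
    (g * h).linearIsometryEquiv v = g.linearIsometryEquiv (h.linearIsometryEquiv v) := rfl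

lemma conj_map_apply (x : E) : (g * γ * g⁻¹) (g x) = g (γ x) :=
  congrArg (fun y => g (γ y)) (g.symm_apply_apply x)

lemma conj_linear_apply (v : E) : (g * γ * g⁻¹).linearIsometryEquiv (g.linearIsometryEquiv v) =
    g.linearIsometryEquiv (γ.linearIsometryEquiv v) := by
  have h : g⁻¹.linearIsometryEquiv (g.linearIsometryEquiv v) = v :=
    g.linearIsometryEquiv.symm_apply_apply v
  rw [linearIsometryEquiv_mul, linearIsometryEquiv_mul, h]

lemma map_mem_fixedDirections_conj {v : E} : g.linearIsometryEquiv v ∈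
    fixedDirections (g * γ * g⁻¹) ↔ v ∈ fixedDirections γ := by
  rw [mem_fixedSpace, mem_fixedSpace, conj_linear_apply]
  exact g.linearIsometryEquiv.injective.eq_iff

lemma fixedDirections_conj : fixedDirections (g * γ * g⁻¹) =
    (fixedDirections γ).map (g.linearIsometryEquiv.toLinearEquiv : E →ₗ[ℝ] E) := by
  ext v
  obtain ⟨u, rfl⟩ := g.linearIsometryEquiv.surjective v
  rw [map_mem_fixedDirections_conj]
  constructor
  · exact fun h => ⟨u, h, rfl⟩
  · rintro ⟨u', h, he⟩
    rwa [← g.linearIsometryEquiv.injective he]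

lemma finrank_fixedDirections_conj :
    finrank ℝ (fixedDirections (g * γ * g⁻¹)) = finrank ℝ (fixedDirections γ) := by
  rw [fixedDirections_conj]
  exact LinearEquiv.finrank_map_eq g.linearIsometryEquiv.toLinearEquiv _

lemma axisOffset_conj (x : E) :
    axisOffset (g * γ * g⁻¹) (g x) = g.linearIsometryEquiv (axisOffset γ x) := by
  refine (eq_axisOffset ?_ ?_).symm
  · rw [Submodule.mem_orthogonal]
    intro v hv
    obtain ⟨u, rfl⟩ := g.linearIsometryEquiv.surjective v
    rw [LinearIsometryEquiv.inner_map_map]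
    exact (Submodule.mem_orthogonal _ _).1 (axisOffset_mem γ x) u
      ((map_mem_fixedDirections_conj γ g).1 hv)
  · have h := (map_mem_fixedDirections_conj γ g).2 (axisOffset_spec γ x)
    convert! h using 1
    rw [conj_linear_apply, conj_map_apply, map_sub, map_sub]
    congr 1
    exact (g.map_vsub x (γ x)).symm

lemma dispExcess_conj (x : E) : dispExcess (g * γ * g⁻¹) (g x) = dispExcess γ x := by
  rw [dispExcess, axisOffset_conj, conj_linear_apply, ← map_sub, LinearIsometryEquiv.norm_map,
    dispExcess]

lemma minDispSq_conj : minDispSq (g * γ * g⁻¹) = minDispSq γ := by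
  have h1 := norm_sub_map_sq (g * γ * g⁻¹) (g 0)
  have h2 := norm_sub_map_sq γ 0
  rw [conj_map_apply, ← dist_eq_norm, g.dist_map, dist_eq_norm, dispExcess_conj] at h1
  linarith

lemma axisDilation_conj (c : ℝ) (x : E) :
    axisDilation (g * γ * g⁻¹) c (g x) = g (axisDilation γ c x) := by
  rw [axisDilation, axisOffset_conj, axisDilation, map_add_eq, map_smul]

end Conj

end Displacement


/-! ### The geometric side of the trace formula -/

section Geometric

set_option linter.unusedSectionVars false

variable {E : Type} [NormedAddCommGroup E] [InnerProductSpace ℝ E] [FiniteDimensional ℝ E]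
  [MeasurableSpace E] [BorelSpace E] {Γ : Subgroup (E ≃ᵃⁱ[ℝ] E)} {w : E → ℝ≥0∞}

/-- The key of an isometry: its minimal squared displacement and the dimension of the fixed space
of its linear part. It is invariant under conjugation. -/
noncomputable def isometryKey (γ : E ≃ᵃⁱ[ℝ] E) : ℝ × ℕ :=
  (minDispSq γ, finrank ℝ (fixedDirections γ))

lemma isometryKey_conj (γ g : E ≃ᵃⁱ[ℝ] E) : isometryKey (g * γ * g⁻¹) = isometryKey γ := by
  rw [isometryKey, minDispSq_conj, finrank_fixedDirections_conj, isometryKey]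

/-- On `Γ × E`, where `Γ` acts on the first factor by conjugation, the weighted integral of an
invariant function does not depend on the weight. The weights `w` and `w'` may depend on the group
element: insert `1 = ∑ g, w' (g (γ, x))`, substitute `g (γ, x)`, and sum over `w` instead. -/
lemma tsum_lintegral_weight_eq [Countable Γ] {w w' f : Γ → E → ℝ≥0∞}
    (hw : ∀ γ, Measurable (w γ)) (hw' : ∀ γ, Measurable (w' γ)) (hf : ∀ γ, Measurable (f γ))
    (hw1 : ∀ γ x, ∑' g : Γ, w (g * γ * g⁻¹) ((g : E ≃ᵃⁱ[ℝ] E) x) = 1)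
    (hw1' : ∀ γ x, ∑' g : Γ, w' (g * γ * g⁻¹) ((g : E ≃ᵃⁱ[ℝ] E) x) = 1)
    (hfi : ∀ (g γ : Γ) x, f (g * γ * g⁻¹) ((g : E ≃ᵃⁱ[ℝ] E) x) = f γ x) :
    ∑' γ, ∫⁻ x, w γ x * f γ x = ∑' γ, ∫⁻ x, w' γ x * f γ x := by
  have hm : ∀ g : Γ, Measurable (g : E ≃ᵃⁱ[ℝ] E) :=
    fun g => measurable_coe_affineIsometryEquiv _
  calc ∑' γ, ∫⁻ x, w γ x * f γ x
      = ∑' γ, ∫⁻ x, ∑' g : Γ, w γ x * f γ x * w' (g * γ * g⁻¹) ((g : E ≃ᵃⁱ[ℝ] E) x) := by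
        simp_rw [ENNReal.tsum_mul_left, hw1', mul_one]
    _ = ∑' γ, ∑' g : Γ, ∫⁻ x, w γ x * f γ x * w' (g * γ * g⁻¹) ((g : E ≃ᵃⁱ[ℝ] E) x) := by
        congr 1
        funext γ
        exact lintegral_tsum fun g =>
          (((hw γ).mul (hf γ)).mul ((hw' _).comp (hm g))).aemeasurable
    _ = ∑' g : Γ, ∑' γ, ∫⁻ x, w γ x * f γ x * w' (g * γ * g⁻¹) ((g : E ≃ᵃⁱ[ℝ] E) x) :=
        ENNReal.tsum_comm
    _ = ∑' g : Γ, ∑' δ : Γ, ∫⁻ y, w (g⁻¹ * δ * g) (((g⁻¹ : Γ) : E ≃ᵃⁱ[ℝ] E) y) *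
          f δ y * w' δ y := by
        congr 1
        funext g
        refine Eq.trans ?_ ((MulAut.conj g).toEquiv.tsum_eq fun δ : Γ =>
          ∫⁻ y, w (g⁻¹ * δ * g) (((g⁻¹ : Γ) : E ≃ᵃⁱ[ℝ] E) y) * f δ y * w' δ y)
        congr 1
        funext γ
        refine Eq.trans ?_ (lintegral_comp_affineIsometryEquiv (g : E ≃ᵃⁱ[ℝ] E) fun y =>
          w (g⁻¹ * (MulAut.conj g).toEquiv γ * g) (((g⁻¹ : Γ) : E ≃ᵃⁱ[ℝ] E) y) *
            f ((MulAut.conj g).toEquiv γ) y * w' ((MulAut.conj g).toEquiv γ) y)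
        congr 1
        funext x
        have e1 : (MulAut.conj g).toEquiv γ = g * γ * g⁻¹ := rfl
        have e2 : g⁻¹ * (g * γ * g⁻¹) * g = γ := by group
        have e3 : ((g⁻¹ : Γ) : E ≃ᵃⁱ[ℝ] E) ((g : E ≃ᵃⁱ[ℝ] E) x) = x :=
          (g : E ≃ᵃⁱ[ℝ] E).symm_apply_apply x
        rw [e1, e2, e3, hfi]
    _ = ∑' g : Γ, ∑' δ : Γ, ∫⁻ y, w (g * δ * g⁻¹) ((g : E ≃ᵃⁱ[ℝ] E) y) * f δ y * w' δ y := by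
        rw [← (Equiv.inv Γ).tsum_eq]
        simp
    _ = ∑' δ : Γ, ∑' g : Γ, ∫⁻ y, w (g * δ * g⁻¹) ((g : E ≃ᵃⁱ[ℝ] E) y) * f δ y * w' δ y :=
        ENNReal.tsum_comm
    _ = ∑' δ : Γ, ∫⁻ y, ∑' g : Γ, w (g * δ * g⁻¹) ((g : E ≃ᵃⁱ[ℝ] E) y) * f δ y * w' δ y := by
        congr 1
        funext δ
        exact (lintegral_tsum fun g =>
          ((((hw _).comp (hm g)).mul (hf δ)).mul (hw' δ)).aemeasurable).symm
    _ = _ := by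
        simp_rw [ENNReal.tsum_mul_right, hw1, one_mul, mul_comm]

open Classical in
/-- The contribution to the heat trace of the elements of `Γ` with a given key, up to elementary
factors. -/
noncomputable def heatCoeff (Γ : Subgroup (E ≃ᵃⁱ[ℝ] E)) (w : E → ℝ≥0∞) (p : ℝ × ℕ) : ℝ≥0∞ :=
  ∑' γ : Γ, if isometryKey (γ : E ≃ᵃⁱ[ℝ] E) = p then
    ∫⁻ x, w x * ENNReal.ofReal (Real.exp (-dispExcess (γ : E ≃ᵃⁱ[ℝ] E) x)) else 0

lemma measurable_exp_dispExcess (γ : E ≃ᵃⁱ[ℝ] E) (s : ℝ) :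
    Measurable fun x => ENNReal.ofReal (Real.exp (-(s * dispExcess γ x))) :=
  (Real.measurable_exp.comp ((measurable_dispExcess γ).const_mul s).neg).ennreal_ofReal

open Classical in
/-- Dilating away from the axes of the elements of `Γ` commutes with the action of `Γ`, and it
reduces the dependence on `s` to a power of `s`. -/
lemma tsum_lintegral_exp_dispExcess [Countable Γ] (hw : IsWeight Γ w) {s : ℝ} (hs : 0 < s)
    (p : ℝ × ℕ) :
    ∑' γ : Γ, (if isometryKey (γ : E ≃ᵃⁱ[ℝ] E) = p then
      ∫⁻ x, w x * ENNReal.ofReal (Real.exp (-(s * dispExcess (γ : E ≃ᵃⁱ[ℝ] E) x))) else 0) =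
    ENNReal.ofReal (s ^ ((p.2 : ℝ) / 2) * s ^ (-(finrank ℝ E : ℝ) / 2)) * heatCoeff Γ w p := by
  set c := √s with hc
  have hc0 : 0 < c := Real.sqrt_pos.2 hs
  -- the dilation by `√s` turns `s * dispExcess` into `dispExcess` and moves the weight `w` to `w'`
  set w' : Γ → E → ℝ≥0∞ := fun γ x => w (axisDilation (γ : E ≃ᵃⁱ[ℝ] E) c⁻¹ x) with hw'
  set f : Γ → E → ℝ≥0∞ := fun γ x => if isometryKey (γ : E ≃ᵃⁱ[ℝ] E) = p then
    ENNReal.ofReal (Real.exp (-dispExcess (γ : E ≃ᵃⁱ[ℝ] E) x)) else 0 with hf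
  have hfm : ∀ γ, Measurable (f γ) := by
    intro γ
    simp only [hf]
    split_ifs
    · simpa using measurable_exp_dispExcess (γ : E ≃ᵃⁱ[ℝ] E) 1
    · exact measurable_const
  have hw'm : ∀ γ, Measurable (w' γ) := fun γ => hw.measurable.comp (measurable_axisDilation _ _)
  have hpow : ∀ γ : Γ, isometryKey (γ : E ≃ᵃⁱ[ℝ] E) = p →
      (c ^ finrank ℝ (fixedDirections (γ : E ≃ᵃⁱ[ℝ] E))ᗮ)⁻¹ =
        s ^ ((p.2 : ℝ) / 2) * s ^ (-(finrank ℝ E : ℝ) / 2) := by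
    intro γ hγ
    have h1 := (fixedDirections (γ : E ≃ᵃⁱ[ℝ] E)).finrank_add_finrank_orthogonal
    have h2 : finrank ℝ (fixedDirections (γ : E ≃ᵃⁱ[ℝ] E)) = p.2 := congrArg Prod.snd hγ
    rw [h2] at h1
    rw [← h1, ← Real.rpow_add hs, hc, Real.sqrt_eq_rpow, ← Real.rpow_natCast, ← Real.rpow_mul hs.le,
      ← Real.rpow_neg hs.le]
    congr 1
    push_cast
    ring
  have hstep : ∀ γ : Γ, (if isometryKey (γ : E ≃ᵃⁱ[ℝ] E) = p then
      ∫⁻ x, w x * ENNReal.ofReal (Real.exp (-(s * dispExcess (γ : E ≃ᵃⁱ[ℝ] E) x))) else 0) =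
      ENNReal.ofReal (s ^ ((p.2 : ℝ) / 2) * s ^ (-(finrank ℝ E : ℝ) / 2)) *
        ∫⁻ x, w' γ x * f γ x := by
    intro γ
    by_cases hγ : isometryKey (γ : E ≃ᵃⁱ[ℝ] E) = p
    · simp only [hγ, if_true, hf]
      rw [← hpow γ hγ, ← lintegral_comp_axisDilation _ hc0]
      · congr 1
        funext x
        rw [dispExcess_axisDilation, Real.sq_sqrt hs.le]
        simp only [hw']
        rw [axisDilation_axisDilation, inv_mul_cancel₀ hc0.ne', axisDilation_one]
      · refine (hw'm γ).mul ?_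
        simpa using measurable_exp_dispExcess (γ : E ≃ᵃⁱ[ℝ] E) 1
    · simp [hγ, hf]
  simp_rw [hstep]
  rw [ENNReal.tsum_mul_left]
  congr 1
  rw [tsum_lintegral_weight_eq hw'm (w' := fun _ => w) (fun _ => hw.measurable) hfm]
  · unfold heatCoeff
    congr 1
    funext γ
    simp only [hf]
    split_ifs
    · rfl
    · simp
  · intro γ x
    have : ∀ g : Γ, w' (g * γ * g⁻¹) ((g : E ≃ᵃⁱ[ℝ] E) x) =
        w ((g : E ≃ᵃⁱ[ℝ] E) (axisDilation (γ : E ≃ᵃⁱ[ℝ] E) c⁻¹ x)) := fun g =>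
      congrArg w (axisDilation_conj (γ : E ≃ᵃⁱ[ℝ] E) (g : E ≃ᵃⁱ[ℝ] E) c⁻¹ x)
    simp_rw [this]
    exact hw.tsum_eq_one _
  · exact fun γ x => hw.tsum_eq_one x
  · intro g γ x
    have h1 : isometryKey ((g * γ * g⁻¹ : Γ) : E ≃ᵃⁱ[ℝ] E) = isometryKey (γ : E ≃ᵃⁱ[ℝ] E) :=
      isometryKey_conj _ _
    have h2 : dispExcess ((g * γ * g⁻¹ : Γ) : E ≃ᵃⁱ[ℝ] E) ((g : E ≃ᵃⁱ[ℝ] E) x) =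
        dispExcess (γ : E ≃ᵃⁱ[ℝ] E) x := dispExcess_conj _ _ _
    simp only [hf, h1, h2]

/-- The expansion of the heat trace, with `s = 1/4t`. -/
theorem lintegral_quotientHeatKernel_diag [Countable Γ] (hw : IsWeight Γ w) {s : ℝ} (hs : 0 < s) :
    ∫⁻ x, w x * quotientHeatKernel Γ (1 / (4 * s)) x x =
      ∑' p : ℝ × ℕ, ENNReal.ofReal (s ^ ((p.2 : ℝ) / 2) * Real.exp (-p.1 * s)) *
        (ENNReal.ofReal (π ^ (-(finrank ℝ E : ℝ) / 2)) * heatCoeff Γ w p) := by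
  classical
  have h1 : ∀ γ : E ≃ᵃⁱ[ℝ] E, ∀ x, ENNReal.ofReal (heatKernel (1 / (4 * s)) (x - γ x)) =
      ENNReal.ofReal (Real.exp (-(isometryKey γ).1 * s)) *
      ENNReal.ofReal (π ^ (-(finrank ℝ E : ℝ) / 2)) *
      ENNReal.ofReal (s ^ ((finrank ℝ E : ℝ) / 2)) *
      ENNReal.ofReal (Real.exp (-(s * dispExcess γ x))) := by
    intro γ x
    rw [← ENNReal.ofReal_mul (by positivity), ← ENNReal.ofReal_mul (by positivity),
      ← ENNReal.ofReal_mul (by positivity)]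
    congr 1
    have e1 : (4 * π * (1 / (4 * s))) = π / s := by field_simp
    have e2 : -(1 / (4 * (1 / (4 * s)))) * (minDispSq γ + dispExcess γ x) =
        -(isometryKey γ).1 * s + -(s * dispExcess γ x) := by
      simp only [isometryKey]
      field_simp
      ring
    rw [heatKernel, norm_sub_map_sq, e1, e2, Real.exp_add, Real.div_rpow (by positivity) hs.le,
      neg_div, Real.rpow_neg hs.le, div_inv_eq_mul]
    ring
  have hwm := hw.measurable
  have hexp : ∀ γ : E ≃ᵃⁱ[ℝ] E, Measurable fun x =>
      w x * ENNReal.ofReal (Real.exp (-(s * dispExcess γ x))) := fun γ =>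
    hwm.mul (measurable_exp_dispExcess γ s)
  have hk : ∀ γ : E ≃ᵃⁱ[ℝ] E, Measurable fun x =>
      w x * ENNReal.ofReal (heatKernel (1 / (4 * s)) (x - γ x)) := fun γ =>
    hwm.mul (((continuous_heatKernel _).comp
      (continuous_id.sub γ.continuous)).measurable.ennreal_ofReal)
  calc ∫⁻ x, w x * quotientHeatKernel Γ (1 / (4 * s)) x x
      = ∑' γ : Γ, ∫⁻ x, w x *
          ENNReal.ofReal (heatKernel (1 / (4 * s)) (x - (γ : E ≃ᵃⁱ[ℝ] E) x)) := by
        unfold quotientHeatKernel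
        simp_rw [← ENNReal.tsum_mul_left]
        exact lintegral_tsum fun γ => (hk γ).aemeasurable
    _ = ∑' γ : Γ, ENNReal.ofReal (Real.exp (-(isometryKey (γ : E ≃ᵃⁱ[ℝ] E)).1 * s)) *
          ENNReal.ofReal (π ^ (-(finrank ℝ E : ℝ) / 2)) *
          ENNReal.ofReal (s ^ ((finrank ℝ E : ℝ) / 2)) *
          ∫⁻ x, w x * ENNReal.ofReal (Real.exp (-(s * dispExcess (γ : E ≃ᵃⁱ[ℝ] E) x))) := by
        congr 1
        funext γ
        simp_rw [h1]
        rw [← lintegral_const_mul _ (hexp _)]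
        congr 1
        funext x
        ring
    _ = ∑' γ : Γ, ∑' p : ℝ × ℕ, ENNReal.ofReal (Real.exp (-p.1 * s)) *
          ENNReal.ofReal (π ^ (-(finrank ℝ E : ℝ) / 2)) *
          ENNReal.ofReal (s ^ ((finrank ℝ E : ℝ) / 2)) *
          (if isometryKey (γ : E ≃ᵃⁱ[ℝ] E) = p then
            ∫⁻ x, w x * ENNReal.ofReal (Real.exp (-(s * dispExcess (γ : E ≃ᵃⁱ[ℝ] E) x)))
            else 0) := by
        congr 1
        funext γ
        rw [tsum_eq_single (isometryKey (γ : E ≃ᵃⁱ[ℝ] E))]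
        · simp
        · intro p hp
          rw [if_neg hp.symm, mul_zero]
    _ = ∑' p : ℝ × ℕ, ENNReal.ofReal (Real.exp (-p.1 * s)) *
          ENNReal.ofReal (π ^ (-(finrank ℝ E : ℝ) / 2)) *
          ENNReal.ofReal (s ^ ((finrank ℝ E : ℝ) / 2)) *
          (ENNReal.ofReal (s ^ ((p.2 : ℝ) / 2) * s ^ (-(finrank ℝ E : ℝ) / 2)) *
            heatCoeff Γ w p) := by
        rw [ENNReal.tsum_comm]
        congr 1
        funext p
        rw [ENNReal.tsum_mul_left, tsum_lintegral_exp_dispExcess hw hs]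
    _ = _ := by
        congr 1
        funext p
        have e : ENNReal.ofReal (s ^ ((finrank ℝ E : ℝ) / 2)) *
            ENNReal.ofReal (s ^ ((p.2 : ℝ) / 2) * s ^ (-(finrank ℝ E : ℝ) / 2)) =
            ENNReal.ofReal (s ^ ((p.2 : ℝ) / 2)) := by
          rw [← ENNReal.ofReal_mul (by positivity), mul_left_comm, ← Real.rpow_add hs]
          congr 1
          rw [neg_div, add_neg_cancel, Real.rpow_zero, mul_one]
        rw [ENNReal.ofReal_mul (q := Real.exp _) (by positivity : 0 ≤ s ^ ((p.2 : ℝ) / 2))]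
        generalize ENNReal.ofReal (s ^ ((p.2 : ℝ) / 2)) = X at e ⊢
        generalize ENNReal.ofReal (s ^ ((finrank ℝ E : ℝ) / 2)) = Y at e ⊢
        rw [← mul_assoc _ _ (heatCoeff Γ w p), mul_assoc _ Y, e]
        ring

/-- A weight is not a null function, since its integral is the volume of the quotient. -/
lemma IsWeight.lintegral_mul_ne_zero [Countable Γ] (hw : IsWeight Γ w) {f : E → ℝ≥0∞}
    (hf : Measurable f) (hf0 : ∀ x, f x ≠ 0) : ∫⁻ x, w x * f x ≠ 0 := by
  intro h
  have hm : Measurable fun x => w x * f x := hw.measurable.mul hf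
  rw [lintegral_eq_zero_iff hm] at h
  have h1 : ∫⁻ x, w x = 0 := by
    rw [lintegral_eq_zero_iff hw.measurable]
    filter_upwards [h] with x hx
    exact (mul_eq_zero.1 hx).resolve_right (hf0 x)
  have h2 := hw.lintegral_mul_tsum (h := fun _ => 1) measurable_const
  have h3 : ∫⁻ x, w x * ∑' _ : Γ, (1 : ℝ≥0∞) = 0 := by
    rw [lintegral_mul_const _ hw.measurable, h1, zero_mul]
  rw [h3] at h2
  simp only [lintegral_const, one_mul] at h2
  exact isOpen_univ.measure_ne_zero volume Set.univ_nonempty h2.symm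

/-- A key has nonzero coefficient exactly if it is the key of an element of `Γ`; there is no
cancellation. -/
lemma heatCoeff_ne_zero_iff [Countable Γ] (hw : IsWeight Γ w) {p : ℝ × ℕ} :
    heatCoeff Γ w p ≠ 0 ↔ ∃ γ ∈ Γ, isometryKey γ = p := by
  classical
  rw [heatCoeff, Ne, ENNReal.tsum_eq_zero, not_forall]
  constructor
  · rintro ⟨γ, hγ⟩
    refine ⟨γ, γ.2, ?_⟩
    by_contra h
    exact hγ (if_neg h)
  · rintro ⟨γ, hγ, rfl⟩
    refine ⟨⟨γ, hγ⟩, ?_⟩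
    simp only [if_true]
    refine hw.lintegral_mul_ne_zero ?_ fun x => ?_
    · simpa using measurable_exp_dispExcess γ 1
    · simp [Real.exp_pos]

/-- Every conjugacy class of `Γ` with bounded minimal displacement meets a fixed finite set. -/
lemma IsFreeCocompact.finite_isometryKey (hΓ : IsFreeCocompact Γ) (L : ℝ) :
    {p : ℝ × ℕ | (∃ γ ∈ Γ, isometryKey γ = p) ∧ p.1 ≤ L}.Finite := by
  obtain ⟨R, hR⟩ := hΓ.exists_radius
  refine ((hΓ.finite_orbit_ball (2 * R + √L + 1) 0).image
    fun γ : Γ => isometryKey (γ : E ≃ᵃⁱ[ℝ] E)).subset ?_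
  rintro p ⟨⟨γ, hγ, rfl⟩, hL⟩
  -- move a point `x` of the axis of `γ` into the ball of radius `R` by an element `g` of `Γ`
  set x := axisDilation γ 0 0
  obtain ⟨g, hg, hgx⟩ := hR x
  refine ⟨⟨g * γ * g⁻¹, mul_mem (mul_mem hg hγ) (inv_mem hg)⟩, ?_, isometryKey_conj γ g⟩
  have h1 : ‖x - γ x‖ ≤ √L := by
    refine Real.le_sqrt_of_sq_le ?_
    rw [norm_sub_map_sq, dispExcess_axisDilation]
    simpa [isometryKey] using hL
  have h2 : ‖(g * γ * g⁻¹) (g x) - g x‖ ≤ √L := by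
    rw [conj_map_apply, ← dist_eq_norm, g.dist_map, dist_comm, dist_eq_norm]
    exact h1
  have h3 : ‖(g * γ * g⁻¹) 0 - (g * γ * g⁻¹) (g x)‖ = ‖g x‖ := by
    rw [← dist_eq_norm, AffineIsometryEquiv.dist_map, dist_zero_left]
  show ‖(g * γ * g⁻¹) 0‖ < 2 * R + √L + 1
  have h4 : (g * γ * g⁻¹) 0 = ((g * γ * g⁻¹) 0 - (g * γ * g⁻¹) (g x)) +
      ((g * γ * g⁻¹) (g x) - g x) + g x := by abel
  rw [h4]
  refine lt_of_le_of_lt (norm_add₃_le) ?_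
  linarith

lemma isometryKey_snd_le (γ : E ≃ᵃⁱ[ℝ] E) : (isometryKey γ).2 ≤ finrank ℝ E :=
  Submodule.finrank_le _

lemma isometryKey_one : isometryKey (1 : E ≃ᵃⁱ[ℝ] E) = (0, finrank ℝ E) := by
  have h : fixedDirections (1 : E ≃ᵃⁱ[ℝ] E) = ⊤ := by
    ext v
    rw [mem_fixedSpace]
    exact iff_of_true rfl trivial
  have h0 : (1 : E ≃ᵃⁱ[ℝ] E) 0 = 0 := rfl
  refine Prod.ext ?_ ?_
  · simp [isometryKey, minDispSq, h0]
  · rw [isometryKey, h, finrank_top]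

/-- Only the identity has a fixed point, so only its key has vanishing displacement. -/
lemma IsFreeCocompact.isometryKey_snd_eq (hΓ : IsFreeCocompact Γ) {γ : E ≃ᵃⁱ[ℝ] E} (hγ : γ ∈ Γ)
    (h0 : (isometryKey γ).1 = 0) : (isometryKey γ).2 = finrank ℝ E := by
  obtain ⟨ρ, hρ, h⟩ := hΓ.exists_sep
  by_cases h1 : γ = 1
  · rw [h1, isometryKey_one]
  · have h2 := h γ hγ h1 (axisDilation γ 0 0)
    have h3 := norm_sub_map_sq γ (axisDilation γ 0 0)
    have h4 : minDispSq γ = 0 := h0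
    rw [dispExcess_axisDilation, h4, ← dist_eq_norm] at h3
    nlinarith

end Geometric


/-! ### What the heat trace determines -/

section Uniqueness

set_option linter.unusedSectionVars false

/-- The functions `s ↦ s ^ (k / 2) * exp (-l * s)` are independent, also in infinite sums, as long
as the exponents `l` that occur are locally finite and the `k` bounded: the term with the smallest
`l` and, for this `l`, the largest `k` dominates the others as `s → ∞`. -/
theorem eq_zero_of_tsum_rpow_mul_exp_eq_zero {c : ℝ × ℕ → ℝ} {N : ℕ}
    (hN : ∀ p, c p ≠ 0 → p.2 ≤ N) (hfin : ∀ L : ℝ, {p | c p ≠ 0 ∧ p.1 ≤ L}.Finite)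
    (hs : ∀ s : ℝ, 0 < s →
      Summable fun p : ℝ × ℕ => s ^ ((p.2 : ℝ) / 2) * Real.exp (-p.1 * s) * c p)
    (h0 : ∀ s : ℝ, 0 < s →
      ∑' p : ℝ × ℕ, s ^ ((p.2 : ℝ) / 2) * Real.exp (-p.1 * s) * c p = 0) (p : ℝ × ℕ) :
    c p = 0 := by
  by_contra hp
  -- the leading exponents: `q.1` is minimal, and `q.2` is maximal for this `q.1`
  obtain ⟨q1, ⟨hq1, -⟩, hq1min⟩ := Set.exists_min_image _ Prod.fst (hfin p.1) ⟨p, hp, le_rfl⟩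
  obtain ⟨q, ⟨hq, hqq1⟩, hqmax⟩ :=
    Set.exists_max_image _ Prod.snd (hfin q1.1) ⟨q1, hq1, le_rfl⟩
  have hmin1 : ∀ r, c r ≠ 0 → q1.1 ≤ r.1 := by
    intro r hr
    by_contra! hlt
    by_cases hrp : r.1 ≤ p.1
    · exact absurd (hq1min r ⟨hr, hrp⟩) (not_le.2 hlt)
    · exact absurd (hq1min p ⟨hp, le_rfl⟩) (not_le.2 (by linarith))
  have hqeq : q.1 = q1.1 := le_antisymm hqq1 (hmin1 q hq)
  rw [← hqeq] at hmin1 hqmax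
  obtain ⟨d, hd, hgap⟩ : ∃ d > 0, ∀ r, c r ≠ 0 → q.1 < r.1 → q.1 + d ≤ r.1 := by
    have hH : {r | c r ≠ 0 ∧ q.1 < r.1 ∧ r.1 ≤ q.1 + 1}.Finite :=
      (hfin (q.1 + 1)).subset fun r hr => ⟨hr.1, hr.2.2⟩
    by_cases hne : {r | c r ≠ 0 ∧ q.1 < r.1 ∧ r.1 ≤ q.1 + 1}.Nonempty
    · obtain ⟨m, ⟨hm, hm1, hm2⟩, hmmin⟩ := Set.exists_min_image _ Prod.fst hH hne
      refine ⟨m.1 - q.1, by linarith, fun r hr hlt => ?_⟩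
      by_cases hr1 : r.1 ≤ q.1 + 1
      · linarith [hmmin r ⟨hr, hlt, hr1⟩]
      · linarith
    · refine ⟨1, one_pos, fun r hr hlt => ?_⟩
      by_contra! hr1
      exact hne ⟨r, hr, hlt, hr1.le⟩
  set g : ℝ → ℝ × ℕ → ℝ := fun s r =>
    s ^ (((r.2 : ℝ) - q.2) / 2) * Real.exp (-(r.1 - q.1) * s) * c r with hg
  have hgsum : ∀ s : ℝ, 0 < s → ∑' r, g s r = 0 := by
    intro s hs0
    have : ∀ r, g s r = (s ^ (-((q.2 : ℝ) / 2)) * Real.exp (q.1 * s)) *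
        (s ^ ((r.2 : ℝ) / 2) * Real.exp (-r.1 * s) * c r) := by
      intro r
      have e1 : ((r.2 : ℝ) - q.2) / 2 = -((q.2 : ℝ) / 2) + (r.2 : ℝ) / 2 := by ring
      have e2 : -(r.1 - q.1) * s = q.1 * s + -r.1 * s := by ring
      simp only [hg]
      rw [e1, e2, Real.rpow_add hs0, Real.exp_add]
      ring
    simp_rw [this]
    rw [tsum_mul_left, h0 s hs0, mul_zero]
  have hlim : ∀ r, Tendsto (fun s => g s r) atTop (𝓝 (if r = q then c q else 0)) := by
    intro r
    by_cases hr : c r = 0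
    · have : r ≠ q := fun h => hq (h ▸ hr)
      simp [hg, hr, this]
    rcases (hmin1 r hr).lt_or_eq with hlt | heq
    · have hne : r ≠ q := fun h => hlt.ne' (by rw [h])
      rw [if_neg hne]
      have := (tendsto_rpow_mul_exp_neg_mul_atTop_nhds_zero (((r.2 : ℝ) - q.2) / 2) (r.1 - q.1)
        (sub_pos.2 hlt)).mul_const (c r)
      rwa [zero_mul] at this
    · by_cases hrq : r = q
      · subst hrq
        simp [hg]
      · rw [if_neg hrq]
        have hlt : r.2 < q.2 := lt_of_le_of_ne (hqmax r ⟨hr, heq.ge⟩) fun h =>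
          hrq (Prod.ext heq.symm h)
        have hlt' : (r.2 : ℝ) < q.2 := by exact_mod_cast hlt
        have := (tendsto_rpow_neg_atTop (y := ((q.2 : ℝ) - r.2) / 2) (by linarith)).mul_const (c r)
        rw [zero_mul] at this
        refine this.congr fun s => ?_
        simp only [hg]
        rw [← heq, sub_self, neg_zero, zero_mul, Real.exp_zero, mul_one]
        congr 2
        ring
  -- half of the exponential decay absorbs the powers of `s`, the other half gives the summable bound
  have hbound : ∀ᶠ s : ℝ in atTop, ∀ r, ‖g s r‖ ≤ (2 : ℝ) ^ ((N : ℝ) / 2) * Real.exp (q.1 / 2) *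
      ‖(1 / 2 : ℝ) ^ ((r.2 : ℝ) / 2) * Real.exp (-r.1 * (1 / 2)) * c r‖ := by
    have h1 := (tendsto_rpow_mul_exp_neg_mul_atTop_nhds_zero ((N : ℝ) / 2) (d / 2)
      (by linarith)).eventually (gt_mem_nhds one_pos)
    filter_upwards [h1, eventually_ge_atTop 1] with s h1 hs1 r
    by_cases hr : c r = 0
    · simp [hg, hr]
    have hs0 : 0 < s := by linarith
    have hrN : (r.2 : ℝ) ≤ N := by exact_mod_cast hN r hr
    have h2 : 1 ≤ (2 : ℝ) ^ ((N : ℝ) / 2) * (1 / 2 : ℝ) ^ ((r.2 : ℝ) / 2) := by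
      rw [one_div, Real.inv_rpow zero_le_two, ← Real.rpow_neg zero_le_two,
        ← Real.rpow_add zero_lt_two]
      exact Real.one_le_rpow one_le_two (by linarith)
    have h3 : s ^ (((r.2 : ℝ) - q.2) / 2) * Real.exp (-(r.1 - q.1) * s) ≤
        Real.exp (-(r.1 - q.1) / 2) := by
      rcases (hmin1 r hr).lt_or_eq with hlt | heq
      · have hg1 := hgap r hr hlt
        have h4 : s ^ (((r.2 : ℝ) - q.2) / 2) ≤ s ^ ((N : ℝ) / 2) :=
          Real.rpow_le_rpow_of_exponent_le hs1 (by
            have : (0 : ℝ) ≤ q.2 := Nat.cast_nonneg _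
            linarith)
        have h5 : Real.exp (-(r.1 - q.1) * s) ≤
            Real.exp (-(d / 2) * s) * Real.exp (-(r.1 - q.1) / 2) := by
          rw [← Real.exp_add]
          refine Real.exp_le_exp.2 ?_
          nlinarith
        calc _ ≤ s ^ ((N : ℝ) / 2) * (Real.exp (-(d / 2) * s) * Real.exp (-(r.1 - q.1) / 2)) := by
              gcongr
          _ = s ^ ((N : ℝ) / 2) * Real.exp (-(d / 2) * s) * Real.exp (-(r.1 - q.1) / 2) := by ring
          _ ≤ 1 * Real.exp (-(r.1 - q.1) / 2) := by gcongr
          _ = _ := one_mul _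
      · rw [← heq]
        simp only [sub_self, neg_zero, zero_mul, zero_div, Real.exp_zero, mul_one]
        have : (r.2 : ℝ) ≤ q.2 := by exact_mod_cast hqmax r ⟨hr, heq.ge⟩
        exact Real.rpow_le_one_of_one_le_of_nonpos hs1 (by linarith)
    have h6 : Real.exp (-(r.1 - q.1) / 2) = Real.exp (q.1 / 2) * Real.exp (-r.1 * (1 / 2)) := by
      rw [← Real.exp_add]
      congr 1
      ring
    simp only [hg]
    have h8 : ∀ X : ℝ, 0 ≤ X → ‖X * c r‖ = X * ‖c r‖ := fun X hX => by
      rw [norm_mul, Real.norm_of_nonneg hX]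
    rw [h8 _ (by positivity), h8 _ (by positivity)]
    calc _ ≤ Real.exp (-(r.1 - q.1) / 2) * ‖c r‖ := by gcongr
      _ = 1 * (Real.exp (q.1 / 2) * Real.exp (-r.1 * (1 / 2))) * ‖c r‖ := by rw [h6, one_mul]
      _ ≤ ((2 : ℝ) ^ ((N : ℝ) / 2) * (1 / 2 : ℝ) ^ ((r.2 : ℝ) / 2)) *
          (Real.exp (q.1 / 2) * Real.exp (-r.1 * (1 / 2))) * ‖c r‖ := by gcongr
      _ = _ := by ring
  have key := tendsto_tsum_of_dominated_convergence
    (((hs (1 / 2) (by norm_num)).norm).mul_left _) hlim hbound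
  rw [tsum_ite_eq] at key
  have h7 : Tendsto (fun s => ∑' r, g s r) atTop (𝓝 0) :=
    tendsto_const_nhds.congr' (by
      filter_upwards [eventually_gt_atTop 0] with s hs0
      exact (hgsum s hs0).symm)
  exact hq (tendsto_nhds_unique key h7)

/-- Uniqueness of the expansion of the heat trace. -/
theorem eq_of_tsum_ofReal_rpow_mul_exp_eq {a b : ℝ × ℕ → ℝ≥0∞} {N : ℕ}
    (haN : ∀ p, a p ≠ 0 → p.2 ≤ N) (hbN : ∀ p, b p ≠ 0 → p.2 ≤ N)
    (hafin : ∀ L : ℝ, {p | a p ≠ 0 ∧ p.1 ≤ L}.Finite)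
    (hbfin : ∀ L : ℝ, {p | b p ≠ 0 ∧ p.1 ≤ L}.Finite)
    (hne : ∀ s : ℝ, 0 < s → ∑' p : ℝ × ℕ,
      ENNReal.ofReal (s ^ ((p.2 : ℝ) / 2) * Real.exp (-p.1 * s)) * a p ≠ ⊤)
    (heq : ∀ s : ℝ, 0 < s →
      ∑' p : ℝ × ℕ, ENNReal.ofReal (s ^ ((p.2 : ℝ) / 2) * Real.exp (-p.1 * s)) * a p =
      ∑' p : ℝ × ℕ, ENNReal.ofReal (s ^ ((p.2 : ℝ) / 2) * Real.exp (-p.1 * s)) * b p) :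
    a = b := by
  have hfinite : ∀ a : ℝ × ℕ → ℝ≥0∞, (∑' p : ℝ × ℕ,
      ENNReal.ofReal ((1 : ℝ) ^ ((p.2 : ℝ) / 2) * Real.exp (-p.1 * 1)) * a p ≠ ⊤) →
      ∀ p, a p ≠ ⊤ := by
    intro a h p hp
    refine ENNReal.ne_top_of_tsum_ne_top h p ?_
    rw [hp, ENNReal.mul_top]
    exact (ENNReal.ofReal_pos.2 (by positivity)).ne'
  have hat := hfinite a (hne 1 one_pos)
  have hbt := hfinite b (by rw [← heq 1 one_pos]; exact hne 1 one_pos)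
  have hreal : ∀ (a : ℝ × ℕ → ℝ≥0∞) (s : ℝ), 0 < s → (∑' p : ℝ × ℕ,
      ENNReal.ofReal (s ^ ((p.2 : ℝ) / 2) * Real.exp (-p.1 * s)) * a p ≠ ⊤) →
      HasSum (fun p : ℝ × ℕ => s ^ ((p.2 : ℝ) / 2) * Real.exp (-p.1 * s) * (a p).toReal)
        (∑' p : ℝ × ℕ,
          ENNReal.ofReal (s ^ ((p.2 : ℝ) / 2) * Real.exp (-p.1 * s)) * a p).toReal := by
    intro a s hs h
    have h1 := ENNReal.summable_toReal h
    rw [ENNReal.tsum_toReal_eq fun p => ENNReal.ne_top_of_tsum_ne_top h p]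
    have h2 : ∀ p : ℝ × ℕ, s ^ ((p.2 : ℝ) / 2) * Real.exp (-p.1 * s) * (a p).toReal =
        (ENNReal.ofReal (s ^ ((p.2 : ℝ) / 2) * Real.exp (-p.1 * s)) * a p).toReal := fun p => by
      rw [ENNReal.toReal_mul, ENNReal.toReal_ofReal (by positivity)]
    simp_rw [h2]
    exact h1.hasSum
  have hsub : ∀ s : ℝ, 0 < s → HasSum (fun p : ℝ × ℕ =>
      s ^ ((p.2 : ℝ) / 2) * Real.exp (-p.1 * s) * ((a p).toReal - (b p).toReal)) 0 := by
    intro s hs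
    have h1 := hreal a s hs (hne s hs)
    have h2 := hreal b s hs (by rw [← heq s hs]; exact hne s hs)
    rw [heq s hs] at h1
    simpa [mul_sub] using h1.sub h2
  have hor : ∀ p, (a p).toReal - (b p).toReal ≠ 0 → a p ≠ 0 ∨ b p ≠ 0 := by
    intro p hp
    by_contra! h
    rw [h.1, h.2] at hp
    exact hp (sub_self _)
  funext p
  rw [← ENNReal.toReal_eq_toReal_iff' (hat p) (hbt p), ← sub_eq_zero]
  refine eq_zero_of_tsum_rpow_mul_exp_eq_zero (N := N)
    (c := fun p => (a p).toReal - (b p).toReal) (fun p hp => ?_) (fun L => ?_)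
    (fun s hs => (hsub s hs).summable) (fun s hs => (hsub s hs).tsum_eq) p
  · exact (hor p hp).elim (haN p) (hbN p)
  · refine ((hafin L).union (hbfin L)).subset ?_
    rintro p ⟨hp, hL⟩
    exact (hor p hp).imp (fun h => ⟨h, hL⟩) fun h => ⟨h, hL⟩

variable {E E' : Type} [NormedAddCommGroup E] [InnerProductSpace ℝ E] [FiniteDimensional ℝ E]
  [MeasurableSpace E] [BorelSpace E] {Γ : Subgroup (E ≃ᵃⁱ[ℝ] E)}
  [NormedAddCommGroup E'] [InnerProductSpace ℝ E'] [FiniteDimensional ℝ E']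
  [MeasurableSpace E'] [BorelSpace E'] {Γ' : Subgroup (E' ≃ᵃⁱ[ℝ] E')}

/-- The heat trace as a sum over the keys of the elements of `Γ`. -/
lemma IsFreeCocompact.exists_heat_expansion (hΓ : IsFreeCocompact Γ) :
    ∃ a : ℝ × ℕ → ℝ≥0∞, (∀ p, a p ≠ 0 ↔ ∃ γ ∈ Γ, isometryKey γ = p) ∧ ∀ s : ℝ, 0 < s →
      ∑' p : ℝ × ℕ, ENNReal.ofReal (s ^ ((p.2 : ℝ) / 2) * Real.exp (-p.1 * s)) * a p ≠ ⊤ ∧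
      ∑' lam : ℝ, ENNReal.ofReal (Real.exp (-lam * (1 / (4 * s)))) *
        (finrank ℝ (invariantEigenspace Γ lam) : ℝ≥0∞) =
      ∑' p : ℝ × ℕ, ENNReal.ofReal (s ^ ((p.2 : ℝ) / 2) * Real.exp (-p.1 * s)) * a p := by
  have := hΓ.countable
  obtain ⟨w, hw, hfin⟩ := hΓ.exists_isWeight
  have := isFiniteMeasure_withDensity hfin
  refine ⟨fun p => ENNReal.ofReal (π ^ (-(finrank ℝ E : ℝ) / 2)) * heatCoeff Γ w p,
    fun p => ?_, fun s hs => ?_⟩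
  · rw [mul_ne_zero_iff, heatCoeff_ne_zero_iff hw, and_iff_right]
    exact (ENNReal.ofReal_pos.2 (by positivity)).ne'
  · rw [← lintegral_quotientHeatKernel_diag hw hs]
    refine ⟨?_, tsum_exp_mul_finrank_eq_lintegral hΓ hw hfin (by positivity)⟩
    obtain ⟨C, -, hC⟩ := hΓ.exists_quotientHeatKernel_le (t := 1 / (4 * s)) (by positivity)
    refine ((lintegral_mono fun x => mul_le_mul_right (hC x x) (w x)).trans_lt ?_).ne
    rw [lintegral_mul_const _ hw.measurable]
    exact ENNReal.mul_lt_top hfin.lt_top ENNReal.ofReal_lt_top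

/-- Groups with the same invariant spectrum have the same keys. -/
theorem exists_isometryKey_iff (hΓ : IsFreeCocompact Γ) (hΓ' : IsFreeCocompact Γ')
    (h : ∀ lam, finrank ℝ (invariantEigenspace Γ lam) = finrank ℝ (invariantEigenspace Γ' lam))
    (p : ℝ × ℕ) : (∃ γ ∈ Γ, isometryKey γ = p) ↔ ∃ γ ∈ Γ', isometryKey γ = p := by
  obtain ⟨a, ha, hax⟩ := hΓ.exists_heat_expansion
  obtain ⟨b, hb, hbx⟩ := hΓ'.exists_heat_expansion
  have hab : a = b := by
    refine eq_of_tsum_ofReal_rpow_mul_exp_eq (N := max (finrank ℝ E) (finrank ℝ E'))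
      (fun p hp => ?_) (fun p hp => ?_) (fun L => ?_) (fun L => ?_) (fun s hs => (hax s hs).1)
      fun s hs => ?_
    · obtain ⟨γ, -, rfl⟩ := (ha p).1 hp
      exact (isometryKey_snd_le γ).trans (le_max_left _ _)
    · obtain ⟨γ, -, rfl⟩ := (hb p).1 hp
      exact (isometryKey_snd_le γ).trans (le_max_right _ _)
    · simp_rw [ha]
      exact hΓ.finite_isometryKey L
    · simp_rw [hb]
      exact hΓ'.finite_isometryKey L
    · rw [← (hax s hs).2, ← (hbx s hs).2]
      simp_rw [h]
  rw [← ha, ← hb, hab]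

/-- The dimension is the second component of the key of the identity. -/
theorem finrank_eq_of_finrank_invariantEigenspace_eq (hΓ : IsFreeCocompact Γ)
    (hΓ' : IsFreeCocompact Γ')
    (h : ∀ lam, finrank ℝ (invariantEigenspace Γ lam) = finrank ℝ (invariantEigenspace Γ' lam)) :
    finrank ℝ E = finrank ℝ E' := by
  obtain ⟨γ, hγ, hk⟩ := (exists_isometryKey_iff hΓ hΓ' h _).1 ⟨1, Γ.one_mem, isometryKey_one⟩
  have := hΓ'.isometryKey_snd_eq hγ (by rw [hk])
  rw [← this, hk]

lemma det_linearIsometryEquiv_pos_iff (γ : E ≃ᵃⁱ[ℝ] E) :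
    0 < LinearMap.det (γ.linearIsometryEquiv.toLinearEquiv : E →ₗ[ℝ] E) ↔
      Even (finrank ℝ E - (isometryKey γ).2) := by
  have h1 := (fixedDirections γ).finrank_add_finrank_orthogonal
  have h2 : finrank ℝ E - (isometryKey γ).2 = finrank ℝ (fixedDirections γ)ᗮ := by
    have h3 : (isometryKey γ).2 = finrank ℝ (fixedDirections γ) := rfl
    omega
  rw [det_linearIsometryEquiv, h2]
  rcases Nat.even_or_odd (finrank ℝ (fixedDirections γ)ᗮ) with he | ho
  · simp [he.neg_one_pow, he]
  · rw [ho.neg_one_pow]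
    exact iff_of_false (by norm_num) (Nat.not_even_iff_odd.2 ho)

/-- Since the determinant of an orthogonal map is determined by the dimension of its fixed space,
the invariant spectrum determines whether a group preserves the orientation. -/
theorem forall_det_pos_iff (hΓ : IsFreeCocompact Γ) (hΓ' : IsFreeCocompact Γ')
    (h : ∀ lam, finrank ℝ (invariantEigenspace Γ lam) = finrank ℝ (invariantEigenspace Γ' lam)) :
    (∀ γ ∈ Γ, 0 < LinearMap.det (γ.linearIsometryEquiv.toLinearEquiv : E →ₗ[ℝ] E)) ↔
      ∀ γ ∈ Γ', 0 < LinearMap.det (γ.linearIsometryEquiv.toLinearEquiv : E' →ₗ[ℝ] E') := by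
  simp_rw [det_linearIsometryEquiv_pos_iff,
    finrank_eq_of_finrank_invariantEigenspace_eq hΓ hΓ' h]
  constructor
  · intro H γ hγ
    obtain ⟨δ, hδ, hk⟩ := (exists_isometryKey_iff hΓ hΓ' h _).2 ⟨γ, hγ, rfl⟩
    rw [← hk]
    exact H δ hδ
  · intro H γ hγ
    obtain ⟨δ, hδ, hk⟩ := (exists_isometryKey_iff hΓ hΓ' h _).1 ⟨γ, hγ, rfl⟩
    rw [← hk]
    exact H δ hδ

end Uniqueness


/-! ### Rigidity of distance-preserving maps -/

section Rigidity

variable {E : Type} [NormedAddCommGroup E] [InnerProductSpace ℝ E] [FiniteDimensional ℝ E]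

/-- A distance-preserving map from a ball to the space itself is the restriction of an isometry. -/
theorem exists_affineIsometryEquiv_eqOn_ball {f : E → E} {x : E} {r : ℝ} (hr : 0 < r)
    (hf : ∀ y ∈ Metric.ball x r, ∀ z ∈ Metric.ball x r, dist (f y) (f z) = dist y z) :
    ∃ g : E ≃ᵃⁱ[ℝ] E, Set.EqOn f g (Metric.ball x r) := by
  -- by polarization `h` preserves inner products; hence it agrees with the linear isometry that has
  -- the same values on the multiples `c • b i` of an orthonormal basis, small enough to lie in the
  -- ball
  set h : E → E := fun v => f (x + v) - f x with hh
  have hmem : ∀ v : E, ‖v‖ < r → x + v ∈ Metric.ball x r := fun v hv => by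
    simpa [Metric.mem_ball, dist_eq_norm] using hv
  have hx : x ∈ Metric.ball x r := Metric.mem_ball_self hr
  have hnorm : ∀ v : E, ‖v‖ < r → ‖h v‖ = ‖v‖ := fun v hv => by
    have := hf _ (hmem v hv) _ hx
    simpa [dist_eq_norm] using this
  have hsub : ∀ u v : E, ‖u‖ < r → ‖v‖ < r → ‖h u - h v‖ = ‖u - v‖ := fun u v hu hv => by
    have := hf _ (hmem u hu) _ (hmem v hv)
    simpa [hh, dist_eq_norm] using this
  have hinner : ∀ u v : E, ‖u‖ < r → ‖v‖ < r → ⟪h u, h v⟫_ℝ = ⟪u, v⟫_ℝ := fun u v hu hv => by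
    rw [real_inner_eq_norm_mul_self_add_norm_mul_self_sub_norm_sub_mul_self_div_two,
      real_inner_eq_norm_mul_self_add_norm_mul_self_sub_norm_sub_mul_self_div_two,
      hnorm u hu, hnorm v hv, hsub u v hu hv]
  set b := stdOrthonormalBasis ℝ E
  set c : ℝ := r / 2 with hc
  have hc0 : 0 < c := half_pos hr
  have hcb : ∀ i, ‖c • b i‖ < r := fun i => by
    rw [norm_smul, b.norm_eq_one, mul_one, Real.norm_of_nonneg hc0.le]
    exact half_lt_self hr
  set v : Fin (finrank ℝ E) → E := fun i => c⁻¹ • h (c • b i) with hv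
  have hvinner : ∀ u i, ‖u‖ < r → ⟪h u, v i⟫_ℝ = ⟪u, b i⟫_ℝ := fun u i hu => by
    rw [hv, real_inner_smul_right, hinner _ _ hu (hcb i), real_inner_smul_right,
      inv_mul_cancel_left₀ hc0.ne']
  have hvo : Orthonormal ℝ v := by
    rw [orthonormal_iff_ite]
    intro i j
    rw [hv]
    simp only
    rw [real_inner_smul_left, hvinner _ _ (hcb i), real_inner_smul_left,
      inv_mul_cancel_left₀ hc0.ne', orthonormal_iff_ite.1 b.orthonormal]
  set A : E →ₗ[ℝ] E := b.toBasis.constr ℝ v with hA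
  have hAb : A ∘ b.toBasis = v := by
    funext i
    exact b.toBasis.constr_basis ℝ v i
  set L : E →ₗᵢ[ℝ] E := A.isometryOfOrthonormal (v := b.toBasis)
    (by rw [b.coe_toBasis]; exact b.orthonormal) (by rw [hAb]; exact hvo) with hL
  have hLsum : ∀ u, L u = ∑ i, ⟪b i, u⟫_ℝ • v i := fun u => by
    show A u = _
    rw [hA, Basis.constr_apply_fintype]
    simp [b.repr_apply_apply]
  have hhL : ∀ u, ‖u‖ < r → h u = L u := fun u hu => by
    rw [← sub_eq_zero, ← inner_self_eq_zero (𝕜 := ℝ)]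
    have h1 : ⟪h u, L u⟫_ℝ = ‖u‖ * ‖u‖ := by
      rw [hLsum, inner_sum, ← real_inner_self_eq_norm_mul_norm, ← b.sum_inner_mul_inner u u]
      refine Finset.sum_congr rfl fun i _ => ?_
      rw [real_inner_smul_right, hvinner u i hu, mul_comm]
    clear_value h
    rw [inner_sub_left, inner_sub_right, inner_sub_right, real_inner_comm (h u) (L u), h1,
      real_inner_self_eq_norm_mul_norm, real_inner_self_eq_norm_mul_norm, hnorm u hu, L.norm_map]
    ring
  set e := L.toLinearIsometryEquiv rfl
  refine ⟨AffineIsometryEquiv.mk' (fun y => L (y - x) + f x) e x fun y => ?_, fun y hy => ?_⟩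
  · simp [e]
  · have h2 := hhL (y - x) (by rwa [← dist_eq_norm])
    simp only [hh, add_sub_cancel] at h2
    show f y = L (y - x) + f x
    rw [← h2, sub_add_cancel]

lemma affineIsometryEquiv_eq_of_eventuallyEq {g g' : E ≃ᵃⁱ[ℝ] E} {x : E} (h : g =ᶠ[𝓝 x] g') :
    g = g' := by
  ext y
  have h1 : Tendsto (fun t : ℝ => x + t • (y - x)) (𝓝[>] 0) (𝓝 x) := by
    have : Continuous fun t : ℝ => x + t • (y - x) := by fun_prop
    simpa using (this.tendsto 0).mono_left nhdsWithin_le_nhds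
  obtain ⟨t, ht, ht0⟩ := ((h1.eventually h).and self_mem_nhdsWithin).exists
  have hx := h.eq_of_nhds
  rw [map_add_eq, map_add_eq, hx, add_right_inj, map_smul, map_smul] at ht
  have h2 := smul_right_injective E (ne_of_gt ht0) ht
  have h3 : y = x + (y - x) := by abel
  rw [h3, map_add_eq, map_add_eq, hx, h2]

end Rigidity

/-! ### Local isometries and their analytic continuation -/

section LocalIso

set_option linter.unusedSectionVars false

variable {E : Type} [NormedAddCommGroup E] [InnerProductSpace ℝ E] [FiniteDimensional ℝ E]
  {M : Type*} [MetricSpace M] {A B F G : E → M} {ρ r : ℝ} {x y : E}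

/-- `F` maps the ball of radius `ρ` about `x` isometrically onto the ball about `F x`. -/
structure IsLocalIso (ρ : ℝ) (F : E → M) (x : E) : Prop where
  dist_eq : ∀ y ∈ Metric.ball x ρ, ∀ z ∈ Metric.ball x ρ, dist (F y) (F z) = dist y z
  ball_subset : Metric.ball (F x) ρ ⊆ F '' Metric.ball x ρ

lemma IsLocalIso.injOn (h : IsLocalIso ρ F x) : Set.InjOn F (Metric.ball x ρ) :=
  fun y hy z hz hyz => by
    rw [← dist_eq_zero, ← h.dist_eq y hy z hz, hyz, dist_self]

lemma IsLocalIso.mapsTo (h : IsLocalIso ρ F x) :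
    Set.MapsTo F (Metric.ball x ρ) (Metric.ball (F x) ρ) := fun y hy => by
  have hρ : 0 < ρ := dist_nonneg.trans_lt hy
  rw [Metric.mem_ball, h.dist_eq y hy x (Metric.mem_ball_self hρ)]
  exact hy

/-- Smaller balls inside the given one. -/
lemma IsLocalIso.of_mem_ball (h : IsLocalIso ρ F x) (hy : dist y x + r ≤ ρ) (hr : 0 < r) :
    IsLocalIso r F y := by
  have hsub : Metric.ball y r ⊆ Metric.ball x ρ := Metric.ball_subset_ball' (by linarith)
  have hyx := hsub (Metric.mem_ball_self hr)
  refine ⟨fun z hz z' hz' => h.dist_eq z (hsub hz) z' (hsub hz'), fun m hm => ?_⟩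
  have hρ : 0 < ρ := dist_nonneg.trans_lt hyx
  have hm' : m ∈ Metric.ball (F x) ρ := by
    have h1 := h.dist_eq y hyx x (Metric.mem_ball_self hρ)
    have h2 := dist_triangle m (F y) (F x)
    rw [Metric.mem_ball] at hm ⊢
    linarith
  obtain ⟨z, hz, rfl⟩ := h.ball_subset hm'
  refine ⟨z, ?_, rfl⟩
  rwa [Metric.mem_ball, h.dist_eq z hz y hyx] at hm

lemma IsLocalIso.mono (h : IsLocalIso ρ F x) (hr : 0 < r) (hrρ : r ≤ ρ) : IsLocalIso r F x :=
  h.of_mem_ball (by rwa [dist_self, zero_add]) hr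

lemma IsLocalIso.comp_affineIsometryEquiv {g : E ≃ᵃⁱ[ℝ] E} (h : IsLocalIso ρ F (g x)) :
    IsLocalIso ρ (F ∘ g) x := by
  have hg : ∀ y, y ∈ Metric.ball x ρ ↔ g y ∈ Metric.ball (g x) ρ := fun y => by
    rw [Metric.mem_ball, Metric.mem_ball, g.dist_map]
  refine ⟨fun y hy z hz => ?_, fun m hm => ?_⟩
  · rw [← g.dist_map y z]
    exact h.dist_eq _ ((hg y).1 hy) _ ((hg z).1 hz)
  · obtain ⟨z, hz, rfl⟩ := h.ball_subset hm
    refine ⟨g.symm z, ?_, by simp⟩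
    rw [hg]
    simpa using hz

lemma IsLocalIso.congr (h : IsLocalIso ρ F x) (hρ : 0 < ρ)
    (hFG : Set.EqOn F G (Metric.ball x ρ)) : IsLocalIso ρ G x := by
  refine ⟨fun y hy z hz => ?_, ?_⟩
  · rw [← hFG hy, ← hFG hz]
    exact h.dist_eq y hy z hz
  · rw [← hFG (Metric.mem_ball_self hρ), ← hFG.image_eq]
    exact h.ball_subset

/-- Two local isometries with the same value differ by an isometry of the Euclidean space. -/
lemma IsLocalIso.exists_eqOn_comp (h : IsLocalIso ρ A x) (hr : 0 < r) (hrρ : r ≤ ρ)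
    (hB : ∀ u ∈ Metric.ball y r, ∀ v ∈ Metric.ball y r, dist (B u) (B v) = dist u v)
    (hAB : A x = B y) :
    ∃ g : E ≃ᵃⁱ[ℝ] E, g y = x ∧ Set.EqOn B (A ∘ g) (Metric.ball y r) := by
  have hy : y ∈ Metric.ball y r := Metric.mem_ball_self hr
  have hBmem : ∀ u ∈ Metric.ball y r, B u ∈ A '' Metric.ball x ρ := fun u hu => by
    refine h.ball_subset ?_
    rw [hAB, Metric.mem_ball, hB u hu y hy]
    exact lt_of_lt_of_le hu hrρ
  choose! f hf hAf using hBmem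
  obtain ⟨g, hg⟩ := exists_affineIsometryEquiv_eqOn_ball (f := f) hr fun u hu v hv => by
    rw [← h.dist_eq _ (hf u hu) _ (hf v hv), hAf u hu, hAf v hv, hB u hu v hv]
  refine ⟨g, ?_, fun u hu => ?_⟩
  · rw [← hg hy]
    exact h.injOn (hf y hy) (Metric.mem_ball_self (hr.trans_le hrρ)) ((hAf y hy).trans hAB.symm)
  · rw [Function.comp_apply, ← hg hu, hAf u hu]

/-- Local isometries are determined by their germ at one point. At a limit point of the set of
agreement the two maps differ by an isometry `g` of the Euclidean space, and `g` is the identity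
near some point. -/
theorem eventuallyEq_of_isLocalIso {C : Set E} (hC : IsPreconnected C)
    (hA : ∀ p ∈ C, ∃ r > 0, IsLocalIso r A p) (hB : ∀ p ∈ C, ∃ r > 0, IsLocalIso r B p)
    (hx : x ∈ C) (hAB : A =ᶠ[𝓝 x] B) : ∀ p ∈ C, A =ᶠ[𝓝 p] B := by
  have hu : IsOpen {p | ∀ᶠ q in 𝓝 p, A q = B q} := isOpen_setOfPred_eventually_nhds
  refine hC.subset_of_closure_inter_subset hu ⟨x, hx, hAB⟩ ?_
  rintro p ⟨hpu, hpC⟩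
  obtain ⟨a, ha, hAp⟩ := hA p hpC
  obtain ⟨b, hb, hBp⟩ := hB p hpC
  set r := min a b
  have hr : 0 < r := lt_min ha hb
  replace hAp := hAp.mono hr (min_le_left _ _)
  replace hBp := hBp.mono hr (min_le_right _ _)
  have hp : p ∈ Metric.ball p r := Metric.mem_ball_self hr
  have hval : A p = B p := by
    refine dist_le_zero.1 (le_of_forall_pos_le_add fun ε hε => ?_)
    obtain ⟨q, hq, hqp⟩ := Metric.mem_closure_iff.1 hpu (min r (ε / 2)) (by positivity)
    have hqr : q ∈ Metric.ball p r := by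
      rw [Metric.mem_ball, dist_comm]
      exact hqp.trans_le (min_le_left _ _)
    have h1 := hAp.dist_eq p hp q hqr
    have h2 := hBp.dist_eq q hqr p hp
    have h3 : A q = B q := EventuallyEq.eq_of_nhds (f := A) (g := B) hq
    have h4 := dist_triangle (A p) (A q) (B p)
    have h5 := hqp.trans_le (min_le_right _ _)
    rw [h3] at h1 h4
    rw [dist_comm q p] at h2
    linarith
  obtain ⟨g, hgp, hg⟩ := hAp.exists_eqOn_comp hr le_rfl hBp.dist_eq hval
  obtain ⟨q, hq, hqp⟩ := Metric.mem_closure_iff.1 hpu r hr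
  have hqr : q ∈ Metric.ball p r := by rwa [Metric.mem_ball, dist_comm]
  -- near `q` one has `A = B = A ∘ g`, and `A` is injective
  have hg1 : g = 1 := by
    refine affineIsometryEquiv_eq_of_eventuallyEq (x := q) ?_
    have hqA : ∀ᶠ z in 𝓝 q, A z = B z := hq
    filter_upwards [hqA, Metric.isOpen_ball.mem_nhds hqr] with z hz hzr
    have hgz : g z ∈ Metric.ball p r := by
      have h1 := g.dist_map z p
      rw [hgp] at h1
      rw [Metric.mem_ball, h1]
      exact hzr
    refine hAp.injOn hgz hzr ?_
    exact (hg hzr).symm.trans hz.symm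
  filter_upwards [Metric.ball_mem_nhds p hr] with z hz
  rw [hg hz, hg1]
  rfl

/-- If there are isometric charts of radius `ρ` everywhere, then a local isometry can be replaced
near a point by one that is isometric on the full ball of radius `ρ`. -/
lemma IsLocalIso.exists_recenter (hch : ∀ m : M, ∃ F : E → M, F 0 = m ∧ IsLocalIso ρ F 0)
    (h : IsLocalIso ρ F x) (hr : 0 < r) (hy : dist y x + r ≤ ρ) :
    ∃ G, IsLocalIso ρ G y ∧ Set.EqOn F G (Metric.ball y r) := by
  obtain ⟨K, hK0, hK⟩ := hch (F y)
  have h1 := h.of_mem_ball hy hr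
  obtain ⟨g, hgy, hg⟩ := hK.exists_eqOn_comp hr (by linarith [dist_nonneg (x := y) (y := x)])
    h1.dist_eq hK0
  exact ⟨K ∘ g, IsLocalIso.comp_affineIsometryEquiv (by rwa [hgy]), hg⟩

/-- One step of the analytic continuation: from the ball of radius `R` to the ball of
radius `R + δ`. The value at `v` is the value of the continuation from the point of the smaller ball
obtained from `v` by a contraction. The condition `4 * δ ≤ ρ` leaves room for the balls involved to
overlap. -/
lemma exists_extend_ball [Nonempty M]
    (hch : ∀ m : M, ∃ F : E → M, F 0 = m ∧ IsLocalIso ρ F 0) {δ R : ℝ} (hδ : 0 < δ) (hδρ : 4 * δ ≤ ρ) (hR : 0 < R)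
    (hF : ∀ x ∈ Metric.ball (0 : E) R, ∃ G, IsLocalIso ρ G x ∧
      Set.EqOn F G (Metric.ball x ρ ∩ Metric.ball 0 R)) :
    ∃ F' : E → M, Set.EqOn F F' (Metric.ball 0 R) ∧
      ∀ x ∈ Metric.ball (0 : E) (R + δ), ∃ G, IsLocalIso ρ G x ∧
        Set.EqOn F' G (Metric.ball x ρ ∩ Metric.ball 0 (R + δ)) := by
  choose! G hG hFG using hF
  set q : ℝ := R / (R + δ) with hq
  have hRδ : 0 < R + δ := by linarith
  have hq0 : 0 < q := by positivity
  have hq1 : q < 1 := (div_lt_one hRδ).2 (by linarith)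
  have hqR : q * (R + δ) = R := div_mul_cancel₀ _ hRδ.ne'
  set w : E → E := fun v => q • v with hw
  have hwR : ∀ v ∈ Metric.ball (0 : E) (R + δ), w v ∈ Metric.ball (0 : E) R := fun v hv => by
    rw [mem_ball_zero_iff] at hv ⊢
    rw [hw, norm_smul, Real.norm_of_nonneg hq0.le, ← hqR]
    exact mul_lt_mul_of_pos_left hv hq0
  have hwd : ∀ v ∈ Metric.ball (0 : E) (R + δ), dist v (w v) < δ := fun v hv => by
    rw [mem_ball_zero_iff] at hv
    have : v - q • v = (1 - q) • v := by rw [sub_smul, one_smul]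
    rw [dist_eq_norm, hw, this, norm_smul, Real.norm_of_nonneg (by linarith)]
    have h1 : (1 - q) * (R + δ) = δ := by linarith
    calc (1 - q) * ‖v‖ < (1 - q) * (R + δ) := mul_lt_mul_of_pos_left hv (by linarith)
      _ = δ := h1
  have hww : ∀ u v : E, dist (w u) (w v) ≤ dist u v := fun u v => by
    rw [hw, dist_smul₀, Real.norm_of_nonneg hq0.le]
    exact mul_le_of_le_one_left dist_nonneg hq1.le
  refine ⟨fun v => G (w v) v, fun v hv => ?_, fun x hx => ?_⟩
  · have hv' : v ∈ Metric.ball (0 : E) (R + δ) :=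
      Metric.ball_subset_ball (by linarith) hv
    refine hFG _ (hwR v hv') ⟨?_, hv⟩
    rw [Metric.mem_ball]
    linarith [hwd v hv']
  · have hwx := hwR x hx
    obtain ⟨K, hK, hKG⟩ := (hG _ hwx).exists_recenter (y := x) (r := ρ - δ) hch (by linarith)
      (by linarith [hwd x hx])
    refine ⟨K, hK, fun u ⟨hux, hu⟩ => ?_⟩
    have hwu := hwR u hu
    have hud := hwd u hu
    have hwux : w x ∈ Metric.ball (w u) ρ := by
      rw [Metric.mem_ball, dist_comm]
      exact (hww u x).trans_lt hux
    have hwxx : dist (w x) x < δ := by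
      rw [dist_comm]
      exact hwd x hx
    have hloc : ∀ (H : E → M) (z p : E), IsLocalIso ρ H z → p ∈ Metric.ball z ρ →
        ∃ r > 0, IsLocalIso r H p := fun H z p hH hp =>
      ⟨ρ - dist p z, sub_pos.2 hp, hH.of_mem_ball (by linarith) (sub_pos.2 hp)⟩
    -- `G (w u)` and `K` both agree with `F` near `w x`
    refine (eventuallyEq_of_isLocalIso (C := Metric.ball (w u) ρ ∩ Metric.ball x ρ) (x := w x)
      ((convex_ball _ _).inter (convex_ball _ _)).isPreconnected
      (fun p hp => hloc _ _ p (hG _ hwu) hp.1) (fun p hp => hloc _ _ p hK hp.2)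
      ⟨hwux, by rw [Metric.mem_ball]; linarith⟩ ?_ u ⟨?_, hux⟩).eq_of_nhds
    · have h1 : w x ∈ Metric.ball x (ρ - δ) := by
        rw [Metric.mem_ball]
        linarith
      filter_upwards [Metric.isOpen_ball.mem_nhds hwux, Metric.isOpen_ball.mem_nhds hwx,
        Metric.isOpen_ball.mem_nhds h1, Metric.ball_mem_nhds (w x) (by linarith : 0 < ρ)]
        with z hz1 hz2 hz3 hz4
      rw [← hFG _ hwu ⟨hz1, hz2⟩, hFG _ hwx ⟨hz4, hz2⟩, hKG hz3]
    · rw [Metric.mem_ball]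
      linarith

/-- A local isometry at the origin continues to the whole space. -/
theorem exists_forall_isLocalIso [Nonempty M]
    (hch : ∀ m : M, ∃ F : E → M, F 0 = m ∧ IsLocalIso ρ F 0) (hρ : 0 < ρ) :
    ∃ P : E → M, ∀ x, IsLocalIso ρ P x := by
  obtain ⟨H, -, hH⟩ := hch (Classical.arbitrary M)
  set δ := ρ / 4 with hδ
  have hδ0 : 0 < δ := by positivity
  have hex : ∀ k : ℕ, ∃ F : E → M, Set.EqOn H F (Metric.ball 0 δ) ∧
      ∀ x ∈ Metric.ball (0 : E) ((k + 1 : ℕ) * δ), ∃ G, IsLocalIso ρ G x ∧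
        Set.EqOn F G (Metric.ball x ρ ∩ Metric.ball 0 ((k + 1 : ℕ) * δ)) := by
    intro k
    induction k with
    | zero =>
      refine ⟨H, fun x _ => rfl, fun x hx => ?_⟩
      simp only [zero_add, Nat.cast_one, one_mul] at hx ⊢
      have hx' := hx
      rw [Metric.mem_ball] at hx'
      obtain ⟨G, hG, hHG⟩ := hH.exists_recenter (y := x) (r := 2 * δ) hch (by linarith)
        (by linarith)
      refine ⟨G, hG, fun y hy => hHG ?_⟩
      have h1 := hy.2
      rw [Metric.mem_ball] at h1 ⊢
      linarith [dist_triangle_right y x 0]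
    | succ k ih =>
      obtain ⟨F, hHF, hF⟩ := ih
      obtain ⟨F', hFF', hF'⟩ := exists_extend_ball hch hδ0 (by linarith)
        (by positivity : (0 : ℝ) < (k + 1 : ℕ) * δ) hF
      have h1 : ((k + 1 + 1 : ℕ) : ℝ) * δ = (k + 1 : ℕ) * δ + δ := by
        push_cast
        ring
      rw [h1]
      refine ⟨F', fun x hx => ?_, hF'⟩
      rw [hHF hx]
      refine hFF' (Metric.ball_subset_ball ?_ hx)
      push_cast
      nlinarith [(Nat.cast_nonneg k : (0 : ℝ) ≤ k)]
  choose F hHF hF using hex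
  have hloc : ∀ k, ∀ p ∈ Metric.ball (0 : E) ((k + 1 : ℕ) * δ), ∃ r > 0, IsLocalIso r (F k) p := by
    intro k p hp
    obtain ⟨G, hG, hFG⟩ := hF k p hp
    have hr : 0 < min ρ ((k + 1 : ℕ) * δ - dist p 0) := lt_min hρ (sub_pos.2 hp)
    refine ⟨_, hr, (hG.mono hr (min_le_left _ _)).congr hr fun z hz => (hFG ⟨?_, ?_⟩).symm⟩
    · exact Metric.ball_subset_ball (min_le_left _ _) hz
    · refine Metric.ball_subset_ball' ?_ hz
      linarith [min_le_right ρ ((k + 1 : ℕ) * δ - dist p 0)]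
  -- the continuations have the same germ at the origin, hence agree where both are defined
  have hcons : ∀ k l y, y ∈ Metric.ball (0 : E) ((k + 1 : ℕ) * δ) →
      y ∈ Metric.ball (0 : E) ((l + 1 : ℕ) * δ) → F k y = F l y := by
    intro k l y hk hl
    have hpos : ∀ j : ℕ, (0 : E) ∈ Metric.ball (0 : E) ((j + 1 : ℕ) * δ) := fun j =>
      Metric.mem_ball_self (by positivity)
    refine (eventuallyEq_of_isLocalIso (x := 0)
      ((convex_ball (0 : E) ((k + 1 : ℕ) * δ)).inter
        (convex_ball (0 : E) ((l + 1 : ℕ) * δ))).isPreconnected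
      (fun p hp => hloc k p hp.1) (fun p hp => hloc l p hp.2) ⟨hpos k, hpos l⟩ ?_ y
      ⟨hk, hl⟩).eq_of_nhds
    filter_upwards [Metric.ball_mem_nhds (0 : E) hδ0] with z hz
    rw [← hHF k hz, ← hHF l hz]
  have hceil : ∀ a : ℝ, a < (⌈a / δ⌉₊ + 1 : ℕ) * δ := fun a => by
    have h1 := Nat.le_ceil (a / δ)
    rw [div_le_iff₀ hδ0] at h1
    push_cast
    linarith
  refine ⟨fun v => F ⌈‖v‖ / δ⌉₊ v, fun x => ?_⟩
  set l := ⌈(‖x‖ + ρ) / δ⌉₊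
  have hl := hceil (‖x‖ + ρ)
  have hsub : Metric.ball x ρ ⊆ Metric.ball (0 : E) ((l + 1 : ℕ) * δ) := by
    refine Metric.ball_subset_ball' ?_
    rw [dist_zero_right]
    linarith
  obtain ⟨G, hG, hFG⟩ := hF l x (hsub (Metric.mem_ball_self hρ))
  refine hG.congr hρ fun y hy => ?_
  rw [← hFG ⟨hy, hsub hy⟩]
  exact hcons _ _ y (hsub hy) (by rw [mem_ball_zero_iff]; exact hceil _)

end LocalIso


/-! ### The universal covering and its deck group -/

section DeckGroup

set_option linter.unusedSectionVars false

variable {E : Type} [NormedAddCommGroup E] [InnerProductSpace ℝ E] [FiniteDimensional ℝ E]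
  {M : Type*} [MetricSpace M] {P : E → M} {ρ : ℝ}

/-- The isometries `γ` of the Euclidean space with `P ∘ γ = P`. -/
def deckGroup (P : E → M) : Subgroup (E ≃ᵃⁱ[ℝ] E) where
  carrier := {γ | ∀ x, P (γ x) = P x}
  one_mem' := fun _ => rfl
  mul_mem' := fun {γ δ} hγ hδ x => (hγ (δ x)).trans (hδ x)
  inv_mem' := fun {γ} hγ x => by
    have h1 : γ (γ⁻¹ x) = x := γ.apply_symm_apply x
    have h2 := hγ (γ⁻¹ x)
    rw [h1] at h2
    exact h2.symm

/-- An isometry that preserves `P` near one point is a deck transformation. -/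
lemma mem_deckGroup_of_eventuallyEq (hP : ∀ x, IsLocalIso ρ P x) (hρ : 0 < ρ) {γ : E ≃ᵃⁱ[ℝ] E}
    {x : E} (h : P ∘ γ =ᶠ[𝓝 x] P) : γ ∈ deckGroup P := fun y =>
  (eventuallyEq_of_isLocalIso isPreconnected_univ
    (fun p _ => ⟨ρ, hρ, (hP (γ p)).comp_affineIsometryEquiv⟩) (fun p _ => ⟨ρ, hρ, hP p⟩)
    (Set.mem_univ x) h y (Set.mem_univ y)).eq_of_nhds

/-- The deck group acts transitively on the fibres. -/
lemma exists_mem_deckGroup (hP : ∀ x, IsLocalIso ρ P x) (hρ : 0 < ρ) {x y : E} (h : P x = P y) :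
    ∃ γ ∈ deckGroup P, γ x = y := by
  obtain ⟨g, hg, hgP⟩ := (hP y).exists_eqOn_comp hρ le_rfl (hP x).dist_eq h.symm
  refine ⟨g, mem_deckGroup_of_eventuallyEq hP hρ (x := x) ?_, hg⟩
  filter_upwards [Metric.ball_mem_nhds x hρ] with z hz
  exact (hgP hz).symm

/-- The range of the covering contains a ball of fixed radius about each of its points, so it is open
and closed. -/
lemma surjective_of_isLocalIso [PreconnectedSpace M] (hP : ∀ x, IsLocalIso ρ P x) (hρ : 0 < ρ) :
    Function.Surjective P := by
  have hball : ∀ x, Metric.ball (P x) ρ ⊆ Set.range P := fun x =>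
    (hP x).ball_subset.trans (Set.image_subset_range _ _)
  have hopen : IsOpen (Set.range P) := by
    rw [Metric.isOpen_iff]
    rintro _ ⟨x, rfl⟩
    exact ⟨ρ, hρ, hball x⟩
  have hclosed : IsClosed (Set.range P) := by
    refine isClosed_of_closure_subset fun m hm => ?_
    obtain ⟨_, ⟨x, rfl⟩, hx⟩ := Metric.mem_closure_iff.1 hm ρ hρ
    exact hball x hx
  rw [← Set.range_eq_univ]
  exact IsClopen.eq_univ ⟨hclosed, hopen⟩ ⟨P 0, Set.mem_range_self 0⟩

/-- Freeness comes from the injectivity of `P` on balls, cocompactness from the compactness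
of `M`. -/
lemma isFreeCocompact_deckGroup [CompactSpace M] [PreconnectedSpace M]
    (hP : ∀ x, IsLocalIso ρ P x) (hρ : 0 < ρ) : IsFreeCocompact (deckGroup P) := by
  have hsurj := surjective_of_isLocalIso hP hρ
  refine ⟨⟨ρ, hρ, fun γ hγ h1 x => ?_⟩, ?_⟩
  · by_contra! hlt
    have hmem : ∀ z ∈ Metric.ball x ρ, dist (γ z) x < ρ → γ z = z := fun z hz hz' =>
      (hP x).injOn hz' hz (hγ z)
    have hx : γ x = x := hmem x (Metric.mem_ball_self hρ) (by rwa [dist_comm])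
    refine h1 (affineIsometryEquiv_eq_of_eventuallyEq (x := x) ?_)
    filter_upwards [Metric.ball_mem_nhds x hρ] with z hz
    refine hmem z hz ?_
    have h2 := γ.dist_map z x
    rw [hx] at h2
    rw [h2]
    exact hz
  · have hopen : ∀ k : ℕ, IsOpen (P '' Metric.ball 0 k) := by
      intro k
      rw [Metric.isOpen_iff]
      rintro _ ⟨x, hx, rfl⟩
      have hr : 0 < min ρ (k - dist x 0) := lt_min hρ (sub_pos.2 hx)
      refine ⟨_, hr, ((hP x).mono hr (min_le_left _ _)).ball_subset.trans (Set.image_mono ?_)⟩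
      refine Metric.ball_subset_ball' ?_
      linarith [min_le_right ρ (k - dist x 0)]
    obtain ⟨k, hk⟩ := isCompact_univ.elim_directed_cover (fun k : ℕ => P '' Metric.ball 0 k) hopen
      (fun m _ => by
        obtain ⟨x, rfl⟩ := hsurj m
        obtain ⟨k, hk⟩ := exists_nat_gt ‖x‖
        exact Set.mem_iUnion.2 ⟨k, x, by simpa using hk, rfl⟩)
      (Monotone.directed_le fun i j hij =>
        Set.image_mono (Metric.ball_subset_ball (by exact_mod_cast hij)))
    refine ⟨k, fun x => ?_⟩
    obtain ⟨y, hy, hyx⟩ := hk (Set.mem_univ (P x))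
    obtain ⟨γ, hγ, rfl⟩ := exists_mem_deckGroup hP hρ hyx.symm
    exact ⟨γ, hγ, by simpa using hy⟩

/-- The partial homeomorphism inverse to a local isometry `P`, with target the ball on which `P` is
isometric. As a total function its inverse is `P` itself. -/
noncomputable def IsLocalIso.chart {x : E} (h : IsLocalIso ρ P x) : OpenPartialHomeomorph M E where
  toFun := Function.invFunOn P (Metric.ball x ρ)
  invFun := P
  source := Metric.ball (P x) ρ
  target := Metric.ball x ρ
  map_source' := fun _ hm => Function.invFunOn_mem (h.ball_subset hm)
  map_target' := fun _ hy => h.mapsTo hy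
  left_inv' := fun _ hm => Function.invFunOn_eq (h.ball_subset hm)
  right_inv' := fun _ hy => h.injOn.leftInvOn_invFunOn hy
  open_source := Metric.isOpen_ball
  open_target := Metric.isOpen_ball
  continuousOn_toFun := by
    refine LipschitzOnWith.continuousOn (K := 1) (LipschitzOnWith.of_dist_le_mul
      fun m hm m' hm' => ?_)
    rw [NNReal.coe_one, one_mul, ← h.dist_eq _ (Function.invFunOn_mem (h.ball_subset hm)) _
      (Function.invFunOn_mem (h.ball_subset hm')), Function.invFunOn_eq (h.ball_subset hm),
      Function.invFunOn_eq (h.ball_subset hm')]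
  continuousOn_invFun := by
    refine LipschitzOnWith.continuousOn (K := 1) (LipschitzOnWith.of_dist_le_mul
      fun y hy y' hy' => ?_)
    rw [NNReal.coe_one, one_mul, h.dist_eq y hy y' hy']

end DeckGroup

section FlatCharts

variable {n : ℕ} {M : Type*} [MetricSpace M] {P : EuclideanSpace ℝ (Fin n) → M} {ρ : ℝ}

lemma IsLocalIso.isFlatChart_chart {x : EuclideanSpace ℝ (Fin n)} (h : IsLocalIso ρ P x) :
    IsFlatChart h.chart := fun m hm m' hm' => by
  rw [← h.dist_eq _ (h.chart.map_source hm) _ (h.chart.map_source hm')]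
  exact congrArg₂ dist (h.chart.left_inv hm) (h.chart.left_inv hm')

lemma IsFlatChart.dist_symm {φ : OpenPartialHomeomorph M (EuclideanSpace ℝ (Fin n))}
    (hφ : IsFlatChart φ) {y z : EuclideanSpace ℝ (Fin n)} (hy : y ∈ φ.target)
    (hz : z ∈ φ.target) : dist (φ.symm y) (φ.symm z) = dist y z := by
  rw [← hφ _ (φ.map_target hy) _ (φ.map_target hz), φ.right_inv hy, φ.right_inv hz]

/-- There are isometric charts of a uniform size. -/
lemma IsCompactFlatManifold.exists_isLocalIso (hM : IsCompactFlatManifold n M) :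
    ∃ ρ > 0, ∀ m : M, ∃ F : EuclideanSpace ℝ (Fin n) → M, F 0 = m ∧ IsLocalIso ρ F 0 := by
  have := hM.compact
  suffices h : ∃ ρ > 0, ∀ m ∈ (Set.univ : Set M), ∃ F : EuclideanSpace ℝ (Fin n) → M,
      F 0 = m ∧ IsLocalIso ρ F 0 by
    simpa using h
  refine isCompact_univ.induction_on (p := fun s : Set M => ∃ ρ > 0, ∀ m ∈ s,
    ∃ F : EuclideanSpace ℝ (Fin n) → M, F 0 = m ∧ IsLocalIso ρ F 0) ⟨1, one_pos, by simp⟩ ?_ ?_ ?_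
  · rintro s t hst ⟨ρ, hρ, h⟩
    exact ⟨ρ, hρ, fun m hm => h m (hst hm)⟩
  · rintro s t ⟨ρ, hρ, h⟩ ⟨ρ', hρ', h'⟩
    have hpos : 0 < min ρ ρ' := lt_min hρ hρ'
    refine ⟨_, hpos, fun m hm => ?_⟩
    rcases hm with hm | hm
    · obtain ⟨F, hF, hF'⟩ := h m hm
      exact ⟨F, hF, hF'.mono hpos (min_le_left _ _)⟩
    · obtain ⟨F, hF, hF'⟩ := h' m hm
      exact ⟨F, hF, hF'.mono hpos (min_le_right _ _)⟩
  · rintro x -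
    obtain ⟨φ, hφ, hx⟩ := hM.flat x
    obtain ⟨a, ha, has⟩ := Metric.isOpen_iff.1 φ.open_source x hx
    obtain ⟨b, hb, hbt⟩ := Metric.isOpen_iff.1 φ.open_target (φ x) (φ.map_source hx)
    set r := min a b / 2 with hr
    have hr0 : 0 < r := half_pos (lt_min ha hb)
    have hra : r + r ≤ a := by rw [hr, add_halves]; exact min_le_left _ _
    have hrb : r + r ≤ b := by rw [hr, add_halves]; exact min_le_right _ _
    refine ⟨Metric.ball x r, mem_nhdsWithin_of_mem_nhds (Metric.ball_mem_nhds x hr0), r, hr0,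
      fun m hm => ?_⟩
    have hms : Metric.ball m r ⊆ φ.source := (Metric.ball_subset_ball' (by
      rw [Metric.mem_ball] at hm
      linarith)).trans has
    have hm0 : m ∈ φ.source := hms (Metric.mem_ball_self hr0)
    have hmt : Metric.ball (φ m) r ⊆ φ.target := (Metric.ball_subset_ball' (by
      rw [hφ m hm0 x hx]
      rw [Metric.mem_ball] at hm
      linarith)).trans hbt
    have hadd : ∀ v ∈ Metric.ball (0 : EuclideanSpace ℝ (Fin n)) r, φ m + v ∈ φ.target :=
      fun v hv => hmt (by simpa using hv)
    have h0 : φ.symm (φ m + 0) = m := by rw [add_zero, φ.left_inv hm0]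
    refine ⟨fun v => φ.symm (φ m + v), h0, fun v hv u hu => ?_, fun m' hm' => ?_⟩
    · rw [hφ.dist_symm (hadd v hv) (hadd u hu), dist_add_left]
    · simp only [h0] at hm'
      refine ⟨φ m' - φ m, ?_, ?_⟩
      · rw [mem_ball_zero_iff, ← dist_eq_norm, hφ m' (hms hm') m hm0]
        exact hm'
      · simp only [add_sub_cancel]
        exact φ.left_inv (hms hm')

/-- A compact flat manifold is covered by Euclidean space, by a map that is isometric on balls of
a fixed radius. -/
theorem IsCompactFlatManifold.exists_covering (hM : IsCompactFlatManifold n M) :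
    ∃ ρ > 0, ∃ P : EuclideanSpace ℝ (Fin n) → M, ∀ x, IsLocalIso ρ P x := by
  obtain ⟨ρ, hρ, h⟩ := hM.exists_isLocalIso
  have := hM.connected
  exact ⟨ρ, hρ, exists_forall_isLocalIso h hρ⟩

/-- The inverse of an isometric chart is locally the covering composed with an isometry. -/
lemma IsFlatChart.exists_symm_eventuallyEq (hP : ∀ x, IsLocalIso ρ P x) (hρ : 0 < ρ)
    {φ : OpenPartialHomeomorph M (EuclideanSpace ℝ (Fin n))} (hφ : IsFlatChart φ)
    {x y : EuclideanSpace ℝ (Fin n)} (hy : y ∈ φ.target) (hxy : P x = φ.symm y) :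
    ∃ g : EuclideanSpace ℝ (Fin n) ≃ᵃⁱ[ℝ] EuclideanSpace ℝ (Fin n),
      g y = x ∧ φ.symm =ᶠ[𝓝 y] P ∘ g := by
  obtain ⟨b, hb, hbt⟩ := Metric.isOpen_iff.1 φ.open_target y hy
  have hr : 0 < min ρ b := lt_min hρ hb
  have hsub : Metric.ball y (min ρ b) ⊆ φ.target :=
    (Metric.ball_subset_ball (min_le_right _ _)).trans hbt
  obtain ⟨g, hg, hgP⟩ := (hP x).exists_eqOn_comp hr (min_le_left _ _)
    (fun u hu v hv => hφ.dist_symm (hsub hu) (hsub hv)) hxy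
  exact ⟨g, hg, by filter_upwards [Metric.ball_mem_nhds y hr] with z hz using hgP hz⟩

end FlatCharts

/-! ### Eigenfunctions on the quotient -/

section Eigenfunctions

set_option linter.unusedSectionVars false

variable {E : Type} [NormedAddCommGroup E] [InnerProductSpace ℝ E] [FiniteDimensional ℝ E]

lemma affineIsometryEquiv_eq_add (g : E ≃ᵃⁱ[ℝ] E) :
    g = fun x => (g.linearIsometryEquiv.toContinuousLinearEquiv : E →L[ℝ] E) x + g 0 := by
  funext x
  have := g.map_vadd 0 x
  simpa using this

lemma contDiff_affineIsometryEquiv (g : E ≃ᵃⁱ[ℝ] E) {k : WithTop ℕ∞} : ContDiff ℝ k g := by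
  rw [affineIsometryEquiv_eq_add g]
  exact (ContinuousLinearMap.contDiff _).add contDiff_const

lemma hasFDerivAt_affineIsometryEquiv (g : E ≃ᵃⁱ[ℝ] E) (x : E) :
    HasFDerivAt g (g.linearIsometryEquiv.toContinuousLinearEquiv : E →L[ℝ] E) x := by
  have h := (g.linearIsometryEquiv.toContinuousLinearEquiv : E →L[ℝ] E).hasFDerivAt.add_const (g 0)
    (x := x)
  rwa [← affineIsometryEquiv_eq_add g] at h

lemma laplacian_comp_affineIsometryEquiv (g : E ≃ᵃⁱ[ℝ] E) (f : E → ℝ) (x : E) :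
    (Δ (f ∘ g)) x = (Δ f) (g x) := by
  have hg : ∀ x, g.linearIsometryEquiv x + g 0 = g x := fun x => by
    have := g.map_vadd 0 x
    simpa using this.symm
  have h : (f ∘ g : E → ℝ) = (fun y => f (y + g 0)) ∘ g.linearIsometryEquiv := by
    funext x
    simp [hg]
  have h2 : ∀ v : Fin 2 → E, iteratedFDeriv ℝ 2 (f ∘ g) x v =
      iteratedFDeriv ℝ 2 f (g x) fun i => g.linearIsometryEquiv (v i) := by
    intro v
    have h3 := g.linearIsometryEquiv.toContinuousLinearEquiv.iteratedFDerivWithin_comp_right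
      (fun y => f (y + g 0)) uniqueDiffOn_univ (x := x) (Set.mem_univ _) 2
    simp only [Set.preimage_univ, iteratedFDerivWithin_univ, iteratedFDeriv_comp_add_right] at h3
    rw [h]
    refine (congrArg (fun A => A v) h3).trans ?_
    have h4 : g.linearIsometryEquiv.toContinuousLinearEquiv x + g 0 = g x := hg x
    rw [h4]
    rfl
  set b := stdOrthonormalBasis ℝ E
  rw [InnerProductSpace.laplacian_eq_iteratedFDeriv_orthonormalBasis _ b,
    InnerProductSpace.laplacian_eq_iteratedFDeriv_orthonormalBasis _
      (b.map g.linearIsometryEquiv)]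
  refine Finset.sum_congr rfl fun i _ => ?_
  rw [h2]
  congr 1
  funext j
  fin_cases j <;> rfl

variable {n : ℕ} {M : Type*} [MetricSpace M] {P : EuclideanSpace ℝ (Fin n) → M} {ρ : ℝ}

/-- The pullback of an eigenfunction is an invariant eigenfunction. -/
lemma comp_mem_invariantEigenspace (hP : ∀ x, IsLocalIso ρ P x) (hρ : 0 < ρ) {lam : ℝ}
    {f : M → ℝ} (hf : f ∈ laplaceEigenspace n M lam) :
    f ∘ P ∈ invariantEigenspace (deckGroup P) lam := by
  refine ⟨contDiff_iff_contDiffAt.2 fun x => ?_, fun γ x => congrArg f (γ.2 x), fun x => ?_⟩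
  · exact (hf.1 _ (hP x).isFlatChart_chart).contDiffAt (Metric.ball_mem_nhds x hρ)
  · exact hf.2 _ (hP x).isFlatChart_chart x (Metric.mem_ball_self hρ)

/-- An invariant eigenfunction descends: in an isometric chart it is read as its composition with an
isometry, which commutes with the Laplacian. -/
lemma mem_laplaceEigenspace_of_comp (hP : ∀ x, IsLocalIso ρ P x) (hρ : 0 < ρ)
    (hsurj : Function.Surjective P) {lam : ℝ} {f : M → ℝ}
    (hf : f ∘ P ∈ invariantEigenspace (deckGroup P) lam) : f ∈ laplaceEigenspace n M lam := by
  have key : ∀ φ : OpenPartialHomeomorph M (EuclideanSpace ℝ (Fin n)), IsFlatChart φ →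
      ∀ y ∈ φ.target, ∃ g : EuclideanSpace ℝ (Fin n) ≃ᵃⁱ[ℝ] EuclideanSpace ℝ (Fin n),
        f ∘ φ.symm =ᶠ[𝓝 y] (f ∘ P) ∘ g := by
    intro φ hφ y hy
    obtain ⟨x, hx⟩ := hsurj (φ.symm y)
    obtain ⟨g, -, hg⟩ := hφ.exists_symm_eventuallyEq hP hρ hy hx
    exact ⟨g, hg.fun_comp f⟩
  refine ⟨fun φ hφ y hy => ?_, fun φ hφ y hy => ?_⟩
  · obtain ⟨g, hg⟩ := key φ hφ y hy
    exact ((hf.1.comp (contDiff_affineIsometryEquiv g)).contDiffAt.congr_of_eventuallyEq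
      hg).contDiffWithinAt
  · obtain ⟨g, hg⟩ := key φ hφ y hy
    rw [(InnerProductSpace.laplacian_congr_nhds hg).eq_of_nhds, laplacian_comp_affineIsometryEquiv,
      hf.2.2]
    exact congrArg (lam * ·) hg.eq_of_nhds.symm

lemma finrank_laplaceEigenspace (hP : ∀ x, IsLocalIso ρ P x) (hρ : 0 < ρ)
    (hsurj : Function.Surjective P) (lam : ℝ) :
    finrank ℝ (laplaceEigenspace n M lam) = finrank ℝ (invariantEigenspace (deckGroup P) lam) := by
  let e : laplaceEigenspace n M lam →ₗ[ℝ] invariantEigenspace (deckGroup P) lam :=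
    (LinearMap.funLeft ℝ ℝ P).restrict fun f hf => comp_mem_invariantEigenspace hP hρ hf
  refine (LinearEquiv.ofBijective e ⟨fun f f' h => ?_, fun F => ?_⟩).finrank_eq
  · have h1 : (f : M → ℝ) ∘ P = (f' : M → ℝ) ∘ P := congrArg Subtype.val h
    exact Subtype.ext (hsurj.injective_comp_right h1)
  · set f : M → ℝ := (F : EuclideanSpace ℝ (Fin n) → ℝ) ∘ Function.surjInv hsurj with hf
    have hfP : f ∘ P = F := by
      funext x
      obtain ⟨γ, hγ, hγx⟩ := exists_mem_deckGroup hP hρ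
        (Function.surjInv_eq hsurj (P x)).symm
      rw [Function.comp_apply, hf, Function.comp_apply, ← hγx]
      exact F.2.2.1 ⟨γ, hγ⟩ x
    refine ⟨⟨f, mem_laplaceEigenspace_of_comp hP hρ hsurj (by rw [hfP]; exact F.2)⟩,
      Subtype.ext hfP⟩

end Eigenfunctions


/-! ### Orientability in terms of the deck group -/

section Orientability

variable {n : ℕ} {M : Type*} [MetricSpace M] {P : EuclideanSpace ℝ (Fin n) → M} {ρ : ℝ}
  {φ ψ : OpenPartialHomeomorph M (EuclideanSpace ℝ (Fin n))}

lemma IsLocalIso.continuousAt {x : EuclideanSpace ℝ (Fin n)} (h : IsLocalIso ρ P x) (hρ : 0 < ρ) :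
    ContinuousAt P x :=
  h.chart.continuousOn_symm.continuousAt (Metric.ball_mem_nhds x hρ)

lemma IsLocalIso.isSmoothChart_chart (hP : ∀ x, IsLocalIso ρ P x) (hρ : 0 < ρ)
    (x : EuclideanSpace ℝ (Fin n)) : IsSmoothChart (hP x).chart := by
  set c := (hP x).chart
  refine fun ψ hψ => ⟨fun y hy => ?_, fun y hy => ?_⟩
  · have hyt : y ∈ ψ.target := hy.1
    have hys : ψ.symm y ∈ c.source := hy.2
    obtain ⟨g, hgy, hg⟩ := hψ.exists_symm_eventuallyEq hP hρ hyt (c.left_inv hys)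
    refine ContDiffAt.contDiffWithinAt (ContDiffAt.congr_of_eventuallyEq
      (contDiff_affineIsometryEquiv g).contDiffAt ?_)
    have h1 : ∀ᶠ z in 𝓝 y, g z ∈ c.target :=
      g.continuous.continuousAt.eventually (c.open_target.mem_nhds (by
        rw [hgy]
        exact c.map_source hys))
    filter_upwards [hg, h1] with z hz hz1
    rw [Function.comp_apply, hz]
    exact c.right_inv hz1
  · have hyt : y ∈ c.target := hy.1
    have hys : P y ∈ ψ.source := hy.2
    obtain ⟨g, hgy, hg⟩ := hψ.exists_symm_eventuallyEq hP hρ (ψ.map_source hys)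
      (ψ.left_inv hys).symm
    refine ContDiffAt.contDiffWithinAt (ContDiffAt.congr_of_eventuallyEq
      (contDiff_affineIsometryEquiv g.symm).contDiffAt ?_)
    have hgy' : g.symm y = ψ (P y) := 
      (congrArg g.symm hgy).symm.trans (g.symm_apply_apply _)
    have hlim : Tendsto g.symm (𝓝 y) (𝓝 (ψ (P y))) := by
      rw [← hgy']
      exact g.symm.continuous.continuousAt
    filter_upwards [hlim.eventually hg,
      hlim.eventually (ψ.open_target.mem_nhds (ψ.map_source hys))] with z hz hz1
    rw [Function.comp_apply, g.apply_symm_apply] at hz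
    show ψ (P z) = g.symm z
    rw [← hz, ψ.right_inv hz1]

/-- The coordinate changes between local inverses of the covering are deck transformations. -/
lemma orientable_of_forall_det_pos (hP : ∀ x, IsLocalIso ρ P x) (hρ : 0 < ρ)
    (hsurj : Function.Surjective P)
    (h : ∀ γ ∈ deckGroup P, 0 < LinearMap.det (γ.linearIsometryEquiv.toLinearEquiv :
      EuclideanSpace ℝ (Fin n) →ₗ[ℝ] EuclideanSpace ℝ (Fin n))) : Orientable n M := by
  refine ⟨Set.range fun x => (hP x).chart, ?_, fun m => ?_, ?_⟩
  · rintro _ ⟨x, rfl⟩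
    exact IsLocalIso.isSmoothChart_chart hP hρ x
  · obtain ⟨x, rfl⟩ := hsurj m
    exact ⟨_, ⟨x, rfl⟩, Metric.mem_ball_self hρ⟩
  · rintro _ ⟨a, rfl⟩ _ ⟨b, rfl⟩ y hy
    set c := (hP b).chart
    have hys : P y ∈ c.source := hy.2
    obtain ⟨γ, hγ, hγy⟩ := exists_mem_deckGroup hP hρ (c.left_inv hys).symm
    have hev : c ∘ P =ᶠ[𝓝 y] γ := by
      have h1 : ∀ᶠ z in 𝓝 y, γ z ∈ c.target :=
        γ.continuous.continuousAt.eventually (c.open_target.mem_nhds (by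
          rw [hγy]
          exact c.map_source hys))
      filter_upwards [h1] with z hz
      rw [Function.comp_apply, ← hγ z]
      exact c.right_inv hz
    have hfd : fderiv ℝ (c ∘ P) y = _ :=
      hev.fderiv_eq.trans (hasFDerivAt_affineIsometryEquiv γ y).fderiv
    show 0 < (fderiv ℝ (c ∘ P) y).det
    rw [hfd]
    exact h γ hγ

lemma IsSmoothChart.contDiffAt_comp (hP : ∀ x, IsLocalIso ρ P x) (hρ : 0 < ρ)
    (hφ : IsSmoothChart φ) {x : EuclideanSpace ℝ (Fin n)} (hx : P x ∈ φ.source) :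
    ContDiffAt ℝ ∞ (φ ∘ P) x :=
  (hφ _ (hP x).isFlatChart_chart).1.contDiffAt
    (((hP x).chart.symm ≫ₕ φ).open_source.mem_nhds ⟨Metric.mem_ball_self hρ, hx⟩)

lemma IsSmoothChart.contDiffAt_chart_comp (hP : ∀ x, IsLocalIso ρ P x) (hρ : 0 < ρ)
    (hφ : IsSmoothChart φ) {x : EuclideanSpace ℝ (Fin n)} (hx : P x ∈ φ.source) :
    ContDiffAt ℝ ∞ ((hP x).chart ∘ φ.symm) (φ (P x)) :=
  (hφ _ (hP x).isFlatChart_chart).2.contDiffAt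
    ((φ.symm ≫ₕ (hP x).chart).open_source.mem_nhds ⟨φ.map_source hx, by
      show φ.symm (φ (P x)) ∈ Metric.ball (P x) ρ
      rw [φ.left_inv hx]
      exact Metric.mem_ball_self hρ⟩)

/-- The chain rule for `f ∘ P = (f ∘ φ.symm) ∘ (φ ∘ P)` near a point over the domain of the
chart `φ`. -/
lemma IsSmoothChart.det_fderiv_comp (hP : ∀ x, IsLocalIso ρ P x) (hρ : 0 < ρ)
    (hφ : IsSmoothChart φ) {f : M → EuclideanSpace ℝ (Fin n)} {x : EuclideanSpace ℝ (Fin n)}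
    (hx : P x ∈ φ.source) (hf : DifferentiableAt ℝ (f ∘ P) x) :
    (fderiv ℝ (f ∘ P) x).det =
      (fderiv ℝ (f ∘ φ.symm) (φ (P x))).det * (fderiv ℝ (φ ∘ P) x).det := by
  set c := (hP x).chart
  have hcx : c (P x) = x := c.right_inv (Metric.mem_ball_self hρ)
  have hlim : Tendsto φ.symm (𝓝 (φ (P x))) (𝓝 (P x)) := by
    have := φ.continuousOn_symm.continuousAt (φ.open_target.mem_nhds (φ.map_source hx))
    rwa [ContinuousAt, φ.left_inv hx] at this
  have h1 : f ∘ φ.symm =ᶠ[𝓝 (φ (P x))] (f ∘ P) ∘ (c ∘ φ.symm) := by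
    filter_upwards [hlim.eventually (c.open_source.mem_nhds (Metric.mem_ball_self hρ))] with z hz
    exact congrArg f (c.left_inv hz).symm
  have hcφ : (c ∘ φ.symm) (φ (P x)) = x := by
    rw [Function.comp_apply, φ.left_inv hx, hcx]
  have h2 : DifferentiableAt ℝ (f ∘ φ.symm) (φ (P x)) := by
    refine DifferentiableAt.congr_of_eventuallyEq (DifferentiableAt.comp _ ?_
      ((hφ.contDiffAt_chart_comp hP hρ hx).differentiableAt (by simp))) h1
    rw [hcφ]
    exact hf
  have h3 : f ∘ P =ᶠ[𝓝 x] (f ∘ φ.symm) ∘ (φ ∘ P) := by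
    filter_upwards [((hP x).continuousAt hρ).eventually (φ.open_source.mem_nhds hx)] with z hz
    exact congrArg f (φ.left_inv hz).symm
  have h4 : fderiv ℝ ((f ∘ φ.symm) ∘ (φ ∘ P)) x =
      (fderiv ℝ (f ∘ φ.symm) (φ (P x))).comp (fderiv ℝ (φ ∘ P) x) :=
    fderiv_comp x h2 ((hφ.contDiffAt_comp hP hρ hx).differentiableAt (by simp))
  rw [h3.fderiv_eq, h4]
  exact LinearMap.det_comp _ _

lemma IsSmoothChart.det_fderiv_ne_zero (hP : ∀ x, IsLocalIso ρ P x) (hρ : 0 < ρ)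
    (hφ : IsSmoothChart φ) {x : EuclideanSpace ℝ (Fin n)} (hx : P x ∈ φ.source) :
    (fderiv ℝ (φ ∘ P) x).det ≠ 0 := by
  set c := (hP x).chart
  have h1 : c ∘ P =ᶠ[𝓝 x] id := by
    filter_upwards [Metric.ball_mem_nhds x hρ] with z hz
    exact c.right_inv hz
  have h2 := hφ.det_fderiv_comp hP hρ (f := c) hx
    (differentiableAt_id.congr_of_eventuallyEq h1)
  rw [h1.fderiv_eq, fderiv_id] at h2
  intro h0
  rw [h0, mul_zero] at h2
  exact one_ne_zero (LinearMap.det_id.symm.trans h2)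

/-- The sign of the Jacobian determinant of the covering with respect to an oriented atlas is
locally constant, hence constant; this forces deck transformations to preserve the orientation. -/
lemma det_pos_of_orientable (hP : ∀ x, IsLocalIso ρ P x) (hρ : 0 < ρ) (h : Orientable n M)
    {γ : EuclideanSpace ℝ (Fin n) ≃ᵃⁱ[ℝ] EuclideanSpace ℝ (Fin n)} (hγ : γ ∈ deckGroup P) :
    0 < LinearMap.det (γ.linearIsometryEquiv.toLinearEquiv :
      EuclideanSpace ℝ (Fin n) →ₗ[ℝ] EuclideanSpace ℝ (Fin n)) := by
  obtain ⟨A, hA, hcov, hdet⟩ := h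
  have hcompat : ∀ φ ∈ A, ∀ ψ ∈ A, ∀ x, P x ∈ φ.source → P x ∈ ψ.source →
      0 < (fderiv ℝ (φ ∘ P) x).det → 0 < (fderiv ℝ (ψ ∘ P) x).det := by
    intro φ hφ ψ hψ x hxφ hxψ hpos
    rw [(hA φ hφ).det_fderiv_comp hP hρ hxφ
      (((hA ψ hψ).contDiffAt_comp hP hρ hxψ).differentiableAt (by simp))]
    refine mul_pos (hdet φ hφ ψ hψ _ ⟨φ.map_source hxφ, ?_⟩) hpos
    show φ.symm (φ (P x)) ∈ ψ.source
    rwa [φ.left_inv hxφ]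
  have hcont : ∀ φ ∈ A, ∀ x, P x ∈ φ.source →
      ContinuousAt (fun y => (fderiv ℝ (φ ∘ P) y).det) x := by
    intro φ hφ x hx
    have h1 : ContinuousAt (fderiv ℝ (φ ∘ P)) x :=
      (((hA φ hφ).contDiffAt_comp hP hρ hx).fderiv_right (m := 0) (by simp)).continuousAt
    exact ContinuousLinearMap.continuous_det.continuousAt.comp h1
  have hsource : ∀ φ ∈ A, ∀ x, P x ∈ φ.source → ∀ᶠ y in 𝓝 x, P y ∈ φ.source := fun φ _ x hx =>
    ((hP x).continuousAt hρ).eventually (φ.open_source.mem_nhds hx)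
  -- where the covering preserves the orientation given by the atlas
  set U : Set (EuclideanSpace ℝ (Fin n)) :=
    {x | ∃ φ ∈ A, P x ∈ φ.source ∧ 0 < (fderiv ℝ (φ ∘ P) x).det} with hU
  have hUmem : ∀ φ ∈ A, ∀ x, P x ∈ φ.source → (x ∈ U ↔ 0 < (fderiv ℝ (φ ∘ P) x).det) :=
    fun φ hφ x hx => ⟨fun ⟨ψ, hψ, hxψ, hpos⟩ => hcompat ψ hψ φ hφ x hxψ hx hpos,
      fun hpos => ⟨φ, hφ, hx, hpos⟩⟩
  have hUopen : IsOpen U := by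
    rw [isOpen_iff_mem_nhds]
    rintro x ⟨φ, hφ, hx, hpos⟩
    filter_upwards [hsource φ hφ x hx, (hcont φ hφ x hx).eventually (lt_mem_nhds hpos)]
      with y hy hy' using ⟨φ, hφ, hy, hy'⟩
  have hUclosed : IsClosed U := by
    rw [← isOpen_compl_iff, isOpen_iff_mem_nhds]
    intro x hx
    obtain ⟨φ, hφ, hxφ⟩ := hcov (P x)
    have hneg : (fderiv ℝ (φ ∘ P) x).det < 0 :=
      lt_of_le_of_ne (not_lt.1 fun hpos => hx ((hUmem φ hφ x hxφ).2 hpos))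
        ((hA φ hφ).det_fderiv_ne_zero hP hρ hxφ)
    filter_upwards [hsource φ hφ x hxφ, (hcont φ hφ x hxφ).eventually (gt_mem_nhds hneg)]
      with y hy hy'
    rw [Set.mem_compl_iff, hUmem φ hφ y hy]
    exact not_lt.2 hy'.le
  have hconst : (0 : EuclideanSpace ℝ (Fin n)) ∈ U ↔ γ 0 ∈ U := by
    rcases isClopen_iff.1 ⟨hUclosed, hUopen⟩ with h0 | h1
    · simp [h0]
    · simp [h1]
  obtain ⟨φ, hφ, h0φ⟩ := hcov (P 0)
  have h0φ' : P (γ 0) ∈ φ.source := by rwa [hγ 0]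
  have hchain : fderiv ℝ (φ ∘ P) 0 = (fderiv ℝ (φ ∘ P) (γ 0)).comp
      (γ.linearIsometryEquiv.toContinuousLinearEquiv :
        EuclideanSpace ℝ (Fin n) →L[ℝ] EuclideanSpace ℝ (Fin n)) := by
    have h1 : (φ ∘ P) ∘ γ = φ ∘ P := funext fun x => congrArg φ (hγ x)
    have h2 := (((hA φ hφ).contDiffAt_comp hP hρ h0φ').differentiableAt
      (by simp)).hasFDerivAt.comp 0 (hasFDerivAt_affineIsometryEquiv γ 0)
    rw [h1] at h2
    exact h2.fderiv
  have hdetmul : (fderiv ℝ (φ ∘ P) 0).det = (fderiv ℝ (φ ∘ P) (γ 0)).det *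
      LinearMap.det (γ.linearIsometryEquiv.toLinearEquiv :
        EuclideanSpace ℝ (Fin n) →ₗ[ℝ] EuclideanSpace ℝ (Fin n)) := by
    rw [hchain]
    exact LinearMap.det_comp _ _
  have hne := (hA φ hφ).det_fderiv_ne_zero hP hρ h0φ
  have hne' := (hA φ hφ).det_fderiv_ne_zero hP hρ h0φ'
  rw [hUmem φ hφ 0 h0φ, hUmem φ hφ (γ 0) h0φ'] at hconst
  rcases hne'.lt_or_gt with hlt | hgt
  · have h3 := lt_of_le_of_ne (not_lt.1 fun hpos => hlt.not_gt (hconst.1 hpos)) hne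
    rw [hdetmul] at h3
    exact pos_of_mul_neg_right h3 hlt.le
  · have h3 := hconst.2 hgt
    rw [hdetmul] at h3
    exact (pos_iff_pos_of_mul_pos h3).1 hgt

/-- The data of a compact flat manifold in terms of its deck group. -/
theorem IsCompactFlatManifold.exists_deckGroup (hM : IsCompactFlatManifold n M) :
    ∃ Γ : Subgroup (EuclideanSpace ℝ (Fin n) ≃ᵃⁱ[ℝ] EuclideanSpace ℝ (Fin n)),
      IsFreeCocompact Γ ∧
      (∀ lam, finrank ℝ (laplaceEigenspace n M lam) = finrank ℝ (invariantEigenspace Γ lam)) ∧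
      (Orientable n M ↔ ∀ γ ∈ Γ, 0 < LinearMap.det (γ.linearIsometryEquiv.toLinearEquiv :
        EuclideanSpace ℝ (Fin n) →ₗ[ℝ] EuclideanSpace ℝ (Fin n))) := by
  have := hM.compact
  have := hM.connected
  obtain ⟨ρ, hρ, P, hP⟩ := hM.exists_covering
  have hsurj := surjective_of_isLocalIso hP hρ
  exact ⟨deckGroup P, isFreeCocompact_deckGroup hP hρ, finrank_laplaceEigenspace hP hρ hsurj,
    fun h _ hγ => det_pos_of_orientable hP hρ h hγ, orientable_of_forall_det_pos hP hρ hsurj⟩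

end Orientability

end FlatManifold

theorem corollary4p3 {n n' : ℕ} {M M' : Type*} [MetricSpace M] [MetricSpace M']
    (hM : FlatManifold.IsCompactFlatManifold n M)
    (hM' : FlatManifold.IsCompactFlatManifold n' M')
    (hiso : FlatManifold.Isospectral n M n' M') :
    FlatManifold.Orientable n M ↔ FlatManifold.Orientable n' M' := by
  obtain ⟨Γ, hΓ, hfin, hor⟩ := hM.exists_deckGroup
  obtain ⟨Γ', hΓ', hfin', hor'⟩ := hM'.exists_deckGroup
  rw [hor, hor']
  refine FlatManifold.forall_det_pos_iff hΓ hΓ' fun lam => ?_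
  obtain ⟨e⟩ := hiso lam
  rw [← hfin, ← hfin', e.finrank_eq]
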